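/- Let $L=\left\{\begin{pmatrix} b& c\\ -a&-b\end{pmatrix}: a,b,c\in\mathbb Z\right\}$ be the even lattice of signature $(1,2)$ with $q(X)=\det X$ and $(X,Y)=q(X+Y)-q(X)-q(Y)$. For a lattice $M$ let $M'$ be its dual lattice, and let $\mathfrak e_X$ ($X\in M'$) be the standard basis vectors of $\mathbb C[M'/M]$. Write $e(x)=e^{2\pi i x}$, and let $\tau=u+iv$ and $z=x+iy$ be in the upper half-plane $\mathbb H$. Let $X_z$ and $X_{z^\perp}$ be the orthogonal projections of $X$ to the line spanned by $X(z)=\frac1{\sqrt2 y}\begin{pmatrix}-x&|z|^2\\-1&x\end{pmatrix}$ and to its orthogonal complement. Put $$\Theta_L(\tau,z)=v\sum_{X\in L'}e\big(q(X_z)\tau+q(X_{z^\perp})\overline\tau\big)\mathfrak e_X,\qquad R_0=2i\frac{\partial}{\partial z}.$$ Let $a,b,c\in\mathbb Z$ with $a>0$ be such that $D=b^2-4ac$ is positive and not a square. Let $A=\begin{pmatrix} b/2&c\\-a&-b/2\end{pmatrix}\in L'$, $I=L\cap(\mathbb QA)^\perp$ and $N=L\cap\mathbb QA$. Let $\Gamma=\mathrm{PSL}_2(\mathbb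 Z)$ act by $g.X=gXg^{-1}$, let $\Gamma_A$ be the stabilizer of $A$ in $\Gamma$, and let $S_A=\{z\in\mathbb H: a|z|^2+bx+c=0\}$, oriented counter-clockwise. For $f$ transforming with weight $2$ for $\Gamma$ put $\mathcal C_A(f)=\int_{\Gamma_A\backslash S_A}f(z)\,dz$. Let $w=\frac{-b-\sqrt D}{2a}$, $Y_0=\begin{pmatrix}-w&w^2\\-1&w\end{pmatrix}$, and define $$\vartheta_I(\tau)=\sum_{\substack{Y\in\Gamma_A\backslash I'\\ q(Y)>0}}\frac{\operatorname{sgn}(Y,Y_0)}{|\Gamma_Y|}\,e(q(Y)\tau)\,\mathfrak e_Y,\qquad \Theta_{3/2,N}(\tau)=\sum_{W\in N'}(W,A)\,e(-q(W)\tau)\,\mathfrak e_W,$$ where $\Gamma_Y$ is the stabilizer of $Y$ in $\Gamma_A$. Let $\mathfrak e_Y\otimes\mathfrak e_W=\mathfrak e_{Y+W}$ for $Y\in I'$, $W\in N'$. For $g\in\mathbb C[(I\oplus N)'/(I\oplus N)]$ let $g^L\in\mathbb C[L'/L]$ be given by $(g^L)_\gamma=\sum_{\beta\in L/(I\oplus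 N)}g_{\beta+\gamma}$. Then, for every $\tau\in\mathbb H$, the three series above converge absolutely, $\Theta_L(\tau,z)$ is real-differentiable in $z$, $I\oplus N$ has finite index in $L$, the cycle integral below converges absolutely, and $$\mathcal C_A\big(R_0\Theta_L(\tau,\cdot)\big)=-\frac{4\pi}{\sqrt D}\Big(\vartheta_I(\tau)\otimes\overline{\Theta_{3/2,N}(\tau)}\,v^{3/2}\Big)^L .$$ -/

import Mathlib

open scoped MatrixGroups UpperHalfPlane

noncomputable section

namespace SiegelTheta

/-- The ambient space of real `2 × 2` matrices. The quadratic space of signature `(1,2)` is its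
subspace of matrices of trace zero, the real span of the lattice `latticeL`. -/
abbrev V : Type := Matrix (Fin 2) (Fin 2) ℝ

/-- The quadratic form `q(X) = det X`. -/
def q (X : V) : ℝ := X.det

/-- The bilinear form `(X, Y) = q(X + Y) - q(X) - q(Y)`, so that `(X, X) = 2 q(X)`. -/
def bil (X Y : V) : ℝ := QuadraticMap.polar q X Y

/-- The matrix of the binary quadratic form `[a, b, c]`. -/
def formMatrix (a b c : ℝ) : V := !![b / 2, c; -a, -b / 2]

lemma bil_eq (X Y : V) :
    bil X Y = X 0 0 * Y 1 1 + Y 0 0 * X 1 1 - X 0 1 * Y 1 0 - Y 0 1 * X 1 0 := by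
  simp only [bil, QuadraticMap.polar, q, Matrix.det_fin_two, Matrix.add_apply]
  ring

lemma bil_add_left (X Y Z : V) : bil (X + Y) Z = bil X Z + bil Y Z := by
  simp only [bil_eq, Matrix.add_apply]; ring

lemma bil_neg_left (X Z : V) : bil (-X) Z = -bil X Z := by
  simp only [bil_eq, Matrix.neg_apply]; ring

lemma bil_zero_left (Z : V) : bil 0 Z = 0 := by
  simp [bil_eq]

/-- The even lattice `L` of all `(b, c; -a, -b)` with `a, b, c ∈ ℤ`. -/
def latticeL : AddSubgroup V where
  carrier := {X | ∃ a b c : ℤ, X = !![(b : ℝ), (c : ℝ); -(a : ℝ), -(b : ℝ)]}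
  zero_mem' := ⟨0, 0, 0, by ext i j; fin_cases i <;> fin_cases j <;> simp⟩
  add_mem' := by
    rintro _ _ ⟨a, b, c, rfl⟩ ⟨a', b', c', rfl⟩
    refine ⟨a + a', b + b', c + c', ?_⟩
    ext i j; fin_cases i <;> fin_cases j <;> simp <;> ring
  neg_mem' := by
    rintro _ ⟨a, b, c, rfl⟩
    refine ⟨-a, -b, -c, ?_⟩
    ext i j; fin_cases i <;> fin_cases j <;> simp

/-- The sublattice `I = L ∩ (ℚ A)^⊥`. -/
def latticeI (A : V) : AddSubgroup V where
  carrier := {X | X ∈ latticeL ∧ bil X A = 0}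
  zero_mem' := ⟨zero_mem _, bil_zero_left A⟩
  add_mem' := fun hX hY => ⟨add_mem hX.1 hY.1, by rw [bil_add_left, hX.2, hY.2, add_zero]⟩
  neg_mem' := fun hX => ⟨neg_mem hX.1, by rw [bil_neg_left, hX.2, neg_zero]⟩

/-- The sublattice `N = L ∩ ℚ A`. -/
def latticeN (A : V) : AddSubgroup V where
  carrier := {X | X ∈ latticeL ∧ ∃ r : ℚ, X = (r : ℝ) • A}
  zero_mem' := ⟨zero_mem _, 0, by simp⟩
  add_mem' := by
    rintro X Y ⟨hX, r, hr⟩ ⟨hY, s, hs⟩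
    exact ⟨add_mem hX hY, r + s, by rw [hr, hs]; push_cast; rw [add_smul]⟩
  neg_mem' := by
    rintro X ⟨hX, r, hr⟩
    exact ⟨neg_mem hX, -r, by rw [hr]; push_cast; rw [neg_smul]⟩

/-- The dual lattice `M' = {X ∈ M ⊗ ℝ : (X, Y) ∈ ℤ for all Y ∈ M}`. -/
def dual (M : AddSubgroup V) : AddSubgroup V where
  carrier := {X | X ∈ Submodule.span ℝ (M : Set V) ∧ ∀ Y ∈ M, ∃ n : ℤ, bil X Y = n}
  zero_mem' := ⟨zero_mem _, fun Y _ => ⟨0, by rw [bil_zero_left]; simp⟩⟩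
  add_mem' := by
    rintro X X' ⟨hX, h⟩ ⟨hX', h'⟩
    refine ⟨add_mem hX hX', fun Y hY => ?_⟩
    obtain ⟨n, hn⟩ := h Y hY
    obtain ⟨m, hm⟩ := h' Y hY
    exact ⟨n + m, by rw [bil_add_left, hn, hm]; push_cast; rfl⟩
  neg_mem' := by
    rintro X ⟨hX, h⟩
    refine ⟨neg_mem hX, fun Y hY => ?_⟩
    obtain ⟨n, hn⟩ := h Y hY
    exact ⟨-n, by rw [bil_neg_left, hn]; push_cast; rfl⟩

/-- The discriminant group `M' / M`. -/
abbrev Disc (M : AddSubgroup V) : Type := dual M ⧸ M.addSubgroupOf (dual M)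

/-- The underlying space of the group ring `ℂ[M'/M]`: the function `g` stands for
`∑_γ g(γ) 𝔢_γ`. -/
abbrev GroupRing (M : AddSubgroup V) : Type := Disc M → ℂ

/-- The class `X + M` of `X ∈ M'`. -/
def toDisc (M : AddSubgroup V) (X : dual M) : Disc M := QuotientAddGroup.mk X

open Classical in
/-- The coefficient `g_X = g_{X + M}` for `X ∈ M'` (and `0` for a vector `X` outside `M'`). -/
def coeff {M : AddSubgroup V} (g : GroupRing M) (X : V) : ℂ :=
  if h : X ∈ dual M then g (toDisc M ⟨X, h⟩) else 0

/-- The map `g ↦ g^L` from `ℂ[M'/M]` to `ℂ[L'/L]` for a sublattice `M ⊆ L` of finite index: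
`(g^L)_γ = ∑_{β ∈ L/M} g_{β + γ}`. -/
def up {M : AddSubgroup V} (L : AddSubgroup V) (g : GroupRing M) : GroupRing L := fun γ =>
  ∑ᶠ β : L ⧸ M.addSubgroupOf L,
    coeff g ((Quotient.out β : L) + (Quotient.out γ : dual L) : V)

/-- The orthogonal projection of `X` to the line spanned by `A`. -/
def projLine (A X : V) : V := (bil X A / bil A A) • A

/-- The orthogonal projection of `X` to the orthogonal complement of `A`. -/
def projPerp (A X : V) : V := X - projLine A X

/-- The tensor product `ℂ[I'/I] × ℂ[N'/N] → ℂ[(I ⊕ N)'/(I ⊕ N)]`, determined by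
`𝔢_Y ⊗ 𝔢_W = 𝔢_{Y + W}`: the coefficient of `f ⊗ h` at `X = Y + W` with `Y ∈ I'` and `W ∈ N'`
is `f_Y h_W`. -/
def tensor (A : V) (f : GroupRing (latticeI A)) (h : GroupRing (latticeN A)) :
    GroupRing (latticeI A ⊔ latticeN A) := fun δ =>
  coeff f (projPerp A (Quotient.out δ : dual (latticeI A ⊔ latticeN A))) *
    coeff h (projLine A (Quotient.out δ : dual (latticeI A ⊔ latticeN A)))

/-- `e(x) = exp(2πix)`. -/
def e (x : ℂ) : ℂ := Complex.exp (2 * Real.pi * Complex.I * x)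

/-- The vector `X(z)`, which spans the positive line attached to `z`. -/
def posVec (z : ℂ) : V :=
  (1 / (√2 * z.im)) • !![-z.re, ‖z‖ ^ 2; -1, z.re]

/-- The summand of index `X` of the Siegel theta function (without the factor `v`),
`e(q(X_z) τ + q(X_{z^⊥}) \bar τ)`, where `X_z` and `X_{z^⊥}` are the orthogonal projections of `X`
to the line spanned by `X(z)` and to its orthogonal complement. -/
def siegelTerm (τ : ℍ) (z : ℂ) (X : V) : ℂ :=
  e ((q (projLine (posVec z) X) : ℂ) * τ +
    (q (projPerp (posVec z) X) : ℂ) * (starRingEnd ℂ) (τ : ℂ))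

/-- The Siegel theta function `Θ_L(τ, z) = v ∑_{X ∈ L'} e(q(X_z) τ + q(X_{z^⊥}) \bar τ) 𝔢_X`,
for `z` in the upper half-plane (as a subset of `ℂ`). -/
def siegelTheta (τ : ℍ) (z : ℂ) : GroupRing latticeL := fun γ =>
  (τ.im : ℂ) * ∑' X : {X : dual latticeL // toDisc latticeL X = γ}, siegelTerm τ z X.1

/-- The Wirtinger derivative `∂f/∂z = (∂f/∂x - i ∂f/∂y) / 2`. -/
def dWirtinger (f : ℂ → ℂ) (z : ℂ) : ℂ :=
  (fderiv ℝ f z 1 - Complex.I * fderiv ℝ f z Complex.I) / 2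

/-- The raising operator `R_κ = 2i ∂/∂z + κ / y`. -/
def raising (κ : ℝ) (f : ℂ → ℂ) (z : ℂ) : ℂ :=
  2 * Complex.I * dWirtinger f z + (κ : ℂ) / (z.im : ℂ) * f z

/-- The action `g.X = g X g⁻¹` of `SL₂(ℤ)`. -/
def conj (g : SL(2, ℤ)) (X : V) : V :=
  (g : Matrix (Fin 2) (Fin 2) ℤ).map (Int.cast : ℤ → ℝ) * X *
    ((g⁻¹ : SL(2, ℤ)) : Matrix (Fin 2) (Fin 2) ℤ).map (Int.cast : ℤ → ℝ)

lemma conj_one (X : V) : conj 1 X = X := by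
  simp [conj, Matrix.map_one]

lemma conj_mul (g h : SL(2, ℤ)) (X : V) : conj (g * h) X = conj g (conj h X) := by
  simp only [conj, mul_inv_rev, Matrix.SpecialLinearGroup.coe_mul]
  rw [show (Int.cast : ℤ → ℝ) = (Int.castRingHom ℝ : ℤ → ℝ) from rfl, Matrix.map_mul,
    Matrix.map_mul]
  simp only [Matrix.mul_assoc]

lemma conj_inv_eq {g : SL(2, ℤ)} {X Y : V} (h : conj g X = Y) : conj g⁻¹ Y = X := by
  rw [← h, ← conj_mul, inv_mul_cancel, conj_one]

/-- The stabilizer of `X` in `SL₂(ℤ)`. Its image in `PSL₂(ℤ)` is the group `Γ_X`. -/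
def stab (X : V) : Subgroup SL(2, ℤ) where
  carrier := {g | conj g X = X}
  one_mem' := conj_one X
  mul_mem' := by
    intro g h hg hh
    change conj (g * h) X = X
    rw [conj_mul, hh, hg]
  inv_mem' := by
    intro g hg
    exact conj_inv_eq hg

/-- The order of the stabilizer of `Y` in `Γ_A ⊆ PSL₂(ℤ)`. -/
def stabOrder (A Y : V) : ℕ :=
  Nat.card ((stab A ⊓ stab Y).map
    (QuotientGroup.mk' (Subgroup.center SL(2, ℤ))) :
      Subgroup (Matrix.ProjectiveSpecialLinearGroup (Fin 2) ℤ))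

/-- The vectors `Y ∈ I'` with `q(Y) > 0` in the class `γ ∈ I'/I`. -/
abbrev HeckeIndex (A : V) (γ : Disc (latticeI A)) : Type :=
  {Y : dual (latticeI A) // toDisc (latticeI A) Y = γ ∧ 0 < q Y}

/-- Equivalence of vectors under `Γ_A`. -/
def heckeSetoid (A : V) (γ : Disc (latticeI A)) : Setoid (HeckeIndex A γ) where
  r Y Y' := ∃ g ∈ stab A, conj g (Y.1 : V) = (Y'.1 : V)
  iseqv :=
    { refl := fun Y => ⟨1, one_mem _, conj_one _⟩
      symm := by
        rintro Y Y' ⟨g, hg, h⟩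
        exact ⟨g⁻¹, inv_mem hg, conj_inv_eq h⟩
      trans := by
        rintro Y Y' Y'' ⟨g, hg, h⟩ ⟨g', hg', h'⟩
        exact ⟨g' * g, mul_mem hg' hg, by rw [conj_mul, h, h']⟩ }

/-- The smaller real endpoint `w = (-b - √D) / (2a)` of the geodesic of `[a, b, c]`, `a > 0`. -/
def endpoint (a b c : ℝ) : ℝ := (-b - √(b ^ 2 - 4 * a * c)) / (2 * a)

/-- The vector `Y₀ = (-w, w²; -1, w)`. -/
def vecY0 (a b c : ℝ) : V :=
  !![-endpoint a b c, endpoint a b c ^ 2; -1, endpoint a b c]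

/-- The summand `sgn(Y, Y₀) / |Γ_Y| · e(q(Y) τ)` of Hecke's theta series; it only depends on the
`Γ_A`-orbit of `Y`. -/
def heckeTerm (a b c : ℝ) (τ : ℍ) (Y : V) : ℂ :=
  ((bil Y (vecY0 a b c)).sign : ℂ) / (stabOrder (formMatrix a b c) Y : ℂ) * e ((q Y : ℂ) * τ)

/-- Hecke's indefinite theta series
`ϑ_I(τ) = ∑_{Y ∈ Γ_I \ I', q(Y) > 0} sgn(Y, Y₀) / |Γ_Y| · e(q(Y) τ) 𝔢_Y`, with `Γ_I = Γ_A`. -/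
def heckeTheta (a b c : ℝ) (τ : ℍ) : GroupRing (latticeI (formMatrix a b c)) := fun γ =>
  ∑' Y : Quotient (heckeSetoid (formMatrix a b c) γ),
    heckeTerm a b c τ (Quotient.out Y).1

/-- The summand `(W, A) e(-q(W) τ)` of the unary theta series. -/
def unaryTerm (A : V) (τ : ℍ) (W : V) : ℂ := (bil W A : ℂ) * e (-(q W : ℂ) * τ)

/-- The unary theta series `Θ_{3/2,N}(τ) = ∑_{W ∈ N'} (W, A) e(-q(W) τ) 𝔢_W`. -/
def unaryTheta (A : V) (τ : ℍ) : GroupRing (latticeN A) := fun γ =>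
  ∑' W : {W : dual (latticeN A) // toDisc (latticeN A) W = γ}, unaryTerm A τ W.1

/-- The geodesic `S_A = {z ∈ ℍ : a|z|² + b Re(z) + c = 0}`. -/
def geodesic (a b c : ℝ) : Set ℍ := {z | a * ‖(z : ℂ)‖ ^ 2 + b * z.re + c = 0}

/-- The parametrization by hyperbolic arc length of the semicircle `S_A`, `a > 0`, with centre
`-b/(2a)` and radius `√D/(2a)`, oriented counter-clockwise, that is, from the larger to the smaller
real endpoint. -/
def geodesicPath (a b c : ℝ) (s : ℝ) : ℂ :=
  ((-b / (2 * a) - √(b ^ 2 - 4 * a * c) / (2 * a) * Real.tanh s : ℝ) : ℂ) +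
    ((√(b ^ 2 - 4 * a * c) / (2 * a) / Real.cosh s : ℝ) : ℂ) * Complex.I

/-- `F` is a (measurable, strict) fundamental domain for the action of `Γ_A` on `S_A`: it contains
exactly one point of each orbit. -/
def IsFundDomain (a b c : ℝ) (F : Set ℍ) : Prop :=
  F ⊆ geodesic a b c ∧ MeasurableSet F ∧
    ∀ z ∈ geodesic a b c, ∃! z' : ℍ, z' ∈ F ∧ ∃ g ∈ stab (formMatrix a b c), g • z = z'

/-- The parameters of the points of `F ⊆ S_A`. -/
def params (a b c : ℝ) (F : Set ℍ) : Set ℝ := {s | ∃ z ∈ F, (z : ℂ) = geodesicPath a b c s}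

/-- The integrand of the cycle integral of a function of weight `2k` along `S_A`, in the parameter
of the geodesic: `f(z) A(z, 1)^{k-1} dz` with `A(z, 1) = a z² + b z + c`. -/
def cycleIntegrand (a b c : ℝ) (k : ℤ) (f : ℂ → ℂ) (s : ℝ) : ℂ :=
  f (geodesicPath a b c s) *
    ((a : ℂ) * geodesicPath a b c s ^ 2 + (b : ℂ) * geodesicPath a b c s + (c : ℂ)) ^ (k - 1) *
      deriv (geodesicPath a b c) s

/-- `C_A(f) = ∫_{Γ_A \ S_A} f(z) A(z, 1)^{k-1} dz` exists and equals `I₀`: the quotient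
`Γ_A \ S_A` has a fundamental domain, and on each of them the line integral converges absolutely
and has the value `I₀`. -/
def HasCycleIntegral (a b c : ℝ) (k : ℤ) (f : ℂ → ℂ) (I₀ : ℂ) : Prop :=
  (∃ F : Set ℍ, IsFundDomain a b c F) ∧
    ∀ F : Set ℍ, IsFundDomain a b c F →
      MeasureTheory.IntegrableOn (cycleIntegrand a b c k f) (params a b c F) ∧
        ∫ s in params a b c F, cycleIntegrand a b c k f s = I₀

end SiegelTheta

end

open SiegelTheta

namespace SiegelTheta

/-! ### The bilinear form -/

/-! Write `w < w'` for the endpoints of `S_A`, `Y₀`, `Y₁` for the isotropic vectors attached to them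
and `r` for the radius. On `S_A`, in arc length `s`, one has `X(z) = κ (e^s Y₀ + e^{-s} Y₁)` with `κ
= 1/(2√2 r)` (`posVec_geodesicPath`), and `Y₀`, `Y₁` are orthogonal to `A`. For `X = Y + W` with `Y
∈ I'`, `W ∈ N'`, the product `p = (X, X(z))` is therefore `κ (m e^s + n e^{-s})` with `m = (Y, Y₀)`,
`n = (Y, Y₁)`, and does not see `W`. The Siegel summand is `e(q(Y) τ̄) e(q(W) τ̄) exp(-2πv p²)`.

Multiplied by `dz/ds`, the operator `∂_x - i ∂_y` turns `p` into `p' - i √2 (W, A)/√D`: a tangential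
and a normal derivative (`deriv_posVec_geodesicPath`). So the integrand has a part with `p p'
exp(-2πv p²)`, an exact derivative that integrates to zero, and a part with `(W, A) p exp(-2πv p²)`.
Since `p'' = p` and `p² = p'² + 2q(Y)`, the second is a Gaussian in the variable `p'`. Over the
whole line it gives `exp(-4πv q(Y)) (sgn m + sgn n)/2 · 1/√(2v)`, and the exponential changes
`e(q(Y) τ̄)` into `e(q(Y) τ)` (`integral_kernel`, `integral_kernel_eq`). For `q(Y) > 0` the signs
agree and give `sgn(Y, Y₀)`; for `q(Y) < 0` they cancel; `q(Y) = 0` forces `Y = 0` because `D` is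
not a square (`eq_zero_of_q_eq_zero`).

The whole line appears by unfolding (`hasSum_integral_unfold`). Modulo `±1`, `Γ_A` is infinite
cyclic (`exists_generator`); it translates `s`, acts trivially on `I'/I`, and acts freely on the `Y`
with `q(Y) ≠ 0`. Finally, a class of `L'/L` is the disjoint union, over `L/(I ⊕ N)`, of products of
a class of `I'/I` and a class of `N'/N` (`bijective_cosetMap`), which produces the tensor product
and the map `g ↦ g^L`. All interchanges of sum, derivative and integral rest on Gaussian bounds from
the positive definite majorant `(X, X(z))² - q(X)` (`sqNorm_le`). -/

lemma bil_comm (X Y : V) : bil X Y = bil Y X := by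
  simp only [bil_eq]; ring

lemma bil_add_right (X Y Z : V) : bil X (Y + Z) = bil X Y + bil X Z := by
  simp only [bil_eq, Matrix.add_apply]; ring

lemma bil_smul_left (r : ℝ) (X Y : V) : bil (r • X) Y = r * bil X Y := by
  simp only [bil_eq, Matrix.smul_apply, smul_eq_mul]; ring

lemma bil_smul_right (r : ℝ) (X Y : V) : bil X (r • Y) = r * bil X Y := by
  simp only [bil_eq, Matrix.smul_apply, smul_eq_mul]; ring

lemma bil_sub_left (X Y Z : V) : bil (X - Y) Z = bil X Z - bil Y Z := by
  simp only [bil_eq, Matrix.sub_apply]; ring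

lemma q_eq (X : V) : q X = X 0 0 * X 1 1 - X 0 1 * X 1 0 := Matrix.det_fin_two X

lemma bil_self (X : V) : bil X X = 2 * q X := by
  simp only [bil_eq, q_eq]; ring

lemma q_smul (r : ℝ) (X : V) : q (r • X) = r ^ 2 * q X := by
  simp only [q_eq, Matrix.smul_apply, smul_eq_mul]; ring

lemma q_add (X Y : V) : q (X + Y) = q X + q Y + bil X Y := by
  simp only [q_eq, bil_eq, Matrix.add_apply]; ring

/-! ### The lattice `L` and its dual -/

lemma traceless_of_mem_span {X : V} (hX : X ∈ Submodule.span ℝ (latticeL : Set V)) :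
    X 1 1 = -X 0 0 := by
  induction hX using Submodule.span_induction with
  | mem X h => obtain ⟨a, b, c, rfl⟩ := h; simp
  | zero => simp
  | add X Y _ _ hX hY => simp only [Matrix.add_apply, hX, hY]; ring
  | smul r X _ hX => simp only [Matrix.smul_apply, hX, smul_eq_mul]; ring

lemma mem_latticeL_mk (α β γ : ℤ) : (!![(β : ℝ), (γ : ℝ); -(α : ℝ), -(β : ℝ)] : V) ∈ latticeL :=
  ⟨α, β, γ, rfl⟩

lemma mem_span_latticeL {X : V} (hX : X 1 1 = -X 0 0) :
    X ∈ Submodule.span ℝ (latticeL : Set V) := by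
  have h : X = X 0 0 • (!![((1 : ℤ) : ℝ), ((0 : ℤ) : ℝ); -((0 : ℤ) : ℝ), -((1 : ℤ) : ℝ)] : V) +
      X 0 1 • (!![((0 : ℤ) : ℝ), ((1 : ℤ) : ℝ); -((0 : ℤ) : ℝ), -((0 : ℤ) : ℝ)] : V) +
      (-X 1 0) • (!![((0 : ℤ) : ℝ), ((0 : ℤ) : ℝ); -((1 : ℤ) : ℝ), -((0 : ℤ) : ℝ)] : V) := by
    ext i j; fin_cases i <;> fin_cases j <;> simp [hX]
  rw [h]
  exact add_mem (add_mem (Submodule.smul_mem _ _ (Submodule.subset_span (mem_latticeL_mk ..)))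
    (Submodule.smul_mem _ _ (Submodule.subset_span (mem_latticeL_mk ..))))
    (Submodule.smul_mem _ _ (Submodule.subset_span (mem_latticeL_mk ..)))

lemma mem_dual_latticeL_iff {X : V} : X ∈ dual latticeL ↔
    ∃ α β γ : ℤ, X = !![(β : ℝ) / 2, (γ : ℝ); -(α : ℝ), -(β : ℝ) / 2] := by
  constructor
  · rintro ⟨hs, h⟩
    have ht := traceless_of_mem_span hs
    obtain ⟨n, hn⟩ := h _ (mem_latticeL_mk 0 1 0)
    obtain ⟨m, hm⟩ := h _ (mem_latticeL_mk 0 0 1)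
    obtain ⟨k, hk⟩ := h _ (mem_latticeL_mk 1 0 0)
    simp only [bil_eq, ht] at hn hm hk
    simp at hn hm hk
    refine ⟨m, -n, k, ?_⟩
    ext i j; fin_cases i <;> fin_cases j <;> simp [ht] <;> linarith
  · rintro ⟨α, β, γ, rfl⟩
    refine ⟨mem_span_latticeL (by simp; ring), ?_⟩
    rintro _ ⟨a, b, c, rfl⟩
    refine ⟨-(β * b) + α * c + γ * a, ?_⟩
    simp [bil_eq]; ring

lemma traceless_of_mem_dual {X : V} (hX : X ∈ dual latticeL) : X 1 1 = -X 0 0 :=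
  traceless_of_mem_span hX.1

lemma latticeL_le_dual : latticeL ≤ dual latticeL := by
  rintro _ ⟨a, b, c, rfl⟩
  refine mem_dual_latticeL_iff.2 ⟨a, 2 * b, c, ?_⟩
  ext i j; fin_cases i <;> fin_cases j <;> simp [neg_div]

lemma two_smul_mem_latticeL {X : V} (hX : X ∈ dual latticeL) : (2 : ℝ) • X ∈ latticeL := by
  obtain ⟨α, β, γ, rfl⟩ := mem_dual_latticeL_iff.1 hX
  refine ⟨2 * α, β, 2 * γ, ?_⟩
  ext i j; fin_cases i <;> fin_cases j <;> simp <;> ring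

lemma formMatrix_mem_dual (a b c : ℤ) : formMatrix a b c ∈ dual latticeL :=
  mem_dual_latticeL_iff.2 ⟨a, b, c, rfl⟩

lemma bil_formMatrix (a b c : ℝ) (X : V) :
    bil X (formMatrix a b c) = -(X 0 0 * b / 2) + X 1 1 * b / 2 + a * X 0 1 - c * X 1 0 := by
  simp [bil_eq, formMatrix]; ring

lemma bil_formMatrix_self (a b c : ℝ) :
    bil (formMatrix a b c) (formMatrix a b c) = -(b ^ 2 - 4 * a * c) / 2 := by
  simp [bil_eq, formMatrix]; ring

lemma exists_int_bil {X Y : V} (hX : X ∈ latticeL) (hY : Y ∈ dual latticeL) :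
    ∃ n : ℤ, bil X Y = n := by
  rw [bil_comm]; exact hY.2 X hX

lemma smul_int_mem {M : AddSubgroup V} {X : V} (hX : X ∈ M) (n : ℤ) : (n : ℝ) • X ∈ M := by
  rw [Int.cast_smul_eq_zsmul]; exact zsmul_mem hX n

/-! ### The action by conjugation -/

lemma conj_eq (g : SL(2, ℤ)) (X : V) : conj g X =
    !![(g 0 0 : ℝ), (g 0 1 : ℝ); (g 1 0 : ℝ), (g 1 1 : ℝ)] * X *
      !![(g 1 1 : ℝ), -(g 0 1 : ℝ); -(g 1 0 : ℝ), (g 0 0 : ℝ)] := by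
  rw [conj, Matrix.SpecialLinearGroup.SL2_inv_expl]
  congr 1
  · congr 1
    ext i j; fin_cases i <;> fin_cases j <;> simp
  · ext i j; fin_cases i <;> fin_cases j <;> simp [Matrix.map]

lemma det_cast (g : SL(2, ℤ)) : (g 0 0 : ℝ) * g 1 1 - g 0 1 * g 1 0 = 1 := by
  have := g.det_coe
  rw [Matrix.det_fin_two] at this
  exact_mod_cast this

lemma conj_apply (g : SL(2, ℤ)) (X : V) : conj g X =
    !![(g 0 0 * X 0 0 + g 0 1 * X 1 0) * g 1 1 - (g 0 0 * X 0 1 + g 0 1 * X 1 1) * g 1 0,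
      -((g 0 0 * X 0 0 + g 0 1 * X 1 0) * g 0 1) + (g 0 0 * X 0 1 + g 0 1 * X 1 1) * g 0 0;
      (g 1 0 * X 0 0 + g 1 1 * X 1 0) * g 1 1 - (g 1 0 * X 0 1 + g 1 1 * X 1 1) * g 1 0,
      -((g 1 0 * X 0 0 + g 1 1 * X 1 0) * g 0 1) + (g 1 0 * X 0 1 + g 1 1 * X 1 1) * g 0 0] := by
  rw [conj_eq]
  nth_rewrite 1 [Matrix.eta_fin_two X]
  simp only [Matrix.mul_fin_two]
  ext i j; fin_cases i <;> fin_cases j <;> simp <;> ring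

lemma conj_add (g : SL(2, ℤ)) (X Y : V) : conj g (X + Y) = conj g X + conj g Y := by
  simp only [conj, Matrix.mul_add, Matrix.add_mul]

lemma conj_smul (g : SL(2, ℤ)) (r : ℝ) (X : V) : conj g (r • X) = r • conj g X := by
  simp only [conj, Matrix.mul_smul, Matrix.smul_mul]

lemma conj_sub (g : SL(2, ℤ)) (X Y : V) : conj g (X - Y) = conj g X - conj g Y := by
  simp only [conj, Matrix.mul_sub, Matrix.sub_mul]

lemma q_conj (g : SL(2, ℤ)) (X : V) : q (conj g X) = q X := by
  rw [conj_eq, q, q, Matrix.det_mul, Matrix.det_mul]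
  simp only [Matrix.det_fin_two_of]
  have := det_cast g
  rw [show (g 0 0 : ℝ) * g 1 1 - g 0 1 * g 1 0 = 1 from this,
    show (g 1 1 : ℝ) * g 0 0 - -(g 0 1 : ℝ) * -(g 1 0 : ℝ) = 1 by linarith]
  ring

lemma bil_conj (g : SL(2, ℤ)) (X Y : V) : bil (conj g X) (conj g Y) = bil X Y := by
  simp only [bil, QuadraticMap.polar, ← conj_add, q_conj]

/-- The class in `L'/L` is the parity of `β`. The upper left entry of `g.X` contains `(ps + qr)
β/2`, and `ps + qr = 1 + 2qr` makes its difference from `β/2` integral. So `Γ` acts trivially on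
`L'/L`. -/
lemma conj_sub_self_mem (g : SL(2, ℤ)) {X : V} (hX : X ∈ dual latticeL) :
    conj g X - X ∈ latticeL := by
  obtain ⟨α, β, γ, rfl⟩ := mem_dual_latticeL_iff.1 hX
  have hd := det_cast g
  set p := g 0 0
  set q := g 0 1
  set r := g 1 0
  set s := g 1 1
  refine ⟨-((r * β - s * α) * s - r * γ * r) - α, (p * β - q * α) * s - p * γ * r - β,
    -((p * β - q * α) * q) + p * γ * p - γ, ?_⟩
  rw [conj_apply]
  have hd' : (p : ℝ) * s = 1 + q * r := by linarith
  ext i j; fin_cases i <;> fin_cases j <;> simp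
  · linear_combination (-(β : ℝ) / 2) * hd
  · ring
  · ring
  · linear_combination (β / 2 : ℝ) * hd

/-! ### The sublattices `I` and `N` -/

section Sublattices

variable {a b c : ℤ}

lemma bil_self_ne (hD : 0 < b ^ 2 - 4 * a * c) :
    bil (formMatrix a b c) (formMatrix a b c) ≠ 0 := by
  rw [bil_formMatrix_self]
  have : (0 : ℝ) < (b : ℝ) ^ 2 - 4 * a * c := by exact_mod_cast hD
  linarith

lemma projLine_add (A X Y : V) : projLine A (X + Y) = projLine A X + projLine A Y := by
  rw [projLine, bil_add_left, add_div, add_smul]; rfl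

lemma projPerp_add (A X Y : V) : projPerp A (X + Y) = projPerp A X + projPerp A Y := by
  rw [projPerp, projLine_add, projPerp, projPerp]; abel

lemma projPerp_add_projLine (A X : V) : projPerp A X + projLine A X = X := by
  rw [projPerp]; abel

lemma bil_projPerp {A : V} (hA : bil A A ≠ 0) (X : V) : bil (projPerp A X) A = 0 := by
  rw [projPerp, projLine, bil_sub_left, bil_smul_left, div_mul_cancel₀ _ hA, sub_self]

lemma bil_projLine {A : V} (hA : bil A A ≠ 0) (X : V) : bil (projLine A X) A = bil X A := by
  rw [projLine, bil_smul_left, div_mul_cancel₀ _ hA]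

lemma projLine_of_perp {A X : V} (hX : bil X A = 0) : projLine A X = 0 := by
  simp [projLine, hX]

lemma projPerp_of_perp {A X : V} (hX : bil X A = 0) : projPerp A X = X := by
  simp [projPerp, projLine_of_perp hX]

lemma projLine_smul_self {A : V} (hA : bil A A ≠ 0) (r : ℝ) : projLine A (r • A) = r • A := by
  rw [projLine, bil_smul_left, mul_div_assoc, div_self hA, mul_one]

lemma projPerp_smul_self {A : V} (hA : bil A A ≠ 0) (r : ℝ) : projPerp A (r • A) = 0 := by
  rw [projPerp, projLine_smul_self hA, sub_self]

lemma latticeI_le (A : V) : latticeI A ≤ latticeL := fun _ h => h.1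

lemma latticeN_le (A : V) : latticeN A ≤ latticeL := fun _ h => h.1

lemma perp_of_mem_dual_latticeI {A X : V} (hX : X ∈ dual (latticeI A)) : bil X A = 0 := by
  have key : ∀ Z ∈ Submodule.span ℝ (latticeI A : Set V), bil Z A = 0 := by
    intro Z hZ
    induction hZ using Submodule.span_induction with
    | mem X h => exact h.2
    | zero => exact bil_zero_left A
    | add X Y _ _ h1 h2 => rw [bil_add_left, h1, h2, add_zero]
    | smul r X _ h => rw [bil_smul_left, h, mul_zero]
  exact key X hX.1

lemma exists_smul_of_mem_dual_latticeN {A X : V} (hX : X ∈ dual (latticeN A)) :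
    ∃ r : ℝ, X = r • A := by
  have key : ∀ Z ∈ Submodule.span ℝ (latticeN A : Set V), ∃ r : ℝ, Z = r • A := by
    intro Z hZ
    induction hZ using Submodule.span_induction with
    | mem X h => obtain ⟨r, hr⟩ := h.2; exact ⟨r, hr⟩
    | zero => exact ⟨0, by simp⟩
    | add X Y _ _ h1 h2 =>
      obtain ⟨r, rfl⟩ := h1; obtain ⟨s, rfl⟩ := h2; exact ⟨r + s, by rw [add_smul]⟩
    | smul r X _ h => obtain ⟨s, rfl⟩ := h; exact ⟨r * s, by rw [mul_smul]⟩
  exact key X hX.1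

lemma traceless_of_mem_dual_le {M : AddSubgroup V} (hM : M ≤ latticeL) {X : V}
    (hX : X ∈ dual M) : X 1 1 = -X 0 0 :=
  traceless_of_mem_span (Submodule.span_mono hM hX.1)

lemma exists_int_bil_formMatrix (a b c : ℤ) {X : V} (hX : X ∈ latticeL) :
    ∃ n : ℤ, bil X (formMatrix a b c) = n := exists_int_bil hX (formMatrix_mem_dual a b c)

/-- The factor `4D` clears every denominator: `(A, A) = -D/2`, both `2X` and `2A` lie in `L`, and
`(2X, A)` is an integer. -/
lemma smul_projLine_mem (hD : 0 < b ^ 2 - 4 * a * c) {X : V} (hX : X ∈ dual latticeL) :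
    (4 * ((b ^ 2 - 4 * a * c : ℤ) : ℝ)) • projLine (formMatrix a b c) X ∈
      latticeN (formMatrix a b c) := by
  obtain ⟨n, hn⟩ := exists_int_bil_formMatrix a b c (two_smul_mem_latticeL hX)
  rw [bil_smul_left] at hn
  have hD' : (0 : ℝ) < (b : ℝ) ^ 2 - 4 * a * c := by exact_mod_cast hD
  have h : (4 * ((b ^ 2 - 4 * a * c : ℤ) : ℝ)) • projLine (formMatrix a b c) X =
      ((-2 * n : ℤ) : ℝ) • ((2 : ℝ) • formMatrix a b c) := by
    rw [projLine, smul_smul, smul_smul, bil_formMatrix_self]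
    congr 1
    push_cast
    field_simp
    linear_combination (-2) * hn
  rw [h]
  refine ⟨smul_int_mem (two_smul_mem_latticeL (formMatrix_mem_dual a b c)) _, -2 * n * 2, ?_⟩
  rw [smul_smul]; push_cast; rfl

lemma smul_projPerp_mem (hD : 0 < b ^ 2 - 4 * a * c) {X : V} (hX : X ∈ dual latticeL) :
    (4 * ((b ^ 2 - 4 * a * c : ℤ) : ℝ)) • projPerp (formMatrix a b c) X ∈
      latticeI (formMatrix a b c) := by
  refine ⟨?_, by rw [bil_smul_left, bil_projPerp (bil_self_ne hD), mul_zero]⟩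
  rw [projPerp, smul_sub]
  refine sub_mem ?_ (latticeN_le _ (smul_projLine_mem hD hX))
  have := smul_int_mem (two_smul_mem_latticeL hX) (2 * (b ^ 2 - 4 * a * c))
  rw [smul_smul] at this
  convert this using 2
  push_cast; ring

lemma mem_span_of_smul_mem {M : AddSubgroup V} {r : ℝ} (hr : r ≠ 0) {X : V} (hX : r • X ∈ M) :
    X ∈ Submodule.span ℝ (M : Set V) := by
  have := Submodule.smul_mem (Submodule.span ℝ (M : Set V)) r⁻¹ (Submodule.subset_span hX)
  rwa [smul_smul, inv_mul_cancel₀ hr, one_smul] at this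

lemma four_mul_disc_ne (hD : 0 < b ^ 2 - 4 * a * c) :
    4 * ((b ^ 2 - 4 * a * c : ℤ) : ℝ) ≠ 0 := by
  have : (0 : ℝ) < ((b ^ 2 - 4 * a * c : ℤ) : ℝ) := by exact_mod_cast hD
  positivity

lemma projPerp_mem_dual (hD : 0 < b ^ 2 - 4 * a * c) {X : V} (hX : X ∈ dual latticeL) :
    projPerp (formMatrix a b c) X ∈ dual (latticeI (formMatrix a b c)) := by
  refine ⟨mem_span_of_smul_mem (four_mul_disc_ne hD) (smul_projPerp_mem hD hX), fun Z hZ => ?_⟩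
  obtain ⟨n, hn⟩ := hX.2 Z hZ.1
  refine ⟨n, ?_⟩
  rw [projPerp, projLine, bil_sub_left, bil_smul_left, bil_comm (formMatrix _ _ _) Z, hZ.2,
    hn]; ring

lemma projLine_mem_dual (hD : 0 < b ^ 2 - 4 * a * c) {X : V} (hX : X ∈ dual latticeL) :
    projLine (formMatrix a b c) X ∈ dual (latticeN (formMatrix a b c)) := by
  refine ⟨mem_span_of_smul_mem (four_mul_disc_ne hD) (smul_projLine_mem hD hX), fun Z hZ => ?_⟩
  obtain ⟨n, hn⟩ := hX.2 Z hZ.1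
  refine ⟨n, ?_⟩
  obtain ⟨r, rfl⟩ := hZ.2
  rw [bil_smul_right, bil_projLine (bil_self_ne hD), ← bil_smul_right, hn]

lemma dual_latticeL_le (hD : 0 < b ^ 2 - 4 * a * c) :
    dual latticeL ≤ dual (latticeI (formMatrix a b c) ⊔ latticeN (formMatrix a b c)) := by
  intro X hX
  refine ⟨?_, fun Z hZ => hX.2 Z (sup_le (latticeI_le _) (latticeN_le _) hZ)⟩
  rw [← projPerp_add_projLine (formMatrix a b c) X]
  exact add_mem (Submodule.span_mono (SetLike.coe_subset_coe.2 le_sup_left)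
      (projPerp_mem_dual hD hX).1)
    (Submodule.span_mono (SetLike.coe_subset_coe.2 le_sup_right) (projLine_mem_dual hD hX).1)

/-- A vector of `I'` is the projection of a vector of `L'`. -/
lemma exists_eq_sub_smul {Y : V} (hY : Y ∈ dual (latticeI (formMatrix a b c))) :
    ∃ X ∈ dual latticeL, ∃ t : ℝ, Y = X - t • formMatrix a b c := by
  -- The values `(Z, A)`, `Z ∈ L`, form a group `dℤ`. If `(Z₀, A) = d`, every `Z ∈ L` is `k Z₀` plus
  -- a vector of `I`. The multiple of `A` added to `Y` is the one that makes the product with `Z₀`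
  -- vanish, so the product with `Z` becomes `(Y, Z - k Z₀)`, an integer.
  let S : AddSubgroup ℤ :=
    { carrier := {n | ∃ Z ∈ latticeL, bil Z (formMatrix a b c) = n}
      zero_mem' := ⟨0, zero_mem _, by simp [bil_zero_left]⟩
      add_mem' := by
        rintro m n ⟨Z, hZ, h⟩ ⟨Z', hZ', h'⟩
        exact ⟨Z + Z', add_mem hZ hZ', by rw [bil_add_left, h, h']; push_cast; rfl⟩
      neg_mem' := by
        rintro m ⟨Z, hZ, h⟩
        exact ⟨-Z, neg_mem hZ, by rw [bil_neg_left, h]; push_cast; rfl⟩ }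
  obtain ⟨d, hd⟩ := Int.subgroup_cyclic S
  obtain ⟨Z₀, hZ₀, hd₀⟩ : d ∈ S := by rw [hd]; exact AddSubgroup.mem_closure_singleton_self d
  have hYt := traceless_of_mem_dual_le (latticeI_le _) hY
  have hAt := traceless_of_mem_dual (formMatrix_mem_dual a b c)
  refine ⟨Y + (-(bil Y Z₀ / d)) • formMatrix a b c, ⟨mem_span_latticeL ?_, ?_⟩,
    -(bil Y Z₀ / d), by abel⟩
  · simp only [Matrix.add_apply, Matrix.smul_apply, hYt, hAt, smul_eq_mul]; ring
  intro Z hZ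
  obtain ⟨n, hn⟩ := exists_int_bil_formMatrix a b c hZ
  have hnS : n ∈ S := ⟨Z, hZ, hn⟩
  rw [hd, AddSubgroup.mem_closure_singleton] at hnS
  obtain ⟨k, rfl⟩ := hnS
  obtain ⟨m, hm⟩ := hY.2 (Z - (k : ℝ) • Z₀) ⟨sub_mem hZ (smul_int_mem hZ₀ k), by
    rw [bil_sub_left, bil_smul_left, hn, hd₀]; push_cast [smul_eq_mul]; ring⟩
  rw [bil_comm, bil_sub_left, bil_smul_left, bil_comm Z, bil_comm Z₀] at hm
  -- If `d = 0`, then `L = I`; the correction `(Y, Z₀)/d` is then `0` by the convention for division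
  -- by zero.
  by_cases h0 : d = 0
  · obtain ⟨m', hm'⟩ := hY.2 Z ⟨hZ, by rw [hn, h0]; simp⟩
    exact ⟨m', by simp [h0, hm']⟩
  · have h0' : (d : ℝ) ≠ 0 := by exact_mod_cast h0
    refine ⟨m, ?_⟩
    rw [bil_add_left, bil_smul_left, bil_comm (formMatrix a b c) Z, hn, ← hm]
    push_cast [smul_eq_mul]
    field_simp
    ring

/-- Vectors of `I'` are projections of vectors of `L'`, so `I'` lies in a scaled copy of `L`. This
is what Gaussian summability over `I'` and the integrality argument for isotropic vectors need. -/
lemma smul_mem_of_mem_dual_latticeI (hD : 0 < b ^ 2 - 4 * a * c) {Y : V}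
    (hY : Y ∈ dual (latticeI (formMatrix a b c))) :
    (4 * ((b ^ 2 - 4 * a * c : ℤ) : ℝ)) • Y ∈ latticeL := by
  obtain ⟨X, hX, t, h⟩ := exists_eq_sub_smul hY
  have h1 : Y = projPerp (formMatrix a b c) X := by
    have h2 : X = Y + t • formMatrix a b c := by rw [h]; abel
    rw [h2, projPerp_add, projPerp_smul_self (bil_self_ne hD),
      projPerp_of_perp (perp_of_mem_dual_latticeI hY), add_zero]
  rw [h1]
  exact (smul_projPerp_mem hD hX).1

lemma smul_mem_of_mem_dual_latticeN {W : V}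
    (hW : W ∈ dual (latticeN (formMatrix a b c))) :
    (4 * ((b ^ 2 - 4 * a * c : ℤ) : ℝ)) • W ∈ latticeL := by
  have h2A := two_smul_mem_latticeL (formMatrix_mem_dual a b c)
  obtain ⟨n, hn⟩ := hW.2 ((2 : ℝ) • formMatrix a b c) ⟨h2A, 2, by norm_num⟩
  obtain ⟨r, rfl⟩ := exists_smul_of_mem_dual_latticeN hW
  rw [bil_smul_right, bil_smul_left, bil_formMatrix_self] at hn
  have := smul_int_mem h2A (-2 * n)
  rw [smul_smul] at this ⊢
  convert this using 2
  push_cast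
  linear_combination (-4) * hn

/-- `Γ_A` acts trivially on the discriminant group of `I`. -/
lemma conj_sub_self_mem_latticeI {g : SL(2, ℤ)} (hg : g ∈ stab (formMatrix a b c)) {Y : V}
    (hY : Y ∈ dual (latticeI (formMatrix a b c))) :
    conj g Y - Y ∈ latticeI (formMatrix a b c) := by
  have hg' : conj g (formMatrix a b c) = formMatrix a b c := hg
  refine ⟨?_, ?_⟩
  -- With `Y = X - tA` and `g.A = A`, the difference `g.Y - Y` equals `g.X - X`.
  · obtain ⟨X, hX, t, rfl⟩ := exists_eq_sub_smul hY
    rw [conj_sub, conj_smul, hg', sub_sub_sub_cancel_right]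
    exact conj_sub_self_mem g hX
  · rw [bil_sub_left, perp_of_mem_dual_latticeI hY, sub_zero]
    nth_rewrite 1 [← hg']
    rw [bil_conj, perp_of_mem_dual_latticeI hY]

lemma conj_mem_dual_latticeI {g : SL(2, ℤ)} (hg : g ∈ stab (formMatrix a b c)) {Y : V}
    (hY : Y ∈ dual (latticeI (formMatrix a b c))) :
    conj g Y ∈ dual (latticeI (formMatrix a b c)) := by
  have h := conj_sub_self_mem_latticeI hg hY
  have h1 : conj g Y - Y ∈ dual (latticeI (formMatrix a b c)) :=
    ⟨Submodule.subset_span h, fun Z hZ => latticeL_le_dual h.1 |>.2 Z hZ.1⟩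
  simpa using add_mem h1 hY

/-- As `K L ⊆ M`, a class modulo `M` depends only on the three integer coordinates modulo `K`. -/
lemma finite_quotient_of_smul_mem {M : AddSubgroup V} (K : ℕ) [NeZero K]
    (h : ∀ X ∈ latticeL, (K : ℝ) • X ∈ M) : Finite (latticeL ⧸ M.addSubgroupOf latticeL) := by
  let f : (Fin K × Fin K × Fin K) → latticeL ⧸ M.addSubgroupOf latticeL := fun x =>
    QuotientAddGroup.mk ⟨_, mem_latticeL_mk (x.1 : ℕ) (x.2.1 : ℕ) (x.2.2 : ℕ)⟩
  have hK : (0 : ℤ) < K := by exact_mod_cast Nat.pos_of_ne_zero (NeZero.ne K)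
  have hmod : ∀ n : ℤ, ∃ i : Fin K, ∃ k : ℤ, n = (i : ℕ) + K * k := fun n =>
    ⟨⟨(n % K).toNat, by have := Int.emod_lt_of_pos n hK; omega⟩, n / K, by
      have h1 := Int.emod_nonneg n hK.ne'
      have h2 := Int.emod_add_mul_ediv n K
      simp only [Int.toNat_of_nonneg h1]
      exact h2.symm⟩
  refine Finite.of_surjective f fun y => ?_
  obtain ⟨⟨X, α, β, γ, rfl⟩, rfl⟩ := QuotientAddGroup.mk_surjective y
  obtain ⟨i, i', rfl⟩ := hmod α
  obtain ⟨j, j', rfl⟩ := hmod β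
  obtain ⟨k, k', rfl⟩ := hmod γ
  refine ⟨(i, j, k), ?_⟩
  rw [QuotientAddGroup.eq, AddSubgroup.mem_addSubgroupOf]
  convert h _ (mem_latticeL_mk i' j' k') using 1
  ext x y; fin_cases x <;> fin_cases y <;> simp

lemma finite_quotient (hD : 0 < b ^ 2 - 4 * a * c) :
    Finite (latticeL ⧸ (latticeI (formMatrix a b c) ⊔ latticeN (formMatrix a b c)).addSubgroupOf
      latticeL) := by
  obtain ⟨K, hK⟩ := Int.eq_ofNat_of_zero_le (a := 4 * (b ^ 2 - 4 * a * c)) (by positivity)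
  have : NeZero K := ⟨by rintro rfl; simp at hK; omega⟩
  refine finite_quotient_of_smul_mem K fun X hX => ?_
  have hK' : (K : ℝ) = 4 * ((b ^ 2 - 4 * a * c : ℤ) : ℝ) := by
    rw [← Int.cast_natCast, ← hK]; push_cast; ring
  rw [hK', ← projPerp_add_projLine (formMatrix a b c) X, smul_add]
  exact AddSubgroup.add_mem_sup (smul_projPerp_mem hD (latticeL_le_dual hX))
    (smul_projLine_mem hD (latticeL_le_dual hX))

end Sublattices

/-! ### The geodesic in arc length coordinates -/

/-- The centre of the semicircle `S_A`. -/
noncomputable def center (a b : ℝ) : ℝ := -b / (2 * a)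

/-- The radius of the semicircle `S_A`. -/
noncomputable def radius (a b c : ℝ) : ℝ := √(b ^ 2 - 4 * a * c) / (2 * a)

/-- The larger real endpoint of the geodesic of `[a, b, c]`, `a > 0`. -/
noncomputable def endpoint' (a b c : ℝ) : ℝ := (-b + √(b ^ 2 - 4 * a * c)) / (2 * a)

/-- The isotropic vector attached to the larger endpoint. -/
noncomputable def vecY1 (a b c : ℝ) : V :=
  !![-endpoint' a b c, endpoint' a b c ^ 2; -1, endpoint' a b c]

section Real

variable {a b c : ℝ}

lemma radius_pos (ha : 0 < a) (hD : 0 < b ^ 2 - 4 * a * c) : 0 < radius a b c := by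
  unfold radius; positivity

lemma sqrt_disc_eq (ha : 0 < a) : √(b ^ 2 - 4 * a * c) = 2 * a * radius a b c := by
  unfold radius; field_simp

lemma endpoint_eq : endpoint a b c = center a b - radius a b c := by
  unfold endpoint center radius; ring

lemma endpoint'_eq : endpoint' a b c = center a b + radius a b c := by
  unfold endpoint' center radius; ring

lemma coeff_b_eq (ha : 0 < a) : b = -(2 * a * center a b) := by
  unfold center; field_simp

lemma coeff_c_eq (ha : 0 < a) (hD : 0 < b ^ 2 - 4 * a * c) :
    c = a * (center a b ^ 2 - radius a b c ^ 2) := by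
  unfold center radius
  rw [div_pow, div_pow, Real.sq_sqrt hD.le]
  field_simp
  ring

lemma formMatrix_eq (ha : 0 < a) (hD : 0 < b ^ 2 - 4 * a * c) :
    formMatrix a b c =
      a • !![-center a b, center a b ^ 2 - radius a b c ^ 2; -1, center a b] := by
  have h1 := coeff_b_eq (b := b) ha
  have h2 := coeff_c_eq ha hD
  ext i j
  fin_cases i <;> fin_cases j <;> simp [formMatrix] <;> linarith

/-- The space of trace zero is the orthogonal sum of `ℝA`, with `(A, A) = -2a²r²`, and the
hyperbolic plane spanned by the isotropic vectors `Y₀`, `Y₁`, with `(Y₀, Y₁) = (w - w')² = 4r²`. -/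
lemma q_eq_combination (ha : 0 < a) (hD : 0 < b ^ 2 - 4 * a * c) {X : V} (hX : X 1 1 = -X 0 0) :
    q X = bil X (vecY0 a b c) * bil X (vecY1 a b c) / (4 * radius a b c ^ 2) -
      bil X (formMatrix a b c) ^ 2 / (4 * a ^ 2 * radius a b c ^ 2) := by
  have hr := radius_pos ha hD
  simp only [formMatrix_eq ha hD, vecY0, vecY1, endpoint_eq, endpoint'_eq, bil_eq, q_eq, hX]
  simp
  field_simp
  ring

lemma geodesicPath_re (s : ℝ) :
    (geodesicPath a b c s).re = center a b - radius a b c * Real.tanh s := by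
  simp [geodesicPath, center, radius, -Complex.ofReal_div, -Complex.ofReal_mul,
    -Complex.ofReal_sub, -Complex.ofReal_tanh, -Complex.ofReal_cosh]

lemma geodesicPath_im (s : ℝ) : (geodesicPath a b c s).im = radius a b c / Real.cosh s := by
  simp [geodesicPath, radius, -Complex.ofReal_div, -Complex.ofReal_mul,
    -Complex.ofReal_sub, -Complex.ofReal_tanh, -Complex.ofReal_cosh]

lemma geodesicPath_im_pos (ha : 0 < a) (hD : 0 < b ^ 2 - 4 * a * c) (s : ℝ) :
    0 < (geodesicPath a b c s).im := by
  rw [geodesicPath_im]; exact div_pos (radius_pos ha hD) (Real.cosh_pos s)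

/-- For `z` on `S_A` the vector `X(z)` is orthogonal to `A`, hence lies in the hyperbolic plane of
`Y₀` and `Y₁`, and moving by arc length is a boost there. The scalar is fixed by `(X(z), X(z)) = 1`
and `(Y₀, Y₁) = 4r²`. -/
lemma posVec_geodesicPath (ha : 0 < a) (hD : 0 < b ^ 2 - 4 * a * c) (s : ℝ) :
    posVec (geodesicPath a b c s) = (1 / (2 * √2 * radius a b c)) •
      (Real.exp s • vecY0 a b c + Real.exp (-s) • vecY1 a b c) := by
  have hr := radius_pos ha hD
  have hC := Real.cosh_pos s
  have h2 : 0 < √2 := by positivity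
  have hsq := Real.cosh_sq s
  rw [posVec, Complex.sq_norm, Complex.normSq_apply, geodesicPath_re, geodesicPath_im,
    Real.tanh_eq_sinh_div_cosh]
  have he := (Real.cosh_add_sinh s).symm
  have he' := (Real.cosh_sub_sinh s).symm
  ext i j
  fin_cases i <;> fin_cases j <;> simp [vecY0, vecY1, endpoint_eq, endpoint'_eq] <;>
    field_simp <;> rw [he, he']
  · ring
  · linear_combination (-2 * radius a b c ^ 2 ) * hsq
  · ring
  · ring

/-- The inner product of `X` with `X(z)` at the point of parameter `s`. -/
lemma bil_posVec_geodesicPath (ha : 0 < a) (hD : 0 < b ^ 2 - 4 * a * c) (X : V) (s : ℝ) :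
    bil X (posVec (geodesicPath a b c s)) = 1 / (2 * √2 * radius a b c) *
      (bil X (vecY0 a b c) * Real.exp s + bil X (vecY1 a b c) * Real.exp (-s)) := by
  rw [posVec_geodesicPath ha hD, bil_smul_right, bil_add_right, bil_smul_right, bil_smul_right]
  ring

lemma hasDerivAt_tanh (s : ℝ) : HasDerivAt Real.tanh (1 / Real.cosh s ^ 2) s := by
  have h := (Real.hasDerivAt_sinh s).div (Real.hasDerivAt_cosh s) (Real.cosh_pos s).ne'
  have hf : Real.sinh / Real.cosh = Real.tanh := by
    ext x; simp [Real.tanh_eq_sinh_div_cosh]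
  rw [hf] at h
  refine h.congr_deriv ?_
  congr 1
  linarith [Real.cosh_sq s]

lemma hasDerivAt_geodesicPath (s : ℝ) : HasDerivAt (geodesicPath a b c)
    (((-radius a b c / Real.cosh s ^ 2 : ℝ) : ℂ) +
      ((-radius a b c * Real.sinh s / Real.cosh s ^ 2 : ℝ) : ℂ) * Complex.I) s := by
  have h1 : HasDerivAt (fun s => -b / (2 * a) - √(b ^ 2 - 4 * a * c) / (2 * a) * Real.tanh s)
      (-radius a b c / Real.cosh s ^ 2) s := by
    have := ((hasDerivAt_tanh s).const_mul (radius a b c)).const_sub (center a b)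
    exact this.congr_deriv (by ring)
  have h2 : HasDerivAt (fun s => √(b ^ 2 - 4 * a * c) / (2 * a) / Real.cosh s)
      (-radius a b c * Real.sinh s / Real.cosh s ^ 2) s := by
    have := ((Real.hasDerivAt_cosh s).inv (Real.cosh_pos s).ne').const_mul (radius a b c)
    exact this.congr_deriv (by ring)
  exact h1.ofReal_comp.add (h2.ofReal_comp.mul_const Complex.I)

/-- The geodesic in terms of its endpoints. -/
lemma geodesicPath_eq_div (s : ℝ) : geodesicPath a b c s =
    ((endpoint a b c * Real.exp s : ℝ) + endpoint' a b c * Complex.I) /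
      ((Real.exp s : ℝ) + Complex.I) := by
  have hne : ((Real.exp s : ℝ) : ℂ) + Complex.I ≠ 0 := by
    intro h; have := congrArg Complex.im h; simp at this
  rw [eq_div_iff hne]
  have hC := (Real.cosh_pos s).ne'
  have hsq := Real.cosh_sq s
  apply Complex.ext
  · simp only [Complex.mul_re, Complex.add_re, Complex.add_im, Complex.ofReal_re,
      Complex.ofReal_im, Complex.I_re, Complex.I_im, geodesicPath_re, geodesicPath_im,
      endpoint_eq, endpoint'_eq, Real.tanh_eq_sinh_div_cosh, ← Real.cosh_add_sinh]
    field_simp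
    linear_combination radius a b c * hsq
  · simp only [Complex.add_re, Complex.add_im, Complex.ofReal_re,
      Complex.ofReal_im, Complex.I_re, Complex.I_im, geodesicPath_re, geodesicPath_im,
      Complex.mul_im, endpoint_eq, endpoint'_eq, Real.tanh_eq_sinh_div_cosh,
      ← Real.cosh_add_sinh]
    field_simp
    ring

/-- The path `geodesicPath` as a map to the upper half-plane. -/
noncomputable def pathH (ha : 0 < a) (hD : 0 < b ^ 2 - 4 * a * c) (s : ℝ) : ℍ :=
  ⟨geodesicPath a b c s, geodesicPath_im_pos ha hD s⟩

@[simp] lemma coe_pathH (ha : 0 < a) (hD : 0 < b ^ 2 - 4 * a * c) (s : ℝ) :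
    (pathH ha hD s : ℂ) = geodesicPath a b c s := rfl

/-- The arc length coordinate of a point of the geodesic. -/
noncomputable def arcCoord (a b : ℝ) (z : ℍ) : ℝ := Real.arsinh ((center a b - z.re) / z.im)

lemma arcCoord_pathH (ha : 0 < a) (hD : 0 < b ^ 2 - 4 * a * c) (s : ℝ) :
    arcCoord a b (pathH ha hD s) = s := by
  have hr := radius_pos ha hD
  have hC := Real.cosh_pos s
  rw [arcCoord, ← UpperHalfPlane.coe_re, ← UpperHalfPlane.coe_im, coe_pathH, geodesicPath_re,
    geodesicPath_im, Real.tanh_eq_sinh_div_cosh, ← Real.arsinh_sinh s]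
  congr 1
  rw [Real.arsinh_sinh]
  field_simp
  ring

lemma pathH_mem_geodesic (ha : 0 < a) (hD : 0 < b ^ 2 - 4 * a * c) (s : ℝ) :
    pathH ha hD s ∈ geodesic a b c := by
  have hC := Real.cosh_pos s
  have hsq := Real.cosh_sq s
  have h1 := coeff_b_eq (b := b) ha
  have h2 := coeff_c_eq ha hD
  change a * ‖(pathH ha hD s : ℂ)‖ ^ 2 + b * (pathH ha hD s).re + c = 0
  rw [← UpperHalfPlane.coe_re, coe_pathH, Complex.sq_norm, Complex.normSq_apply,
    geodesicPath_re, geodesicPath_im, Real.tanh_eq_sinh_div_cosh]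
  generalize center a b = x at *
  generalize radius a b c = r at *
  subst h1
  subst h2
  field_simp
  linear_combination (-a * r ^ 2) * hsq

lemma pathH_arcCoord (ha : 0 < a) (hD : 0 < b ^ 2 - 4 * a * c) {z : ℍ}
    (hz : z ∈ geodesic a b c) : pathH ha hD (arcCoord a b z) = z := by
  have hr := radius_pos ha hD
  have hy := z.im_pos
  have h1 := coeff_b_eq (b := b) ha
  have h2 := coeff_c_eq ha hD
  have hz' : a * ‖(z : ℂ)‖ ^ 2 + b * z.re + c = 0 := hz
  rw [Complex.sq_norm, Complex.normSq_apply, UpperHalfPlane.coe_re, UpperHalfPlane.coe_im] at hz'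
  have h3 : (center a b - z.re) ^ 2 + z.im ^ 2 = radius a b c ^ 2 := by
    have : a * ((center a b - z.re) ^ 2 + z.im ^ 2 - radius a b c ^ 2) = 0 := by
      linear_combination hz' - h2 - z.re * h1
    have := (mul_eq_zero.1 this).resolve_left ha.ne'
    linarith
  have hcosh : Real.cosh (arcCoord a b z) = radius a b c / z.im := by
    rw [arcCoord, Real.cosh_arsinh, div_pow, show (1 : ℝ) + (center a b - z.re) ^ 2 / z.im ^ 2 =
      (radius a b c / z.im) ^ 2 by field_simp; linarith, Real.sqrt_sq (by positivity)]
  have hsinh : Real.sinh (arcCoord a b z) = (center a b - z.re) / z.im := Real.sinh_arsinh _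
  apply UpperHalfPlane.ext
  rw [coe_pathH]
  apply Complex.ext
  · rw [geodesicPath_re, Real.tanh_eq_sinh_div_cosh, hcosh, hsinh, UpperHalfPlane.coe_re]
    field_simp
    ring
  · rw [geodesicPath_im, hcosh, UpperHalfPlane.coe_im]
    field_simp

lemma continuous_geodesicPath : Continuous (geodesicPath a b c) :=
  continuous_iff_continuousAt.2 fun s => (hasDerivAt_geodesicPath s).continuousAt

lemma continuous_pathH (ha : 0 < a) (hD : 0 < b ^ 2 - 4 * a * c) : Continuous (pathH ha hD) :=
  UpperHalfPlane.isEmbedding_coe.continuous_iff.2 continuous_geodesicPath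

lemma params_eq_preimage (ha : 0 < a) (hD : 0 < b ^ 2 - 4 * a * c) (F : Set ℍ) :
    params a b c F = pathH ha hD ⁻¹' F := by
  ext s
  constructor
  · rintro ⟨z, hz, h⟩
    have : pathH ha hD s = z := UpperHalfPlane.ext h.symm
    rwa [Set.mem_preimage, this]
  · exact fun h => ⟨_, h, rfl⟩

end Real

/-! ### The stabilizer of `A` -/

/-- The eigenvalue of `g ∈ Γ_A` on the eigenvector `(w, 1)`. -/
noncomputable def eigen (w : ℝ) (g : SL(2, ℤ)) : ℝ := g 1 0 * w + g 1 1

section Stabilizer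

variable {a b c : ℝ}

/-- Stabilizing `A` means commuting with it, and the first column of `gA = Ag` is linear in the
entries of `g`. -/
lemma stab_relations {g : SL(2, ℤ)} (hg : g ∈ stab (formMatrix a b c)) :
    a * g 0 1 = -(c * g 1 0) ∧ a * g 0 0 = a * g 1 1 - b * g 1 0 := by
  have h : conj g (formMatrix a b c) = formMatrix a b c := hg
  have hd := det_cast g
  rw [conj_eq] at h
  have h' := congrArg (· * (!![(g 0 0 : ℝ), (g 0 1 : ℝ); (g 1 0 : ℝ), (g 1 1 : ℝ)] : V)) h
  have hone : (!![(g 1 1 : ℝ), -(g 0 1 : ℝ); -(g 1 0 : ℝ), (g 0 0 : ℝ)] : V) *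
      !![(g 0 0 : ℝ), (g 0 1 : ℝ); (g 1 0 : ℝ), (g 1 1 : ℝ)] = 1 := by
    rw [Matrix.mul_fin_two, Matrix.one_fin_two]
    ext i j; fin_cases i <;> fin_cases j <;> simp <;> linarith
  simp only [Matrix.mul_assoc, hone, Matrix.mul_one] at h'
  rw [formMatrix, Matrix.mul_fin_two, Matrix.mul_fin_two] at h'
  have h00 := congrFun (congrFun h' 0) 0
  have h10 := congrFun (congrFun h' 1) 0
  simp at h00 h10
  constructor <;> linarith

/-- The vectors `(w, 1)` and `(w', 1)` are eigenvectors of `A`, hence of every `g` commuting with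
`A`. The two factors are the eigenvalues of `g`: their product is `det g` and their sum (next lemma)
is the trace. -/
lemma eigen_mul_eigen' (ha : 0 < a) (hD : 0 < b ^ 2 - 4 * a * c) {g : SL(2, ℤ)}
    (hg : g ∈ stab (formMatrix a b c)) :
    eigen (endpoint a b c) g * eigen (endpoint' a b c) g = 1 := by
  obtain ⟨h1, h2⟩ := stab_relations hg
  have hd := det_cast g
  have hb := coeff_b_eq (b := b) ha
  have hc := coeff_c_eq ha hD
  simp only [eigen, endpoint_eq, endpoint'_eq]
  have : a * (((g 1 0 : ℝ) * (center a b - radius a b c) + g 1 1) *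
      (g 1 0 * (center a b + radius a b c) + g 1 1) - 1) = 0 := by
    linear_combination a * hd - (g 1 1 : ℝ) * h2 + (g 1 0 : ℝ) * h1 - (g 1 0 : ℝ) ^ 2 * hc +
      (g 1 0 : ℝ) * g 1 1 * hb
  have := (mul_eq_zero.1 this).resolve_left ha.ne'
  linarith

lemma eigen_add_eigen' (ha : 0 < a) {g : SL(2, ℤ)} (hg : g ∈ stab (formMatrix a b c)) :
    eigen (endpoint a b c) g + eigen (endpoint' a b c) g = g 0 0 + g 1 1 := by
  obtain ⟨h1, h2⟩ := stab_relations hg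
  have hb := coeff_b_eq (b := b) ha
  simp only [eigen, endpoint_eq, endpoint'_eq]
  have : a * ((g 1 0 : ℝ) * (center a b - radius a b c) + g 1 1 +
      (g 1 0 * (center a b + radius a b c) + g 1 1) - (g 0 0 + g 1 1)) = 0 := by
    linear_combination (-1) * h2 + (g 1 0 : ℝ) * hb
  have := (mul_eq_zero.1 this).resolve_left ha.ne'
  linarith

lemma eigen_mul_endpoint (ha : 0 < a) (hD : 0 < b ^ 2 - 4 * a * c) {g : SL(2, ℤ)}
    (hg : g ∈ stab (formMatrix a b c)) :
    g 0 0 * endpoint a b c + g 0 1 = eigen (endpoint a b c) g * endpoint a b c := by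
  obtain ⟨h1, h2⟩ := stab_relations hg
  have hb := coeff_b_eq (b := b) ha
  have hc := coeff_c_eq ha hD
  simp only [eigen, endpoint_eq]
  generalize center a b = x at *
  generalize radius a b c = r at *
  have : a * ((g 0 0 : ℝ) * (x - r) + g 0 1 - (g 1 0 * (x - r) + g 1 1) * (x - r)) = 0 := by
    linear_combination (x - r) * h2 + h1 - (g 1 0 : ℝ) * (x - r) * hb - (g 1 0 : ℝ) * hc
  have := (mul_eq_zero.1 this).resolve_left ha.ne'
  linarith

lemma eigen'_mul_endpoint' (ha : 0 < a) (hD : 0 < b ^ 2 - 4 * a * c) {g : SL(2, ℤ)}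
    (hg : g ∈ stab (formMatrix a b c)) :
    g 0 0 * endpoint' a b c + g 0 1 = eigen (endpoint' a b c) g * endpoint' a b c := by
  obtain ⟨h1, h2⟩ := stab_relations hg
  have hb := coeff_b_eq (b := b) ha
  have hc := coeff_c_eq ha hD
  simp only [eigen, endpoint'_eq]
  generalize center a b = x at *
  generalize radius a b c = r at *
  have : a * ((g 0 0 : ℝ) * (x + r) + g 0 1 - (g 1 0 * (x + r) + g 1 1) * (x + r)) = 0 := by
    linear_combination (x + r) * h2 + h1 - (g 1 0 : ℝ) * (x + r) * hb - (g 1 0 : ℝ) * hc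
  have := (mul_eq_zero.1 this).resolve_left ha.ne'
  linarith

/-- The matrix has rank one: it is the column `(w, 1)` times the row `(-1, w)`. The column is scaled
by the eigenvalue under `g` from the left, and the row by the same factor under `g⁻¹` from the
right. -/
lemma conj_isotropic {g : SL(2, ℤ)} {w : ℝ} (h : g 0 0 * w + g 0 1 = eigen w g * w) :
    conj g !![-w, w ^ 2; -1, w] = eigen w g ^ 2 • (!![-w, w ^ 2; -1, w] : V) := by
  have h' : (g 0 1 : ℝ) = eigen w g * w - g 0 0 * w := by linarith
  have h1 : eigen w g = g 1 0 * w + g 1 1 := rfl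
  have h'' : (g 1 1 : ℝ) = eigen w g - g 1 0 * w := by linarith
  rw [conj_apply, h', h'']
  generalize eigen w g = l at *
  ext i j; fin_cases i <;> fin_cases j <;> simp <;> ring

lemma eigen_ne_zero (ha : 0 < a) (hD : 0 < b ^ 2 - 4 * a * c) {g : SL(2, ℤ)}
    (hg : g ∈ stab (formMatrix a b c)) : eigen (endpoint a b c) g ≠ 0 := by
  intro h
  have := eigen_mul_eigen' ha hD hg
  rw [h, zero_mul] at this
  exact zero_ne_one this

/-- The translation of the arc length coordinate effected by `g ∈ Γ_A`. -/
noncomputable def shift (a b c : ℝ) (g : SL(2, ℤ)) : ℝ := Real.log (eigen (endpoint a b c) g ^ 2)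

lemma exp_shift (ha : 0 < a) (hD : 0 < b ^ 2 - 4 * a * c) {g : SL(2, ℤ)}
    (hg : g ∈ stab (formMatrix a b c)) :
    Real.exp (shift a b c g) = eigen (endpoint a b c) g ^ 2 :=
  Real.exp_log (by have := eigen_ne_zero ha hD hg; positivity)

lemma exp_neg_shift (ha : 0 < a) (hD : 0 < b ^ 2 - 4 * a * c) {g : SL(2, ℤ)}
    (hg : g ∈ stab (formMatrix a b c)) :
    Real.exp (-shift a b c g) = eigen (endpoint' a b c) g ^ 2 := by
  have h := eigen_mul_eigen' ha hD hg
  rw [Real.exp_neg, exp_shift ha hD hg]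
  refine inv_eq_of_mul_eq_one_right ?_
  rw [← mul_pow, h, one_pow]

lemma conj_vecY0 (ha : 0 < a) (hD : 0 < b ^ 2 - 4 * a * c) {g : SL(2, ℤ)}
    (hg : g ∈ stab (formMatrix a b c)) :
    conj g (vecY0 a b c) = Real.exp (shift a b c g) • vecY0 a b c := by
  rw [exp_shift ha hD hg]
  exact conj_isotropic (eigen_mul_endpoint ha hD hg)

lemma conj_vecY1 (ha : 0 < a) (hD : 0 < b ^ 2 - 4 * a * c) {g : SL(2, ℤ)}
    (hg : g ∈ stab (formMatrix a b c)) :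
    conj g (vecY1 a b c) = Real.exp (-shift a b c g) • vecY1 a b c := by
  rw [exp_neg_shift ha hD hg]
  exact conj_isotropic (eigen'_mul_endpoint' ha hD hg)

lemma bil_conj_vecY0 (ha : 0 < a) (hD : 0 < b ^ 2 - 4 * a * c) {g : SL(2, ℤ)}
    (hg : g ∈ stab (formMatrix a b c)) (X : V) :
    bil (conj g X) (vecY0 a b c) = Real.exp (-shift a b c g) * bil X (vecY0 a b c) := by
  have h := bil_conj g X (vecY0 a b c)
  rw [conj_vecY0 ha hD hg, bil_smul_right] at h
  rw [← h, ← mul_assoc, ← Real.exp_add, neg_add_cancel, Real.exp_zero, one_mul]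

lemma bil_conj_vecY1 (ha : 0 < a) (hD : 0 < b ^ 2 - 4 * a * c) {g : SL(2, ℤ)}
    (hg : g ∈ stab (formMatrix a b c)) (X : V) :
    bil (conj g X) (vecY1 a b c) = Real.exp (shift a b c g) * bil X (vecY1 a b c) := by
  have h := bil_conj g X (vecY1 a b c)
  rw [conj_vecY1 ha hD hg, bil_smul_right] at h
  rw [← h, ← mul_assoc, ← Real.exp_add, add_neg_cancel, Real.exp_zero, one_mul]

lemma shift_mul (ha : 0 < a) (hD : 0 < b ^ 2 - 4 * a * c) {g h : SL(2, ℤ)}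
    (hg : g ∈ stab (formMatrix a b c)) (hh : h ∈ stab (formMatrix a b c)) :
    shift a b c (g * h) = shift a b c g + shift a b c h := by
  have h1 : eigen (endpoint a b c) (g * h) =
      eigen (endpoint a b c) g * eigen (endpoint a b c) h := by
    have h2 := eigen_mul_endpoint ha hD hh
    have h3 : eigen (endpoint a b c) h = h 1 0 * endpoint a b c + h 1 1 := rfl
    have h4 : eigen (endpoint a b c) g = g 1 0 * endpoint a b c + g 1 1 := rfl
    rw [eigen, Matrix.SpecialLinearGroup.coe_mul, Matrix.mul_apply, Matrix.mul_apply,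
      Fin.sum_univ_two, Fin.sum_univ_two]
    push_cast
    linear_combination (g 1 0 : ℝ) * h2 - eigen (endpoint a b c) h * h4 - (g 1 1 : ℝ) * h3
  rw [shift, h1, mul_pow, Real.log_mul (pow_ne_zero 2 (eigen_ne_zero ha hD hg))
    (pow_ne_zero 2 (eigen_ne_zero ha hD hh))]
  rfl

lemma shift_one : shift a b c 1 = 0 := by simp [shift, eigen]

/-- The group of translations of the arc length coordinate effected by `Γ_A`. -/
noncomputable def shiftGroup (ha : 0 < a) (hD : 0 < b ^ 2 - 4 * a * c) : AddSubgroup ℝ where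
  carrier := {t | ∃ g ∈ stab (formMatrix a b c), shift a b c g = t}
  zero_mem' := ⟨1, one_mem _, shift_one⟩
  add_mem' := by
    rintro _ _ ⟨g, hg, rfl⟩ ⟨h, hh, rfl⟩
    exact ⟨g * h, mul_mem hg hh, shift_mul ha hD hg hh⟩
  neg_mem' := by
    rintro _ ⟨g, hg, rfl⟩
    refine ⟨g⁻¹, inv_mem hg, ?_⟩
    have := shift_mul ha hD hg (inv_mem hg)
    rw [mul_inv_cancel, shift_one] at this
    linarith

/-- By `geodesicPath_eq_div`, the point of parameter `s` is the ratio of the coordinates of `e^s (w,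
1) + i (w', 1)`. Since `g` multiplies the two eigenvectors by `λ` and `λ⁻¹`, it multiplies `e^s` by
`λ²`. -/
lemma smul_pathH (ha : 0 < a) (hD : 0 < b ^ 2 - 4 * a * c) {g : SL(2, ℤ)}
    (hg : g ∈ stab (formMatrix a b c)) (s : ℝ) :
    g • pathH ha hD s = pathH ha hD (s + shift a b c g) := by
  have h0 : ∀ t : ℝ, ((Real.exp t : ℝ) : ℂ) + Complex.I ≠ 0 := by
    intro t h; have := congrArg Complex.im h; simp at this
  have hl : (eigen (endpoint a b c) g : ℂ) ≠ 0 := by exact_mod_cast eigen_ne_zero ha hD hg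
  have e1 : ((eigen (endpoint a b c) g * eigen (endpoint' a b c) g : ℝ) : ℂ) = 1 := by
    rw [eigen_mul_eigen' ha hD hg]; simp
  have e2 : (g 0 0 * endpoint a b c + g 0 1 : ℂ) =
      eigen (endpoint a b c) g * endpoint a b c := by
    exact_mod_cast congrArg (fun x : ℝ => (x : ℂ)) (eigen_mul_endpoint ha hD hg)
  have e3 : (g 0 0 * endpoint' a b c + g 0 1 : ℂ) =
      eigen (endpoint' a b c) g * endpoint' a b c := by
    exact_mod_cast congrArg (fun x : ℝ => (x : ℂ)) (eigen'_mul_endpoint' ha hD hg)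
  have e4 : (eigen (endpoint a b c) g : ℂ) = g 1 0 * endpoint a b c + g 1 1 := by
    simp [eigen]
  have e5 : (eigen (endpoint' a b c) g : ℂ) = g 1 0 * endpoint' a b c + g 1 1 := by
    simp [eigen]
  have hE : ((Real.exp (s + shift a b c g) : ℝ) : ℂ) =
      (Real.exp s : ℝ) * (eigen (endpoint a b c) g : ℂ) ^ 2 := by
    rw [Real.exp_add, exp_shift ha hD hg]; push_cast; rfl
  have hs := h0 s
  have hst := h0 (s + shift a b c g)
  apply UpperHalfPlane.ext
  rw [UpperHalfPlane.coe_specialLinearGroup_apply, coe_pathH, coe_pathH, geodesicPath_eq_div,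
    geodesicPath_eq_div]
  simp only [algebraMap_int_eq, eq_intCast, Complex.ofReal_intCast, Complex.ofReal_mul]
  rw [Complex.ofReal_mul] at e1
  rw [hE] at hst ⊢
  generalize ((Real.exp s : ℝ) : ℂ) = E at *
  generalize (endpoint a b c : ℂ) = w at *
  generalize (endpoint' a b c : ℂ) = w' at *
  generalize (eigen _ g : ℂ) = l at *
  generalize (eigen _ g : ℂ) = l' at *
  have hnum : (g 0 0 : ℂ) * ((w * E + w' * Complex.I) / (E + Complex.I)) + g 0 1 =
      (l * w * E + l' * w' * Complex.I) / (E + Complex.I) := by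
    field_simp
    linear_combination E * e2 + Complex.I * e3
  have hden : (g 1 0 : ℂ) * ((w * E + w' * Complex.I) / (E + Complex.I)) + g 1 1 =
      (l * E + l' * Complex.I) / (E + Complex.I) := by
    field_simp
    linear_combination -E * e4 - Complex.I * e5
  have hne : l * E + l' * Complex.I ≠ 0 := by
    intro h
    apply hst
    linear_combination l * h - Complex.I * e1
  rw [hnum, hden, div_div_div_cancel_right₀ hs, div_eq_div_iff hne hst]
  linear_combination (-l * E * Complex.I * (w - w')) * e1

/-- If `λ² = 1`, the two eigenvalues coincide; as `w ≠ w'`, the entry `g 1 0` vanishes and the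
relations of `stab_relations` make `g` scalar. -/
lemma eq_one_or_neg_one_of_shift_eq_zero (ha : 0 < a) (hD : 0 < b ^ 2 - 4 * a * c)
    {g : SL(2, ℤ)} (hg : g ∈ stab (formMatrix a b c)) (h : shift a b c g = 0) :
    g = 1 ∨ g = -1 := by
  have h1 : eigen (endpoint a b c) g ^ 2 = 1 := by rw [← exp_shift ha hD hg, h, Real.exp_zero]
  have h2 := eigen_mul_eigen' ha hD hg
  have hr := radius_pos ha hD
  obtain ⟨h3, h4⟩ := stab_relations hg
  have h5 : eigen (endpoint' a b c) g = eigen (endpoint a b c) g := by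
    have h6 : eigen (endpoint a b c) g ≠ 0 := eigen_ne_zero ha hD hg
    apply mul_left_cancel₀ h6
    rw [h2, ← h1, sq]
  have h10 : (g 1 0 : ℝ) = 0 := by
    simp only [eigen, endpoint_eq, endpoint'_eq] at h5
    have : (g 1 0 : ℝ) * (2 * radius a b c) = 0 := by linear_combination h5
    exact (mul_eq_zero.1 this).resolve_right (by positivity)
  have h01 : (g 0 1 : ℝ) = 0 := by
    rw [h10, mul_zero, neg_zero] at h3
    exact (mul_eq_zero.1 h3).resolve_left ha.ne'
  have h00 : (g 0 0 : ℝ) = g 1 1 := by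
    rw [h10, mul_zero, sub_zero] at h4
    exact mul_left_cancel₀ ha.ne' h4
  have h11 : (g 1 1 : ℝ) ^ 2 = 1 := by
    rw [← h1, eigen, h10, zero_mul, zero_add]
  norm_cast at h10 h01 h00 h11
  rcases sq_eq_sq_iff_eq_or_eq_neg.1 (h11.trans (one_pow 2).symm) with h | h
  · left
    ext i j
    fin_cases i <;> fin_cases j <;> simp [h10, h01, h00, h]
  · right
    ext i j
    fin_cases i <;> fin_cases j <;> simp [h10, h01, h00, h]

lemma conj_neg_one (X : V) : conj (-1) X = X := by
  rw [conj_apply]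
  ext i j; fin_cases i <;> fin_cases j <;> simp

lemma conj_eq_self_of_shift_eq_zero (ha : 0 < a) (hD : 0 < b ^ 2 - 4 * a * c)
    {g : SL(2, ℤ)} (hg : g ∈ stab (formMatrix a b c)) (h : shift a b c g = 0) (X : V) :
    conj g X = X := by
  rcases eq_one_or_neg_one_of_shift_eq_zero ha hD hg h with rfl | rfl
  · exact conj_one X
  · exact conj_neg_one X

lemma shift_eq_zero_of_conj_eq (ha : 0 < a) (hD : 0 < b ^ 2 - 4 * a * c)
    {g : SL(2, ℤ)} (hg : g ∈ stab (formMatrix a b c)) {Y : V} (hY : bil Y (vecY0 a b c) ≠ 0)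
    (h : conj g Y = Y) : shift a b c g = 0 := by
  have h1 := bil_conj_vecY0 ha hD hg Y
  rw [h] at h1
  have h2 : Real.exp (-shift a b c g) = 1 := by
    apply mul_right_cancel₀ hY
    rw [← h1, one_mul]
  rw [Real.exp_eq_one_iff] at h2
  linarith

/-- An element of `Γ_A` scales `(Y, Y₀)` by `e^{-t}`, where `t` is its shift. If it fixes `Y`, then
`t = 0` and it is `±1`, which is trivial in `PSL₂(ℤ)`. Hence the weights `1/|Γ_Y|` in Hecke's series
are all `1`. -/
lemma stabOrder_eq_one (ha : 0 < a) (hD : 0 < b ^ 2 - 4 * a * c) {Y : V}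
    (hY : bil Y (vecY0 a b c) ≠ 0) : stabOrder (formMatrix a b c) Y = 1 := by
  rw [stabOrder, Subgroup.card_eq_one, Subgroup.map_eq_bot_iff, QuotientGroup.ker_mk']
  rintro g ⟨hg, hg'⟩
  rcases eq_one_or_neg_one_of_shift_eq_zero ha hD hg
    (shift_eq_zero_of_conj_eq ha hD hg hY hg') with rfl | rfl
  · exact one_mem _
  · rw [Subgroup.mem_center_iff]
    intro h; simp

lemma shift_zpow (ha : 0 < a) (hD : 0 < b ^ 2 - 4 * a * c) {g : SL(2, ℤ)}
    (hg : g ∈ stab (formMatrix a b c)) (k : ℤ) : shift a b c (g ^ k) = k * shift a b c g := by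
  let f : stab (formMatrix a b c) →* Multiplicative ℝ :=
    { toFun := fun h => Multiplicative.ofAdd (shift a b c h)
      map_one' := by rw [Subgroup.coe_one, shift_one]; rfl
      map_mul' := fun x y => by rw [Subgroup.coe_mul, shift_mul ha hD x.2 y.2]; rfl }
  have h := map_zpow f ⟨g, hg⟩ k
  have h' := congrArg Multiplicative.toAdd h
  simpa [f] using h'

end Stabilizer

/-! ### Pell's equation and the generator of `Γ_A` -/

section Integral

variable {a b c : ℤ}

lemma disc_pos_cast (hD : 0 < b ^ 2 - 4 * a * c) : (0 : ℝ) < (b : ℝ) ^ 2 - 4 * a * c := by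
  exact_mod_cast hD

/-- A solution of Pell's equation gives an element of `Γ_A` of infinite order. -/
lemma exists_shift_ne_zero (ha : 0 < (a : ℝ)) (hD : 0 < b ^ 2 - 4 * a * c)
    (hsq : ¬IsSquare (b ^ 2 - 4 * a * c)) :
    ∃ g ∈ stab (formMatrix a b c), shift a b c g ≠ 0 := by
  obtain ⟨x, y, hxy, hy⟩ := Pell.exists_of_not_isSquare hD hsq
  -- This is `x + 2yA`, which commutes with `A` and has determinant `x² - D y² = 1`.
  let g : SL(2, ℤ) := ⟨!![x + b * y, 2 * c * y; -(2 * a * y), x - b * y], by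
    rw [Matrix.det_fin_two_of]; linear_combination hxy⟩
  have hg : g ∈ stab (formMatrix a b c) := by
    change conj g _ = _
    have hd := det_cast g
    rw [conj_apply]
    have e00 : (g 0 0 : ℝ) = x + b * y := by simp [g]
    have e01 : (g 0 1 : ℝ) = 2 * c * y := by simp [g]
    have e10 : (g 1 0 : ℝ) = -(2 * a * y) := by simp [g]
    have e11 : (g 1 1 : ℝ) = x - b * y := by simp [g]
    rw [e00, e01, e10, e11] at hd ⊢
    ext i j; fin_cases i <;> fin_cases j <;> simp [formMatrix]
    · linear_combination (b / 2 : ℝ) * hd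
    · linear_combination (c : ℝ) * hd
    · linear_combination (-a : ℝ) * hd
    · linear_combination (-b / 2 : ℝ) * hd
  refine ⟨g, hg, fun h => ?_⟩
  have ha' : a ≠ 0 := by rintro rfl; simp at ha
  rcases eq_one_or_neg_one_of_shift_eq_zero ha (disc_pos_cast hD) hg h with h | h
  all_goals
    have h10 := congrFun (congrFun (congrArg Subtype.val h) 1) 0
    simp [g, ha', hy] at h10

/-- Discreteness comes from integrality of the trace: for the shift `t`, `e^t + e^{-t} = (tr g)² -
2` is an integer, whereas `0 < t < log 2` would place it strictly between `2` and `3`. -/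
lemma one_le_shift (ha : 0 < (a : ℝ)) (hD : 0 < b ^ 2 - 4 * a * c) {g : SL(2, ℤ)}
    (hg : g ∈ stab (formMatrix a b c)) (h : 0 < shift a b c g) :
    Real.log 2 ≤ shift a b c g := by
  have hD' := disc_pos_cast hD
  by_contra! hlt
  have h1 : Real.exp (shift a b c g) < 2 := (Real.lt_log_iff_exp_lt two_pos).1 hlt
  have h2 : 1 < Real.exp (shift a b c g) := Real.one_lt_exp_iff.2 h
  have h3 := Real.exp_neg (shift a b c g)
  have h4 : Real.exp (shift a b c g) + Real.exp (-shift a b c g) =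
      ((g 0 0 + g 1 1) ^ 2 - 2 : ℤ) := by
    rw [exp_shift ha hD' hg, exp_neg_shift ha hD' hg]
    push_cast
    rw [← eigen_add_eigen' ha hg]
    linear_combination (-2) * eigen_mul_eigen' ha hD' hg
  have h5 : Real.exp (shift a b c g) * Real.exp (-shift a b c g) = 1 := by
    rw [← Real.exp_add, add_neg_cancel, Real.exp_zero]
  generalize Real.exp (shift a b c g) = u at *
  generalize Real.exp (-shift a b c g) = u' at *
  have h6 : u + u' < (3 : ℤ) := by
    have : 0 < u' := by nlinarith
    push_cast
    nlinarith
  have h7 : ((2 : ℤ) : ℝ) < u + u' := by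
    push_cast
    nlinarith
  rw [h4] at h6 h7
  have h6' := Int.cast_lt.1 h6
  have h7' := Int.cast_lt.1 h7
  omega

/-- `Γ_A` is infinite cyclic up to sign. -/
lemma exists_generator (ha : 0 < (a : ℝ)) (hD : 0 < b ^ 2 - 4 * a * c)
    (hsq : ¬IsSquare (b ^ 2 - 4 * a * c)) :
    ∃ g₀ ∈ stab (formMatrix a b c), 0 < shift a b c g₀ ∧
      ∀ g ∈ stab (formMatrix a b c), ∃ k : ℤ, shift a b c g = k * shift a b c g₀ := by
  have hD' := disc_pos_cast hD
  -- A subgroup of `ℝ` with no element in `(0, log 2)` is cyclic. It is nonzero by Pell's equation,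
  -- and the generator is inverted below if its shift is negative.
  obtain ⟨t, ht⟩ := AddSubgroup.cyclic_of_isolated_zero (H := shiftGroup ha hD')
    (Real.log_pos one_lt_two) (by
      rw [Set.disjoint_left]
      rintro _ ⟨g, hg, rfl⟩ ⟨h0, h1⟩
      exact absurd (one_le_shift ha hD hg h0) (not_le.2 h1))
  have hgen : ∀ g ∈ stab (formMatrix a b c), ∃ k : ℤ, shift a b c g = k * t := fun g hg => by
    have : shift a b c g ∈ shiftGroup ha hD' := ⟨g, hg, rfl⟩
    rw [ht, AddSubgroup.mem_closure_singleton] at this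
    obtain ⟨k, hk⟩ := this
    exact ⟨k, by rw [← hk, zsmul_eq_mul]⟩
  obtain ⟨g, hg, hgt⟩ : t ∈ shiftGroup ha hD' := by
    rw [ht]; exact AddSubgroup.mem_closure_singleton_self t
  have ht0 : t ≠ 0 := by
    rintro rfl
    obtain ⟨h, hh, hne⟩ := exists_shift_ne_zero ha hD hsq
    obtain ⟨k, hk⟩ := hgen h hh
    exact hne (by rw [hk, mul_zero])
  rcases lt_or_gt_of_ne ht0 with h | h
  · refine ⟨g⁻¹, inv_mem hg, ?_, fun g' hg' => ?_⟩
    all_goals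
      have hi : shift a b c g⁻¹ = -t := by
        have := shift_zpow ha hD' hg (-1)
        simpa [hgt] using this
    · rw [hi]; linarith
    · obtain ⟨k, hk⟩ := hgen g' hg'
      exact ⟨-k, by rw [hk, hi]; push_cast; ring⟩
  · exact ⟨g, hg, by rwa [hgt], by rwa [hgt]⟩

/-- The elements `g` and `g₀^k` differ by an element of shift zero, that is by `±1`, which acts
trivially. -/
lemma conj_eq_conj_zpow (ha : 0 < (a : ℝ)) (hD : 0 < b ^ 2 - 4 * a * c) {g₀ g : SL(2, ℤ)}
    (hg₀ : g₀ ∈ stab (formMatrix a b c)) (hg : g ∈ stab (formMatrix a b c)) {k : ℤ}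
    (hk : shift a b c g = k * shift a b c g₀) (X : V) : conj g X = conj (g₀ ^ k) X := by
  have hD' := disc_pos_cast hD
  have h0 : shift a b c (g₀ ^ (-k) * g) = 0 := by
    rw [shift_mul ha hD' (zpow_mem hg₀ _) hg, shift_zpow ha hD' hg₀, hk]; push_cast; ring
  have h1 := conj_eq_self_of_shift_eq_zero ha hD' (mul_mem (zpow_mem hg₀ (-k)) hg) h0 X
  rw [conj_mul, zpow_neg] at h1
  have h2 := conj_inv_eq h1
  rw [inv_inv] at h2
  exact h2.symm

end Integral

/-! ### Fundamental domains on the geodesic -/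

section FundamentalDomain

variable {a b c : ℝ}

open MeasureTheory

/-- In arc length, the `Γ_A`-orbits on `S_A` are the cosets of the group generated by the shift of
`g₀`. -/
lemma smul_mem_iff (ha : 0 < a) (hD : 0 < b ^ 2 - 4 * a * c) {g₀ : SL(2, ℤ)}
    (hg₀ : g₀ ∈ stab (formMatrix a b c))
    (hgen : ∀ g ∈ stab (formMatrix a b c), ∃ k : ℤ, shift a b c g = k * shift a b c g₀)
    (s s' : ℝ) :
    (∃ g ∈ stab (formMatrix a b c), g • pathH ha hD s = pathH ha hD s') ↔
      ∃ k : ℤ, s' = s + k * shift a b c g₀ := by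
  constructor
  · rintro ⟨g, hg, h⟩
    obtain ⟨k, hk⟩ := hgen g hg
    rw [smul_pathH ha hD hg] at h
    have := congrArg (arcCoord a b) h
    rw [arcCoord_pathH, arcCoord_pathH, hk] at this
    exact ⟨k, this.symm⟩
  · rintro ⟨k, rfl⟩
    exact ⟨g₀ ^ k, zpow_mem hg₀ k, by rw [smul_pathH ha hD (zpow_mem hg₀ k),
      shift_zpow ha hD hg₀]⟩

lemma exists_isFundDomain (ha : 0 < a) (hD : 0 < b ^ 2 - 4 * a * c) {g₀ : SL(2, ℤ)}
    (hg₀ : g₀ ∈ stab (formMatrix a b c)) (hpos : 0 < shift a b c g₀)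
    (hgen : ∀ g ∈ stab (formMatrix a b c), ∃ k : ℤ, shift a b c g = k * shift a b c g₀) :
    ∃ F : Set ℍ, IsFundDomain a b c F := by
  refine ⟨geodesic a b c ∩ arcCoord a b ⁻¹' Set.Ioc 0 (0 + shift a b c g₀),
    Set.inter_subset_left, ?_, ?_⟩
  · refine MeasurableSet.inter ?_ ?_
    · refine IsClosed.measurableSet (isClosed_eq ?_ continuous_const)
      have h1 : Continuous fun z : ℍ => (z : ℂ) := UpperHalfPlane.continuous_coe
      have h2 : Continuous fun z : ℍ => z.re := UpperHalfPlane.continuous_re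
      fun_prop
    · refine Continuous.measurable ?_ measurableSet_Ioc
      have h1 : Continuous fun z : ℍ => z.re := UpperHalfPlane.continuous_re
      have h2 : Continuous fun z : ℍ => z.im := UpperHalfPlane.continuous_im
      exact Real.continuous_arsinh.comp
        ((continuous_const.sub h1).div h2 fun z => z.im_pos.ne')
  · intro z hz
    rw [← pathH_arcCoord ha hD hz]
    generalize arcCoord a b z = s
    obtain ⟨k, hk, huniq⟩ := existsUnique_add_zsmul_mem_Ioc hpos s 0
    simp only [zsmul_eq_mul] at hk huniq
    refine ⟨pathH ha hD (s + k * shift a b c g₀), ⟨⟨pathH_mem_geodesic ha hD _, ?_⟩,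
      (smul_mem_iff ha hD hg₀ hgen _ _).2 ⟨k, rfl⟩⟩, ?_⟩
    · rwa [Set.mem_preimage, arcCoord_pathH]
    · rintro z' ⟨⟨hz', hmem⟩, h⟩
      rw [← pathH_arcCoord ha hD hz'] at h ⊢
      obtain ⟨k', hk'⟩ := (smul_mem_iff ha hD hg₀ hgen _ _).1 h
      rw [Set.mem_preimage, hk'] at hmem
      rw [hk', huniq k' hmem]

/-- Periodic functions have the same integral over all fundamental domains of a group of
translations. This reduces an arbitrary `F` in `HasCycleIntegral` to one period. -/
lemma isAddFundamentalDomain_params (ha : 0 < a) (hD : 0 < b ^ 2 - 4 * a * c) {g₀ : SL(2, ℤ)}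
    (hg₀ : g₀ ∈ stab (formMatrix a b c))
    (hgen : ∀ g ∈ stab (formMatrix a b c), ∃ k : ℤ, shift a b c g = k * shift a b c g₀)
    {F : Set ℍ} (hF : IsFundDomain a b c F) :
    IsAddFundamentalDomain (AddSubgroup.zmultiples (shift a b c g₀)) (params a b c F)
      volume := by
  obtain ⟨hsub, hmeas, huniq⟩ := hF
  rw [params_eq_preimage ha hD]
  refine IsAddFundamentalDomain.mk'
    ((continuous_pathH ha hD).measurable hmeas).nullMeasurableSet fun s => ?_
  obtain ⟨z, ⟨hz, h⟩, hu⟩ := huniq _ (pathH_mem_geodesic ha hD s)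
  have hzp := pathH_arcCoord ha hD (hsub hz)
  rw [← hzp] at h
  obtain ⟨k, hk⟩ := (smul_mem_iff ha hD hg₀ hgen _ _).1 h
  refine ⟨⟨k * shift a b c g₀, ⟨k, by simp⟩⟩, ?_, ?_⟩
  · change pathH ha hD (k * shift a b c g₀ + s) ∈ F
    rwa [add_comm, ← hk, hzp]
  · rintro ⟨_, ⟨j, rfl⟩⟩ hj
    change pathH ha hD (j • shift a b c g₀ + s) ∈ F at hj
    have h1 := hu _ ⟨hj, (smul_mem_iff ha hD hg₀ hgen _ _).2 ⟨j, by
      rw [zsmul_eq_mul, add_comm]⟩⟩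
    have h2 := congrArg (arcCoord a b) h1
    rw [arcCoord_pathH, hk] at h2
    ext
    change j • shift a b c g₀ = k * shift a b c g₀
    linarith

end FundamentalDomain

/-! ### Gaussian sums over lattices -/

/-- The Euclidean norm on matrices of trace zero. -/
def sqNorm (X : V) : ℝ := X 0 0 ^ 2 + X 0 1 ^ 2 + X 1 0 ^ 2

lemma sqNorm_nonneg (X : V) : 0 ≤ sqNorm X := by unfold sqNorm; positivity

/-- These are the norms of the terms of the Jacobi theta series at `z = 0`, `τ = ic/π`. -/
lemma summable_exp_neg_mul_int_sq {c : ℝ} (hc : 0 < c) :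
    Summable fun n : ℤ => Real.exp (-c * (n : ℝ) ^ 2) := by
  have h : 0 < (((c / Real.pi : ℝ) : ℂ) * Complex.I).im := by
    have := Real.pi_pos
    simp only [Complex.im_ofReal_mul, Complex.I_im, mul_one]
    positivity
  refine ((summable_jacobiTheta₂_term_iff 0 _).2 h).norm.congr fun n => ?_
  rw [norm_jacobiTheta₂_term]
  congr 1
  simp
  field_simp

/-- The Gaussian sum over the points of a set contained in a scaled copy of `L` converges. -/
lemma summable_exp_neg_sqNorm {ι : Type*} {f : ι → V} (hf : Function.Injective f) {K : ℝ}
    (hK : K ≠ 0) (hL : ∀ i, K • f i ∈ latticeL) {c : ℝ} (hc : 0 < c) :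
    Summable fun i => Real.exp (-c * sqNorm (f i)) := by
  choose α β γ h using hL
  have hc' : 0 < c / K ^ 2 := by positivity
  have h1 := summable_exp_neg_mul_int_sq hc'
  -- The coordinates of `K • f i` are integers, so the Gaussian is part of a product of three
  -- one-dimensional ones with parameter `c/K²`.
  have h2 := h1.mul_of_nonneg (h1.mul_of_nonneg h1 (fun _ => (Real.exp_pos _).le)
    (fun _ => (Real.exp_pos _).le)) (fun _ => (Real.exp_pos _).le)
    (fun _ => (mul_pos (Real.exp_pos _) (Real.exp_pos _)).le)
  have hinj : Function.Injective fun i => (α i, β i, γ i) := by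
    intro i j hij
    simp only [Prod.mk.injEq] at hij
    apply hf
    have : K • f i = K • f j := by rw [h i, h j, hij.1, hij.2.1, hij.2.2]
    exact smul_right_injective V hK this
  refine (h2.comp_injective hinj).congr fun i => ?_
  simp only [Function.comp_apply]
  rw [← Real.exp_add, ← Real.exp_add]
  congr 1
  have e00 := congrFun (congrFun (h i) 0) 0
  have e01 := congrFun (congrFun (h i) 0) 1
  have e10 := congrFun (congrFun (h i) 1) 0
  simp at e00 e01 e10
  rw [sqNorm]
  have e10' : (α i : ℝ) = -(K * f i 1 0) := by linarith
  rw [← e00, ← e01, e10']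
  field_simp
  ring

/-! ### The Siegel theta function -/

lemma norm_e (x : ℂ) : ‖e x‖ = Real.exp (-(2 * Real.pi * x.im)) := by
  rw [e, Complex.norm_exp]
  simp

lemma e_add (x y : ℂ) : e (x + y) = e x * e y := by
  rw [e, e, e, ← Complex.exp_add]; congr 1; ring

lemma e_mul_I (x : ℝ) : e (x * Complex.I) = (Real.exp (-(2 * Real.pi * x)) : ℝ) := by
  rw [e, Complex.ofReal_exp]
  congr 1
  push_cast
  linear_combination (2 * Real.pi * x : ℂ) * Complex.I_sq

lemma bil_posVec_self {z : ℂ} (hz : 0 < z.im) : bil (posVec z) (posVec z) = 1 := by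
  have h2 : √2 ^ 2 = 2 := Real.sq_sqrt two_pos.le
  have h2' : 0 < √2 := by positivity
  rw [posVec, bil_smul_left, bil_smul_right, bil_eq, Complex.sq_norm, Complex.normSq_apply]
  simp
  field_simp
  rw [h2]
  ring

lemma q_projLine {A : V} (hA : bil A A = 1) (X : V) : q (projLine A X) = bil X A ^ 2 / 2 := by
  have h := bil_self A
  rw [projLine, q_smul, hA, div_one]
  rw [hA] at h
  linear_combination (-(bil X A ^ 2) / 2) * h

lemma q_projPerp {A : V} (hA : bil A A = 1) (X : V) :
    q (projPerp A X) = q X - bil X A ^ 2 / 2 := by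
  have h := q_add (projPerp A X) (projLine A X)
  rw [projPerp_add_projLine, q_projLine hA] at h
  have h2 : bil (projPerp A X) (projLine A X) = 0 := by
    rw [projLine, bil_smul_right, bil_projPerp (by rw [hA]; exact one_ne_zero), mul_zero]
  linarith

/-- The product of the summands of the Siegel theta function as a Gaussian in `(X, X(z))`. -/
lemma siegelTerm_eq (τ : ℍ) {z : ℂ} (hz : 0 < z.im) (X : V) :
    siegelTerm τ z X = e ((q X : ℂ) * (starRingEnd ℂ) (τ : ℂ)) *
      (Real.exp (-(2 * Real.pi * τ.im * bil X (posVec z) ^ 2)) : ℝ) := by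
  have h := bil_posVec_self hz
  rw [siegelTerm, q_projLine h, q_projPerp h]
  have h1 : -(2 * Real.pi * τ.im * bil X (posVec z) ^ 2) =
    -(2 * Real.pi * (τ.im * bil X (posVec z) ^ 2)) := by ring
  rw [h1, ← e_mul_I, ← e_add]
  congr 1
  have h2 : (τ : ℂ) = τ.re + τ.im * Complex.I := (Complex.re_add_im _).symm
  have h3 : (starRingEnd ℂ) (τ : ℂ) = τ.re - τ.im * Complex.I := by
    rw [h2]; simp [sub_eq_add_neg]
  rw [h3, h2]
  push_cast
  ring

lemma norm_siegelTerm (τ : ℍ) {z : ℂ} (hz : 0 < z.im) (X : V) :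
    ‖siegelTerm τ z X‖ =
      Real.exp (-(2 * Real.pi * τ.im * (bil X (posVec z) ^ 2 - q X))) := by
  rw [siegelTerm_eq τ hz, norm_mul, norm_e, Complex.norm_real, Real.norm_of_nonneg
    (Real.exp_pos _).le, ← Real.exp_add]
  congr 1
  simp
  ring

/-- The partial derivative of `(X, X(z))` with respect to `x`. -/
noncomputable def posDerivX (X : V) (z : ℂ) : ℝ :=
  √2 * (-X 1 0 * z.re + X 0 0) / z.im

/-- The partial derivative of `(X, X(z))` with respect to `y`. -/
noncomputable def posDerivY (X : V) (z : ℂ) : ℝ :=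
  √2 * -X 1 0 - bil X (posVec z) / z.im

lemma bil_posVec {X : V} (hX : X 1 1 = -X 0 0) (z : ℂ) : bil X (posVec z) =
    (-X 1 0 * (z.re ^ 2 + z.im ^ 2) + 2 * X 0 0 * z.re + X 0 1) * (√2 * z.im)⁻¹ := by
  rw [posVec, bil_smul_right, bil_eq, Complex.sq_norm, Complex.normSq_apply]
  simp [hX]
  ring

lemma hasFDerivAt_bil_posVec {X : V} (hX : X 1 1 = -X 0 0) {z : ℂ} (hz : 0 < z.im) :
    HasFDerivAt (fun z => bil X (posVec z))
      (posDerivX X z • Complex.reCLM + posDerivY X z • Complex.imCLM) z := by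
  have h2 : √2 ^ 2 = 2 := Real.sq_sqrt two_pos.le
  have h2' : 0 < √2 := by positivity
  have hre : HasFDerivAt Complex.re Complex.reCLM z := Complex.reCLM.hasFDerivAt
  have him : HasFDerivAt Complex.im Complex.imCLM z := Complex.imCLM.hasFDerivAt
  have h1 := ((((hre.pow 2).add (him.pow 2)).const_mul (-X 1 0)).add
    (hre.const_mul (2 * X 0 0))).add_const (X 0 1)
  have h3 := (hasDerivAt_inv (show √2 * z.im ≠ 0 by positivity)).comp_hasFDerivAt z
    (him.const_mul √2)
  have h4 := h1.mul h3
  have hfun : (fun z => bil X (posVec z)) = fun z =>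
      (-X 1 0 * (z.re ^ 2 + z.im ^ 2) + 2 * X 0 0 * z.re + X 0 1) * (√2 * z.im)⁻¹ :=
    funext (bil_posVec hX)
  rw [hfun]
  refine h4.congr_fderiv ?_
  ext v
  simp [posDerivX, posDerivY, bil_posVec hX]
  field_simp
  rw [h2]
  ring

/-- Twice the majorant of the quadratic form attached to `z`. -/
lemma majorant_eq {X : V} (hX : X 1 1 = -X 0 0) {z : ℂ} (hz : 0 < z.im) :
    2 * z.im ^ 2 * (bil X (posVec z) ^ 2 - q X) =
      (√2 * z.im * bil X (posVec z) + z.im ^ 2 * X 1 0) ^ 2 + (z.im ^ 2 * X 1 0) ^ 2 +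
        2 * (z.im * (-X 1 0 * z.re + X 0 0)) ^ 2 := by
  have h2 : √2 ^ 2 = 2 := Real.sq_sqrt two_pos.le
  have h2' : 0 < √2 := by positivity
  rw [bil_posVec hX, q_eq, hX]
  field_simp
  rw [h2]
  ring

/-- The bound for the ratio of the Euclidean norm and the majorant attached to `z`. -/
noncomputable def distortion (z : ℂ) : ℝ :=
  2 / z.im ^ 2 + 2 + 4 * z.re ^ 2 / z.im ^ 2 + 6 * z.im ^ 2 + 6 * z.re ^ 4 / z.im ^ 2 +
    12 * z.re ^ 2

/-- Each bound keeps some of the squares in `majorant_eq`; for the second, `√2 y (X, X(z))` is the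
difference of the first two squared quantities. -/
lemma majorant_bounds {X : V} (hX : X 1 1 = -X 0 0) {z : ℂ} (hz : 0 < z.im) :
    0 ≤ bil X (posVec z) ^ 2 - q X ∧
    bil X (posVec z) ^ 2 ≤ 2 * (bil X (posVec z) ^ 2 - q X) ∧
    X 1 0 ^ 2 ≤ 2 * (bil X (posVec z) ^ 2 - q X) / z.im ^ 2 ∧
    (-X 1 0 * z.re + X 0 0) ^ 2 ≤ bil X (posVec z) ^ 2 - q X ∧
    (√2 * z.im * bil X (posVec z) + z.im ^ 2 * X 1 0) ^ 2 ≤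
      2 * z.im ^ 2 * (bil X (posVec z) ^ 2 - q X) := by
  have h := majorant_eq hX hz
  have h2 : √2 ^ 2 = 2 := Real.sq_sqrt two_pos.le
  generalize bil X (posVec z) ^ 2 - q X = S at *
  have hy2 : 0 < z.im ^ 2 := by positivity
  refine ⟨?_, ?_, ?_, ?_, ?_⟩
  · by_contra! hS
    have : 2 * z.im ^ 2 * S < 0 := mul_neg_of_pos_of_neg (by positivity) hS
    nlinarith [sq_nonneg (√2 * z.im * bil X (posVec z) + z.im ^ 2 * X 1 0),
      sq_nonneg (z.im ^ 2 * X 1 0), sq_nonneg (z.im * (-X 1 0 * z.re + X 0 0))]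
  · have h3 : (√2 * z.im * bil X (posVec z)) ^ 2 ≤ 2 * (2 * z.im ^ 2 * S) := by
      nlinarith [sq_nonneg (√2 * z.im * bil X (posVec z) + 2 * (z.im ^ 2 * X 1 0)),
        sq_nonneg (z.im * (-X 1 0 * z.re + X 0 0))]
    rw [mul_pow, mul_pow, h2] at h3
    have : 2 * z.im ^ 2 * bil X (posVec z) ^ 2 ≤ 2 * z.im ^ 2 * (2 * S) := by linarith
    exact le_of_mul_le_mul_left this (by positivity)
  · rw [le_div_iff₀ hy2]
    have : z.im ^ 2 * (X 1 0 ^ 2 * z.im ^ 2) ≤ z.im ^ 2 * (2 * S) := by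
      nlinarith [sq_nonneg (√2 * z.im * bil X (posVec z) + z.im ^ 2 * X 1 0),
        sq_nonneg (z.im * (-X 1 0 * z.re + X 0 0))]
    exact le_of_mul_le_mul_left this hy2
  · have : 2 * z.im ^ 2 * (-X 1 0 * z.re + X 0 0) ^ 2 ≤ 2 * z.im ^ 2 * S := by
      nlinarith [sq_nonneg (√2 * z.im * bil X (posVec z) + z.im ^ 2 * X 1 0),
        sq_nonneg (z.im ^ 2 * X 1 0)]
    exact le_of_mul_le_mul_left this (by positivity)
  · nlinarith [sq_nonneg (z.im ^ 2 * X 1 0), sq_nonneg (z.im * (-X 1 0 * z.re + X 0 0))]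

/-- The entries of `X` are recovered linearly from the quantities bounded in `majorant_bounds`. The
inequalities `(u + v)² ≤ 2(u² + v²)` and its analogue for three terms produce the coefficients of
`distortion`. Only its positivity and continuity matter later. -/
lemma sqNorm_le {X : V} (hX : X 1 1 = -X 0 0) {z : ℂ} (hz : 0 < z.im) :
    sqNorm X ≤ distortion z * (bil X (posVec z) ^ 2 - q X) := by
  obtain ⟨h0, -, h10, h00, h01⟩ := majorant_bounds hX hz
  have h2 : √2 ^ 2 = 2 := Real.sq_sqrt two_pos.le
  have h2' : 0 < √2 := by positivity
  have hC : X 0 1 = (√2 * z.im * bil X (posVec z) + z.im ^ 2 * X 1 0) +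
      -X 1 0 * z.re ^ 2 - 2 * z.re * (-X 1 0 * z.re + X 0 0) := by
    rw [bil_posVec hX]
    field_simp
    ring
  have hB : X 0 0 = (-X 1 0 * z.re + X 0 0) + X 1 0 * z.re := by ring
  generalize bil X (posVec z) ^ 2 - q X = S at *
  generalize √2 * z.im * bil X (posVec z) + z.im ^ 2 * X 1 0 = U at *
  generalize hW : -X 1 0 * z.re + X 0 0 = W at *
  have hx2 := sq_nonneg z.re
  have k1 : X 0 0 ^ 2 ≤ 2 * S + 2 * z.re ^ 2 * (2 * S / z.im ^ 2) := by
    rw [hB]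
    nlinarith [sq_nonneg (W - X 1 0 * z.re), mul_le_mul_of_nonneg_left h10 hx2]
  have k2 : X 0 1 ^ 2 ≤ 3 * (2 * z.im ^ 2 * S) + 3 * z.re ^ 4 * (2 * S / z.im ^ 2) +
      12 * z.re ^ 2 * S := by
    have e : X 0 1 ^ 2 ≤ 3 * (U ^ 2 + (X 1 0 * z.re ^ 2) ^ 2 + (2 * z.re * W) ^ 2) := by
      rw [hC]
      nlinarith [sq_nonneg (U + X 1 0 * z.re ^ 2), sq_nonneg (U + 2 * z.re * W),
        sq_nonneg (X 1 0 * z.re ^ 2 - 2 * z.re * W)]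
    have hx4 : 0 ≤ z.re ^ 4 := by positivity
    nlinarith [mul_le_mul_of_nonneg_left h10 hx4, mul_le_mul_of_nonneg_left h00 hx2]
  have : distortion z * S = 2 * S / z.im ^ 2 + (2 * S + 2 * z.re ^ 2 * (2 * S / z.im ^ 2)) +
      (3 * (2 * z.im ^ 2 * S) + 3 * z.re ^ 4 * (2 * S / z.im ^ 2) + 12 * z.re ^ 2 * S) := by
    unfold distortion; field_simp; ring
  rw [this, sqNorm]
  linarith

lemma abs_mul_posDeriv_le {X : V} (hX : X 1 1 = -X 0 0) {z : ℂ} (hz : 0 < z.im) :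
    |bil X (posVec z)| * (|posDerivX X z| + |posDerivY X z|) ≤
      9 / z.im * (bil X (posVec z) ^ 2 - q X) := by
  obtain ⟨h0, h1, h10, h00, -⟩ := majorant_bounds hX hz
  have h2 : √2 ^ 2 = 2 := Real.sq_sqrt two_pos.le
  have hx : (z.im * posDerivX X z) ^ 2 ≤ 2 * (bil X (posVec z) ^ 2 - q X) := by
    have : z.im * posDerivX X z = √2 * (-X 1 0 * z.re + X 0 0) := by
      unfold posDerivX; field_simp
    rw [this, mul_pow, h2]; linarith
  have hy : (z.im * posDerivY X z) ^ 2 ≤ 12 * (bil X (posVec z) ^ 2 - q X) := by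
    have e1 : z.im * posDerivY X z = √2 * (z.im * -X 1 0) - bil X (posVec z) := by
      unfold posDerivY; field_simp
    have e2 : (√2 * (z.im * -X 1 0)) ^ 2 ≤ 4 * (bil X (posVec z) ^ 2 - q X) := by
      rw [mul_pow, h2, mul_pow, neg_sq]
      rw [le_div_iff₀ (by positivity)] at h10
      linarith
    rw [e1]
    nlinarith [sq_nonneg (√2 * (z.im * -X 1 0) + bil X (posVec z))]
  rw [div_mul_eq_mul_div, le_div_iff₀ hz]
  have ex : z.im * |posDerivX X z| = |z.im * posDerivX X z| := by rw [abs_mul, abs_of_pos hz]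
  have ey : z.im * |posDerivY X z| = |z.im * posDerivY X z| := by rw [abs_mul, abs_of_pos hz]
  have : |bil X (posVec z)| * (|posDerivX X z| + |posDerivY X z|) * z.im =
      |bil X (posVec z)| * |z.im * posDerivX X z| +
        |bil X (posVec z)| * |z.im * posDerivY X z| := by rw [← ex, ← ey]; ring
  rw [this]
  rw [← sq_abs] at hx hy
  have h1' : |bil X (posVec z)| ^ 2 ≤ 2 * (bil X (posVec z) ^ 2 - q X) := by rwa [sq_abs]
  -- By `2uv ≤ u² + v²`, the bounds `2`, `2`, `12` for the squares give `(2 + 2)/2 + (2 + 12)/2 =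
  -- 9`.
  nlinarith [sq_nonneg (|bil X (posVec z)| - |z.im * posDerivX X z|),
    sq_nonneg (|bil X (posVec z)| - |z.im * posDerivY X z|)]

/-- The derivative of a summand of the Siegel theta function. -/
noncomputable def siegelTermDeriv (τ : ℍ) (X : V) (z : ℂ) : ℂ →L[ℝ] ℂ :=
  (siegelTerm τ z X * ((-(4 * Real.pi * τ.im) * bil X (posVec z) : ℝ) : ℂ)) •
    Complex.ofRealCLM.comp (posDerivX X z • Complex.reCLM + posDerivY X z • Complex.imCLM)

lemma hasFDerivAt_siegelTerm (τ : ℍ) {X : V} (hX : X 1 1 = -X 0 0) {z : ℂ} (hz : 0 < z.im) :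
    HasFDerivAt (fun z => siegelTerm τ z X) (siegelTermDeriv τ X z) z := by
  have hp := hasFDerivAt_bil_posVec hX hz
  have h1 := ((hp.pow 2).const_mul (2 * Real.pi * τ.im)).neg.exp
  have h2 := (Complex.ofRealCLM.hasFDerivAt.comp z h1).const_mul
    (e ((q X : ℂ) * (starRingEnd ℂ) (τ : ℂ)))
  have hev : (fun z => siegelTerm τ z X) =ᶠ[nhds z] fun z =>
      e ((q X : ℂ) * (starRingEnd ℂ) (τ : ℂ)) *
        (Complex.ofRealCLM ∘ fun z =>
          Real.exp (-(2 * Real.pi * τ.im * bil X (posVec z) ^ 2))) z := by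
    filter_upwards [(isOpen_lt continuous_const Complex.continuous_im).mem_nhds hz] with z' hz'
    exact siegelTerm_eq τ hz' X
  refine (h2.congr_of_eventuallyEq hev).congr_fderiv ?_
  rw [siegelTermDeriv, siegelTerm_eq τ hz]
  ext v
  simp
  ring

lemma norm_siegelTermDeriv_le (τ : ℍ) {X : V} (hX : X 1 1 = -X 0 0) {z : ℂ} (hz : 0 < z.im) :
    ‖siegelTermDeriv τ X z‖ ≤
      36 / z.im * Real.exp (-(Real.pi * τ.im * (bil X (posVec z) ^ 2 - q X))) := by
  have hv := τ.im_pos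
  have hpi := Real.pi_pos
  have hL : ‖Complex.ofRealCLM.comp
      (posDerivX X z • Complex.reCLM + posDerivY X z • Complex.imCLM)‖ ≤
      |posDerivX X z| + |posDerivY X z| := by
    refine (ContinuousLinearMap.opNorm_comp_le _ _).trans ?_
    rw [Complex.ofRealCLM_norm, one_mul]
    refine (norm_add_le _ _).trans ?_
    rw [norm_smul, norm_smul, Complex.reCLM_norm, Complex.imCLM_norm, mul_one, mul_one]
    rfl
  have hb := abs_mul_posDeriv_le hX hz
  have h0 := (majorant_bounds hX hz).1
  rw [siegelTermDeriv, norm_smul, norm_mul, norm_siegelTerm τ hz, Complex.norm_real,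
    Real.norm_eq_abs, abs_mul, abs_neg, abs_of_pos (by positivity : 0 < 4 * Real.pi * τ.im)]
  generalize ‖Complex.ofRealCLM.comp
      (posDerivX X z • Complex.reCLM + posDerivY X z • Complex.imCLM)‖ = L at *
  generalize bil X (posVec z) ^ 2 - q X = S at *
  have h3 : |bil X (posVec z)| * L ≤ 9 / z.im * S :=
    (mul_le_mul_of_nonneg_left hL (abs_nonneg _)).trans hb
  -- Half of the Gaussian decay is spent on absorbing the linear factor `S`; the constant `36` is `4
  -- · 9`.
  have h4 : Real.pi * τ.im * S ≤ Real.exp (Real.pi * τ.im * S) := by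
    linarith [Real.add_one_le_exp (Real.pi * τ.im * S)]
  have h5 : Real.exp (-(2 * Real.pi * τ.im * S)) * Real.exp (Real.pi * τ.im * S) =
      Real.exp (-(Real.pi * τ.im * S)) := by
    rw [← Real.exp_add]; congr 1; ring
  calc Real.exp (-(2 * Real.pi * τ.im * S)) * (4 * Real.pi * τ.im * |bil X (posVec z)|) * L
      = Real.exp (-(2 * Real.pi * τ.im * S)) * (4 * Real.pi * τ.im) *
          (|bil X (posVec z)| * L) := by ring
    _ ≤ Real.exp (-(2 * Real.pi * τ.im * S)) * (4 * Real.pi * τ.im) * (9 / z.im * S) :=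
        mul_le_mul_of_nonneg_left h3 (by positivity)
    _ = 36 / z.im * (Real.exp (-(2 * Real.pi * τ.im * S)) * (Real.pi * τ.im * S)) := by ring
    _ ≤ 36 / z.im * (Real.exp (-(2 * Real.pi * τ.im * S)) * Real.exp (Real.pi * τ.im * S)) := by
        gcongr
    _ = _ := by rw [h5]

lemma continuousAt_distortion {z : ℂ} (hz : 0 < z.im) : ContinuousAt distortion z := by
  have h2 : ContinuousAt (fun z : ℂ => z.im ^ 2) z := by fun_prop
  have h3 : z.im ^ 2 ≠ 0 := by positivity
  have hre : ContinuousAt (fun z : ℂ => z.re) z := by fun_prop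
  unfold distortion
  exact (((((continuousAt_const.div h2 h3).add continuousAt_const).add
    (((hre.pow 2).const_mul 4).div h2 h3)).add (h2.const_mul 6)).add
    (((hre.pow 4).const_mul 6).div h2 h3)).add ((hre.pow 2).const_mul 12)

lemma distortion_pos {z : ℂ} : 0 < distortion z := by unfold distortion; positivity

lemma summable_sqNorm_dual (γ : Disc latticeL) {c : ℝ} (hc : 0 < c) :
    Summable fun X : {X : dual latticeL // toDisc latticeL X = γ} =>
      Real.exp (-c * sqNorm (X.1 : V)) :=
  summable_exp_neg_sqNorm (f := fun X : {X : dual latticeL // toDisc latticeL X = γ} => (X.1 : V))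
    (Subtype.val_injective.comp Subtype.val_injective) two_ne_zero
    (fun X => two_smul_mem_latticeL X.1.2) hc

lemma summable_siegelTerm (τ : ℍ) (γ : Disc latticeL) {z : ℂ} (hz : 0 < z.im) :
    Summable fun X : {X : dual latticeL // toDisc latticeL X = γ} => siegelTerm τ z X.1 := by
  have hv := τ.im_pos
  have hpi := Real.pi_pos
  have hd := distortion_pos (z := z)
  refine .of_norm_bounded (summable_sqNorm_dual γ
    (c := 2 * Real.pi * τ.im / distortion z) (by positivity)) fun X => ?_
  rw [norm_siegelTerm τ hz, Real.exp_le_exp]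
  have h := sqNorm_le (traceless_of_mem_dual X.1.2) hz
  rw [neg_mul, neg_le_neg_iff, div_mul_eq_mul_div, div_le_iff₀ hd]
  calc _ ≤ 2 * Real.pi * τ.im * (distortion z * (bil X.1 (posVec z) ^ 2 - q X.1)) := by gcongr
    _ = _ := by ring

/-- The Siegel theta function may be differentiated term by term. -/
lemma hasFDerivAt_tsum_siegelTerm (τ : ℍ) (γ : Disc latticeL) {z : ℂ} (hz : 0 < z.im) :
    (Summable fun X : {X : dual latticeL // toDisc latticeL X = γ} =>
      siegelTermDeriv τ X.1 z) ∧
    HasFDerivAt (fun z => ∑' X : {X : dual latticeL // toDisc latticeL X = γ},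
      siegelTerm τ z X.1)
      (∑' X : {X : dual latticeL // toDisc latticeL X = γ}, siegelTermDeriv τ X.1 z) z := by
  have hv := τ.im_pos
  have hpi := Real.pi_pos
  have hd := distortion_pos (z := z)
  -- On a small ball the imaginary part and the distortion are controlled, so a single summable
  -- Gaussian dominates all derivatives there. Halving the imaginary part turns `36` into `72`.
  have hev : ∀ᶠ z' in nhds z, z.im / 2 < z'.im ∧ distortion z' < distortion z + 1 :=
    (Complex.continuous_im.continuousAt.eventually_const_lt (by linarith)).and
      ((continuousAt_distortion hz).eventually_lt continuousAt_const (by linarith))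
  obtain ⟨ε, hε, hball⟩ := Metric.eventually_nhds_iff_ball.1 hev
  have hu := (summable_sqNorm_dual γ (c := Real.pi * τ.im / (distortion z + 1))
    (by positivity)).mul_left (72 / z.im)
  have hbound : ∀ (X : {X : dual latticeL // toDisc latticeL X = γ}) (z' : ℂ),
      z' ∈ Metric.ball z ε → ‖siegelTermDeriv τ X.1 z'‖ ≤
        72 / z.im * Real.exp (-(Real.pi * τ.im / (distortion z + 1)) * sqNorm (X.1 : V)) := by
    intro X z' hz'
    obtain ⟨h1, h2⟩ := hball z' hz'
    have hz'' : 0 < z'.im := by linarith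
    have hX := traceless_of_mem_dual X.1.2
    have h3 := (majorant_bounds hX hz'').1
    refine (norm_siegelTermDeriv_le τ hX hz'').trans (mul_le_mul ?_ ?_ (Real.exp_pos _).le
      (by positivity))
    · rw [div_le_div_iff₀ hz'' hz]; linarith
    · rw [Real.exp_le_exp, neg_mul, neg_le_neg_iff, div_mul_eq_mul_div,
        div_le_iff₀ (by positivity)]
      have h4 := sqNorm_le hX hz''
      calc _ ≤ Real.pi * τ.im * (distortion z' * (bil X.1 (posVec z') ^ 2 - q X.1)) := by gcongr
        _ ≤ Real.pi * τ.im * ((distortion z + 1) * (bil X.1 (posVec z') ^ 2 - q X.1)) := by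
          gcongr
        _ = _ := by ring
  refine ⟨.of_norm_bounded hu fun X => hbound X z (Metric.mem_ball_self hε), ?_⟩
  refine hasFDerivAt_tsum_of_isPreconnected hu Metric.isOpen_ball
    (convex_ball z ε).isPreconnected (fun X z' hz' => ?_) hbound (Metric.mem_ball_self hε)
    (summable_siegelTerm τ γ hz) (Metric.mem_ball_self hε)
  exact hasFDerivAt_siegelTerm τ (traceless_of_mem_dual X.1.2) (by linarith [(hball z' hz').1])

lemma differentiableAt_siegelTheta (τ : ℍ) (γ : Disc latticeL) {z : ℂ} (hz : 0 < z.im) :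
    DifferentiableAt ℝ (fun z : ℂ => siegelTheta τ z γ) z :=
  ((hasFDerivAt_tsum_siegelTerm τ γ hz).2.const_mul (τ.im : ℂ)).differentiableAt

/-- In weight `0` the raising operator is `i (∂_x - i ∂_y)`, applied to each summand. -/
lemma raising_siegelTheta (τ : ℍ) (γ : Disc latticeL) {z : ℂ} (hz : 0 < z.im) :
    HasSum (fun X : {X : dual latticeL // toDisc latticeL X = γ} =>
      Complex.I * τ.im * (siegelTerm τ z X.1 *
        ((-(4 * Real.pi * τ.im) * bil X.1 (posVec z) : ℝ) : ℂ) *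
        (posDerivX X.1 z - Complex.I * posDerivY X.1 z)))
      (raising 0 (fun z : ℂ => siegelTheta τ z γ) z) := by
  obtain ⟨hs, hd⟩ := hasFDerivAt_tsum_siegelTerm τ γ hz
  have hfd : fderiv ℝ (fun z : ℂ => siegelTheta τ z γ) z = (τ.im : ℂ) •
      ∑' X : {X : dual latticeL // toDisc latticeL X = γ}, siegelTermDeriv τ X.1 z :=
    (hd.const_mul (τ.im : ℂ)).fderiv
  have h1 := fun v : ℂ => (ContinuousLinearMap.apply ℝ ℂ v).hasSum hs.hasSum
  have h2 := ((h1 1).sub ((h1 Complex.I).mul_left Complex.I)).mul_left (Complex.I * τ.im)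
  have e : raising 0 (fun z : ℂ => siegelTheta τ z γ) z =
      Complex.I * τ.im * ((∑' X : {X : dual latticeL // toDisc latticeL X = γ},
        siegelTermDeriv τ X.1 z) 1 - Complex.I * (∑' X : {X : dual latticeL //
          toDisc latticeL X = γ}, siegelTermDeriv τ X.1 z) Complex.I) := by
    simp only [raising, dWirtinger, hfd, _root_.smul_apply, smul_eq_mul]
    push_cast
    ring
  rw [e]
  refine HasSum.congr_fun h2 fun X => ?_
  simp [siegelTermDeriv]
  ring

open MeasureTheory Filter Topology

/-! ### Unfolding -/

lemma setIntegral_Ioc_comp_sub {E : Type*} [NormedAddCommGroup E] [NormedSpace ℝ E] {T : ℝ}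
    (hT : 0 < T) (f : ℝ → E) (d : ℝ) :
    ∫ s in Set.Ioc 0 T, f (s - d) = ∫ s in Set.Ioc (-d) (T - d), f s := by
  rw [← intervalIntegral.integral_of_le hT.le, intervalIntegral.integral_comp_sub_right,
    zero_sub, intervalIntegral.integral_of_le (by linarith)]

/-- Unfolding the integral over a period of a sum on which `ℤ` acts freely. -/
lemma hasSum_integral_unfold {ι : Type*} (r : Setoid ι) (σ : Equiv.Perm ι)
    (hr : ∀ y y', r y y' ↔ ∃ j : ℤ, (σ ^ j) y = y')
    (hfree : ∀ (y) (j : ℤ), (σ ^ j) y = y → j = 0) {T : ℝ} (hT : 0 < T) {k : ι → ℝ → ℂ}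
    (hk : ∀ y (j : ℤ) s, k ((σ ^ j) y) s = k y (s - j * T)) (hcont : ∀ y, Continuous (k y))
    (hsum : Summable fun y => ∫ s in Set.Ioc 0 T, ‖k y s‖) :
    (∀ y, Integrable (k y)) ∧
      HasSum (fun c : Quotient r => ∫ s, k (Quotient.out c) s)
        (∑' y, ∫ s in Set.Ioc 0 T, k y s) := by
  have hset : ∀ j : ℤ, Set.Ioc (-((-j : ℤ) * T)) (T - (-j : ℤ) * T) =
      Set.Ioc (j • T) ((j + 1) • T) := fun j => by
    rw [zsmul_eq_mul, zsmul_eq_mul]; push_cast; congr 1 <;> ring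
  have hunion := iUnion_Ioc_zsmul hT
  have hdisj := Set.pairwise_disjoint_Ioc_zsmul T
  have hpow : ∀ y, Function.Injective fun j : ℤ => (σ ^ j) y := by
    intro y i j hij
    have : (σ ^ (i - j)) y = y := by
      have h1 : (σ ^ i) y = (σ ^ j) y := hij
      rw [sub_eq_neg_add, zpow_add, Equiv.Perm.mul_apply, h1, ← Equiv.Perm.mul_apply,
        ← zpow_add, neg_add_cancel, zpow_zero, Equiv.Perm.one_apply]
    have := hfree _ _ this
    omega
  -- The integral of `‖k y‖` over a translated period is that of `‖k (σ^j y)‖` over `(0, T]` for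
  -- some `j`. These belong to a summable family, because `j ↦ σ^j y` is injective.
  have hint : ∀ y, Integrable (k y) := by
    intro y
    have h1 := (hsum.comp_injective (hpow y)).comp_injective neg_injective
    have h2 : IntegrableOn (k y) (⋃ j : ℤ, Set.Ioc (j • T) ((j + 1) • T)) := by
      refine integrableOn_iUnion_of_summable_integral_norm (fun j => ?_) ?_
      · exact ((hcont y).integrableOn_Icc).mono_set Set.Ioc_subset_Icc_self
      · refine h1.congr fun j => ?_
        simp only [Function.comp_apply, hk]
        rw [setIntegral_Ioc_comp_sub hT (fun s => ‖k y s‖), hset]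
    rwa [hunion, integrableOn_univ] at h2
  refine ⟨hint, ?_⟩
  -- By freeness, every index is uniquely a power of `σ` applied to the chosen representative of its
  -- orbit.
  let E : Quotient r × ℤ → ι := fun x => (σ ^ x.2) (Quotient.out x.1)
  have hE : Function.Bijective E := by
    constructor
    · rintro ⟨c, i⟩ ⟨d, j⟩ h
      have h1 : (σ ^ i) (Quotient.out c) = (σ ^ j) (Quotient.out d) := h
      have hcd : c = d := by
        rw [← Quotient.out_eq c, ← Quotient.out_eq d]
        refine Quotient.sound ((hr _ _).2 ⟨-j + i, ?_⟩)
        rw [zpow_add, Equiv.Perm.mul_apply, h1, ← Equiv.Perm.mul_apply,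
          ← zpow_add, neg_add_cancel, zpow_zero, Equiv.Perm.one_apply]
      subst hcd
      rw [hpow _ h1]
    · intro y
      obtain ⟨j, hj⟩ := (hr _ _).1 (Quotient.mk_out (s := r) y)
      exact ⟨(⟦y⟧, j), hj⟩
  have hsum' : Summable fun y => ∫ s in Set.Ioc 0 T, k y s :=
    .of_norm_bounded hsum fun y => norm_integral_le_integral_norm _
  have h3 := (Equiv.ofBijective E hE).hasSum_iff.2 hsum'.hasSum
  refine h3.prod_fiberwise fun c => ?_
  have h4 : HasSum (fun j : ℤ => ∫ s in Set.Ioc (j • T) ((j + 1) • T), k (Quotient.out c) s)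
      (∫ s, k (Quotient.out c) s) := by
    have := hasSum_integral_iUnion (f := k (Quotient.out c)) (μ := volume)
      (fun j : ℤ => measurableSet_Ioc) hdisj (hint _).integrableOn
    rwa [hunion, setIntegral_univ] at this
  -- The power `σ^j` moves `(0, T]` to the period starting at `-jT`, hence the change of sign of
  -- `j`.
  refine ((Equiv.neg ℤ).hasSum_iff.2 h4).congr_fun fun j => ?_
  simp only [Function.comp_apply, Equiv.ofBijective_apply, E, hk]
  rw [setIntegral_Ioc_comp_sub hT (fun s => k (Quotient.out c) s), ← hset, Equiv.neg_apply, neg_neg]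

/-! ### Integrals over the whole geodesic -/

/-- `m e^s + n e^{-s}` -/
noncomputable def expSum (m n s : ℝ) : ℝ := m * Real.exp s + n * Real.exp (-s)

lemma hasDerivAt_expSum (m n s : ℝ) : HasDerivAt (expSum m n) (expSum m (-n) s) s := by
  have h1 := (Real.hasDerivAt_exp s).const_mul m
  have h2 := ((hasDerivAt_neg s).exp).const_mul n
  exact (h1.add h2).congr_deriv (by simp [expSum])

lemma continuous_expSum (m n : ℝ) : Continuous (expSum m n) := by
  unfold expSum; fun_prop

lemma expSum_neg (m n s : ℝ) : expSum m n (-s) = expSum n m s := by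
  rw [expSum, expSum, neg_neg, add_comm]

lemma expSum_sq (m n s : ℝ) : expSum m n s ^ 2 = expSum m (-n) s ^ 2 + 4 * (m * n) := by
  have h : Real.exp s * Real.exp (-s) = 1 := by rw [← Real.exp_add, add_neg_cancel, Real.exp_zero]
  unfold expSum
  linear_combination (4 * m * n) * h

lemma tendsto_expSum_atTop {m : ℝ} (hm : 0 < m) (n : ℝ) :
    Tendsto (expSum m n) atTop atTop := by
  have h1 : Tendsto (fun s => m * Real.exp s) atTop atTop :=
    Real.tendsto_exp_atTop.const_mul_atTop hm
  have h2 : Tendsto (fun s => n * Real.exp (-s)) atTop (𝓝 (n * 0)) :=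
    Real.tendsto_exp_neg_atTop_nhds_zero.const_mul n
  exact h1.atTop_add h2

lemma tendsto_expSum_atBot {m : ℝ} (hm : m < 0) (n : ℝ) :
    Tendsto (expSum m n) atTop atBot := by
  have h := tendsto_neg_atTop_atBot.comp (tendsto_expSum_atTop (neg_pos.2 hm) (-n))
  refine h.congr fun s => ?_
  simp [expSum]; ring

lemma tendsto_expSum_sq {m : ℝ} (hm : m ≠ 0) (n : ℝ) :
    Tendsto (fun s => expSum m n s ^ 2) atTop atTop := by
  rcases lt_or_gt_of_ne hm with h | h
  · refine ((tendsto_pow_atTop two_ne_zero).comp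
      (tendsto_neg_atBot_atTop.comp (tendsto_expSum_atBot h n))).congr fun s => ?_
    simp
  · exact (tendsto_pow_atTop two_ne_zero).comp (tendsto_expSum_atTop h n)

/-- The odd antiderivative of a Gaussian. -/
noncomputable def gaussPrim (β x : ℝ) : ℝ := ∫ t in (0 : ℝ)..x, Real.exp (-β * t ^ 2)

lemma hasDerivAt_gaussPrim (β x : ℝ) :
    HasDerivAt (gaussPrim β) (Real.exp (-β * x ^ 2)) x := by
  have hc : Continuous fun t : ℝ => Real.exp (-β * t ^ 2) := by fun_prop
  exact intervalIntegral.integral_hasDerivAt_right (hc.intervalIntegrable _ _)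
    (hc.stronglyMeasurableAtFilter _ _) hc.continuousAt

lemma gaussPrim_neg (β x : ℝ) : gaussPrim β (-x) = -gaussPrim β x := by
  have := intervalIntegral.integral_comp_neg (a := x) (b := 0)
    (fun t : ℝ => Real.exp (-β * t ^ 2))
  simp only [neg_zero, neg_sq] at this
  rw [gaussPrim, gaussPrim, ← this, intervalIntegral.integral_symm]

lemma tendsto_gaussPrim_atTop {β : ℝ} (hβ : 0 < β) :
    Tendsto (gaussPrim β) atTop (𝓝 (√(Real.pi / β) / 2)) := by
  rw [← integral_gaussian_Ioi]
  exact intervalIntegral_tendsto_integral_Ioi 0 (integrable_exp_neg_mul_sq hβ).integrableOn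
    tendsto_id

lemma tendsto_gaussPrim_atBot {β : ℝ} (hβ : 0 < β) :
    Tendsto (gaussPrim β) atBot (𝓝 (-(√(Real.pi / β) / 2))) := by
  have h := ((tendsto_gaussPrim_atTop hβ).comp tendsto_neg_atBot_atTop).neg
  refine h.congr fun x => ?_
  simp [gaussPrim_neg]

lemma tendsto_gaussPrim_expSum {β κ : ℝ} (hβ : 0 < β) (hκ : 0 < κ) {m : ℝ} (hm : m ≠ 0) (n : ℝ) :
    Tendsto (fun s => gaussPrim β (κ * expSum m n s)) atTop
      (𝓝 (m.sign * (√(Real.pi / β) / 2))) := by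
  rcases lt_or_gt_of_ne hm with h | h
  · rw [Real.sign_of_neg h, neg_one_mul]
    exact (tendsto_gaussPrim_atBot hβ).comp ((tendsto_expSum_atBot h n).const_mul_atBot hκ)
  · rw [Real.sign_of_pos h, one_mul]
    exact (tendsto_gaussPrim_atTop hβ).comp ((tendsto_expSum_atTop h n).const_mul_atTop hκ)

/-- Put `p = κ (m e^s + n e^{-s})`. Then `p'' = p` and `p² = p'² + 4κ²mn`, so `p exp(-βp²) ds` is
`exp(-4βκ²mn)` times the Gaussian differential in `p'`. The term `p p' exp(-βp²)` is the derivative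
of `-exp(-βp²)/(2β)`, which vanishes at both ends. Only the signs of the limits of `p'` at the two
ends remain. -/
lemma integral_kernel {β κ : ℝ} (hβ : 0 < β) (hκ : 0 < κ) {m n : ℝ} (hm : m ≠ 0) (hn : n ≠ 0)
    (x y : ℂ)
    (hint : Integrable fun s => (x * (κ * expSum m n s : ℝ) +
      y * (κ * expSum m n s : ℝ) * (κ * expSum m (-n) s : ℝ)) *
        (Real.exp (-β * (κ * expSum m n s) ^ 2) : ℝ)) :
    ∫ s, (x * (κ * expSum m n s : ℝ) +
      y * (κ * expSum m n s : ℝ) * (κ * expSum m (-n) s : ℝ)) *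
        (Real.exp (-β * (κ * expSum m n s) ^ 2) : ℝ) =
      x * (Real.exp (-β * (4 * κ ^ 2 * (m * n))) * √(Real.pi / β) *
        ((m.sign + n.sign) / 2) : ℝ) := by
  let c₀ : ℝ := Real.exp (-β * (4 * κ ^ 2 * (m * n)))
  let Φ : ℝ → ℂ := fun s => x * (c₀ * gaussPrim β (κ * expSum m (-n) s) : ℝ) +
    y * (-(1 / (2 * β)) * Real.exp (-β * (κ * expSum m n s) ^ 2) : ℝ)
  have hderiv : ∀ s, HasDerivAt Φ ((x * (κ * expSum m n s : ℝ) +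
      y * (κ * expSum m n s : ℝ) * (κ * expSum m (-n) s : ℝ)) *
        (Real.exp (-β * (κ * expSum m n s) ^ 2) : ℝ)) s := by
    intro s
    have h1 := (((hasDerivAt_gaussPrim β (κ * expSum m (-n) s)).comp s
      ((hasDerivAt_expSum m (-n) s).const_mul κ)).const_mul c₀).ofReal_comp.const_mul x
    have h2 := ((((((hasDerivAt_expSum m n s).const_mul κ).pow 2).const_mul (-β)).exp).const_mul
      (-(1 / (2 * β)))).ofReal_comp.const_mul y
    have h3 : c₀ * (Real.exp (-β * (κ * expSum m (-n) s) ^ 2) * (κ * expSum m (- -n) s)) =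
        κ * expSum m n s * Real.exp (-β * (κ * expSum m n s) ^ 2) := by
      rw [neg_neg, ← mul_assoc, ← Real.exp_add, mul_comm]
      congr 2
      rw [mul_pow κ (expSum m n s), expSum_sq]
      ring
    refine (h1.add h2).congr_deriv ?_
    rw [h3]
    simp only [Pi.pow_apply]
    have hβ' : (β : ℂ) ≠ 0 := by exact_mod_cast hβ.ne'
    push_cast
    field_simp
  have hlim1 : ∀ (m n : ℝ), m ≠ 0 →
      Tendsto (fun s => (-(1 / (2 * β)) * Real.exp (-β * (κ * expSum m n s) ^ 2) : ℝ)) atTop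
        (𝓝 (-(1 / (2 * β)) * 0)) := by
    intro m n hm
    refine Tendsto.const_mul _ (Real.tendsto_exp_atBot.comp ?_)
    have := (tendsto_expSum_sq hm n).const_mul_atTop_of_neg
      (show -β * κ ^ 2 < 0 by have := pow_pos hκ 2; nlinarith)
    exact this.congr fun s => by ring
  have htop : Tendsto Φ atTop (𝓝 (x * (c₀ * (m.sign * (√(Real.pi / β) / 2)) : ℝ) +
      y * (-(1 / (2 * β)) * 0 : ℝ))) :=
    ((Complex.continuous_ofReal.tendsto _).comp
      ((tendsto_gaussPrim_expSum hβ hκ hm (-n)).const_mul c₀)).const_mul x |>.add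
    (((Complex.continuous_ofReal.tendsto _).comp (hlim1 m n hm)).const_mul y)
  -- The reflection `s ↦ -s` interchanges the two coefficients and reduces `-∞` to `+∞`.
  have hbot : Tendsto Φ atBot (𝓝 (x * (c₀ * ((-n).sign * (√(Real.pi / β) / 2)) : ℝ) +
      y * (-(1 / (2 * β)) * 0 : ℝ))) := by
    have h := ((Complex.continuous_ofReal.tendsto _).comp
      ((tendsto_gaussPrim_expSum hβ hκ (neg_ne_zero.2 hn) m).const_mul c₀)).const_mul x |>.add
      (((Complex.continuous_ofReal.tendsto _).comp (hlim1 n m hn)).const_mul y)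
    refine (h.comp tendsto_neg_atBot_atTop).congr fun s => ?_
    simp only [Function.comp_apply, Φ]
    rw [← expSum_neg m (-n), ← expSum_neg m n, neg_neg]
  rw [integral_of_hasDerivAt_of_tendsto hderiv hint hbot htop, Real.sign_neg,
    show Real.exp (-β * (4 * κ ^ 2 * (m * n))) = c₀ from rfl]
  push_cast
  ring

/-! ### The kernel of Hecke's theta series -/

/-- The inner product of `Y ∈ I` with `X(z)` at the point of parameter `s` of the geodesic. -/
noncomputable def arcProd (a b c : ℝ) (Y : V) (s : ℝ) : ℝ :=
  1 / (2 * √2 * radius a b c) * expSum (bil Y (vecY0 a b c)) (bil Y (vecY1 a b c)) s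

/-- The derivative of `arcProd`. -/
noncomputable def arcProd' (a b c : ℝ) (Y : V) (s : ℝ) : ℝ :=
  1 / (2 * √2 * radius a b c) * expSum (bil Y (vecY0 a b c)) (-bil Y (vecY1 a b c)) s

/-- The contribution of `Y ∈ I'` to the integrand of the cycle integral. -/
noncomputable def kernel (a b c : ℝ) (τ : ℍ) (x y : ℂ) (Y : V) (s : ℝ) : ℂ :=
  e ((q Y : ℂ) * (starRingEnd ℂ) (τ : ℂ)) *
    ((x * (arcProd a b c Y s : ℝ) + y * (arcProd a b c Y s : ℝ) * (arcProd' a b c Y s : ℝ)) *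
      (Real.exp (-(2 * Real.pi * τ.im) * arcProd a b c Y s ^ 2) : ℝ))

section Real

variable {a b c : ℝ} (τ : ℍ) (x y : ℂ)

lemma arcProd_eq (ha : 0 < a) (hD : 0 < b ^ 2 - 4 * a * c) (Y : V) (s : ℝ) :
    arcProd a b c Y s = bil Y (posVec (geodesicPath a b c s)) :=
  (bil_posVec_geodesicPath ha hD Y s).symm

lemma expSum_exp_mul (m n s t : ℝ) :
    expSum (Real.exp (-t) * m) (Real.exp t * n) s = expSum m n (s - t) := by
  rw [expSum, expSum, show s - t = s + -t by ring, show -(s + -t) = -s + t by ring,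
    Real.exp_add, Real.exp_add]
  ring

/-- The element `g` multiplies `(Y, Y₀)` and `(Y, Y₁)` by `e^{-t}` and `e^t`, which is the
translation of `s` by `t`. This equivariance makes the unfolding possible. -/
lemma kernel_conj (ha : 0 < a) (hD : 0 < b ^ 2 - 4 * a * c) {g : SL(2, ℤ)}
    (hg : g ∈ stab (formMatrix a b c)) (Y : V) (s : ℝ) :
    kernel a b c τ x y (conj g Y) s = kernel a b c τ x y Y (s - shift a b c g) := by
  have h1 : arcProd a b c (conj g Y) s = arcProd a b c Y (s - shift a b c g) := by
    rw [arcProd, bil_conj_vecY0 ha hD hg, bil_conj_vecY1 ha hD hg, expSum_exp_mul]; rfl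
  have h2 : arcProd' a b c (conj g Y) s = arcProd' a b c Y (s - shift a b c g) := by
    rw [arcProd', bil_conj_vecY0 ha hD hg, bil_conj_vecY1 ha hD hg, ← mul_neg, expSum_exp_mul]
    rfl
  rw [kernel, h1, h2, q_conj]; rfl

lemma continuous_kernel (Y : V) : Continuous (kernel a b c τ x y Y) := by
  have h1 : Continuous (arcProd a b c Y) := (continuous_expSum _ _).const_mul _
  have h2 : Continuous (arcProd' a b c Y) := (continuous_expSum _ _).const_mul _
  unfold kernel
  fun_prop

lemma arcProd_sq (ha : 0 < a) (hD : 0 < b ^ 2 - 4 * a * c) {Y : V} (hY : Y 1 1 = -Y 0 0)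
    (hA : bil Y (formMatrix a b c) = 0) (s : ℝ) :
    arcProd a b c Y s ^ 2 = arcProd' a b c Y s ^ 2 + 2 * q Y := by
  have h2 : √2 ^ 2 = 2 := Real.sq_sqrt two_pos.le
  have hr := radius_pos ha hD
  rw [arcProd, arcProd', mul_pow, mul_pow, expSum_sq, q_eq_combination ha hD hY, hA, div_pow,
    mul_pow, mul_pow, h2]
  field_simp
  ring

lemma norm_kernel_le (ha : 0 < a) (hD : 0 < b ^ 2 - 4 * a * c) {Y : V} (hY : Y 1 1 = -Y 0 0)
    (hA : bil Y (formMatrix a b c) = 0) (s : ℝ) :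
    ‖kernel a b c τ x y Y s‖ ≤ (‖x‖ + ‖y‖) * (1 + 2 / (Real.pi * τ.im)) *
      Real.exp (-(Real.pi * τ.im / distortion (geodesicPath a b c s)) * sqNorm Y) := by
  have hv := τ.im_pos
  have hpi := Real.pi_pos
  have hz := geodesicPath_im_pos ha hD s
  obtain ⟨h0, h1, -⟩ := majorant_bounds hY hz
  have h2 := sqNorm_le hY hz
  have h3 := arcProd_sq ha hD hY hA s
  have hd := distortion_pos (z := geodesicPath a b c s)
  rw [← arcProd_eq ha hD] at h0 h1 h2
  have hexp : ‖kernel a b c τ x y Y s‖ =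
      ‖x * (arcProd a b c Y s : ℝ) + y * (arcProd a b c Y s : ℝ) * (arcProd' a b c Y s : ℝ)‖ *
        Real.exp (-(2 * Real.pi * τ.im * (arcProd a b c Y s ^ 2 - q Y))) := by
    rw [kernel, norm_mul, norm_mul, norm_e, Complex.norm_real,
      Real.norm_of_nonneg (Real.exp_pos _).le, mul_comm, mul_assoc, ← Real.exp_add]
    congr 2
    simp
    ring
  generalize hp : arcProd a b c Y s = p at *
  generalize arcProd' a b c Y s = p' at *
  generalize hS : p ^ 2 - q Y = S at *
  -- Here `p'² = p² - 2q(Y) = 2S - p²`. So `p` and `p p'` are at most `1 + 2S` in absolute value,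
  -- which half of the Gaussian decay absorbs.
  have hp' : p' ^ 2 ≤ 2 * S := by nlinarith [sq_nonneg p]
  have hlin : ‖x * (p : ℝ) + y * (p : ℝ) * (p' : ℝ)‖ ≤ (‖x‖ + ‖y‖) * (1 + 2 * S) := by
    have k1 : |p| ≤ 1 + 2 * S := by
      rw [← sq_abs] at h1; nlinarith [sq_nonneg (|p| - 1)]
    have k2 : |p| * |p'| ≤ 1 + 2 * S := by
      rw [← sq_abs] at h1 hp'; nlinarith [sq_nonneg (|p| - |p'|)]
    refine (norm_add_le _ _).trans ?_
    rw [norm_mul, norm_mul, norm_mul, Complex.norm_real, Complex.norm_real, Real.norm_eq_abs,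
      Real.norm_eq_abs, mul_assoc, add_mul]
    gcongr
  have hE : (1 + 2 * S) * Real.exp (-(2 * Real.pi * τ.im * S)) ≤
      (1 + 2 / (Real.pi * τ.im)) * Real.exp (-(Real.pi * τ.im * S)) := by
    have k1 : Real.pi * τ.im * S + 1 ≤ Real.exp (Real.pi * τ.im * S) := Real.add_one_le_exp _
    have k2 : 1 + 2 * S ≤ (1 + 2 / (Real.pi * τ.im)) * Real.exp (Real.pi * τ.im * S) := by
      have e1 : 2 * S = 2 / (Real.pi * τ.im) * (Real.pi * τ.im * S) := by field_simp
      rw [e1, add_mul, one_mul]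
      have : 0 ≤ Real.pi * τ.im * S := by positivity
      gcongr <;> linarith
    have k3 : Real.exp (Real.pi * τ.im * S) * Real.exp (-(2 * Real.pi * τ.im * S)) =
        Real.exp (-(Real.pi * τ.im * S)) := by rw [← Real.exp_add]; congr 1; ring
    rw [← k3, ← mul_assoc]
    gcongr
  have hF : Real.exp (-(Real.pi * τ.im * S)) ≤
      Real.exp (-(Real.pi * τ.im / distortion (geodesicPath a b c s)) * sqNorm Y) := by
    rw [Real.exp_le_exp, neg_mul, neg_le_neg_iff, div_mul_eq_mul_div, div_le_iff₀ hd]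
    calc _ ≤ Real.pi * τ.im * (distortion (geodesicPath a b c s) * S) := by gcongr
      _ = _ := by ring
  rw [hexp]
  calc _ ≤ (‖x‖ + ‖y‖) * (1 + 2 * S) * Real.exp (-(2 * Real.pi * τ.im * S)) := by gcongr
    _ = (‖x‖ + ‖y‖) * ((1 + 2 * S) * Real.exp (-(2 * Real.pi * τ.im * S))) := by ring
    _ ≤ (‖x‖ + ‖y‖) * ((1 + 2 / (Real.pi * τ.im)) *
        Real.exp (-(Real.pi * τ.im / distortion (geodesicPath a b c s)) * sqNorm Y)) := by
      refine mul_le_mul_of_nonneg_left (hE.trans ?_) (by positivity)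
      gcongr
    _ = _ := by ring

lemma exists_distortion_bound (ha : 0 < a) (hD : 0 < b ^ 2 - 4 * a * c) (T : ℝ) :
    ∃ M : ℝ, 0 < M ∧ ∀ s ∈ Set.Icc 0 T, distortion (geodesicPath a b c s) ≤ M := by
  have hc : ContinuousOn (fun s => distortion (geodesicPath a b c s)) (Set.Icc 0 T) :=
    fun s _ => ((continuousAt_distortion (geodesicPath_im_pos ha hD s)).comp
      continuous_geodesicPath.continuousAt).continuousWithinAt
  obtain ⟨M, hM⟩ := isCompact_Icc.exists_bound_of_continuousOn hc
  refine ⟨max M 1, by positivity, fun s hs => ?_⟩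
  exact ((le_abs_self _).trans (hM s hs)).trans (le_max_left _ _)

lemma bil_ne_zero_of_q_ne_zero (ha : 0 < a) (hD : 0 < b ^ 2 - 4 * a * c) {Y : V}
    (hY : Y 1 1 = -Y 0 0) (hA : bil Y (formMatrix a b c) = 0) (hq : q Y ≠ 0) :
    bil Y (vecY0 a b c) ≠ 0 ∧ bil Y (vecY1 a b c) ≠ 0 := by
  rw [q_eq_combination ha hD hY, hA] at hq
  constructor <;> intro h <;> simp [h] at hq

/-- For `(Y, A) = 0` one has `4κ²mn = 2q(Y)`, so `integral_kernel` with `β = 2πv` yields the factor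
`exp(-4πv q(Y))`, which turns `e(q(Y) τ̄)` into the holomorphic `e(q(Y) τ)`. -/
lemma integral_kernel_eq (ha : 0 < a) (hD : 0 < b ^ 2 - 4 * a * c) {Y : V}
    (hY : Y 1 1 = -Y 0 0) (hA : bil Y (formMatrix a b c) = 0) (hq : q Y ≠ 0)
    (hint : Integrable (kernel a b c τ x y Y)) :
    ∫ s, kernel a b c τ x y Y s = x * (√(Real.pi / (2 * Real.pi * τ.im)) : ℝ) *
      (e ((q Y : ℂ) * τ) *
        (((bil Y (vecY0 a b c)).sign + (bil Y (vecY1 a b c)).sign) / 2 : ℝ)) := by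
  have hr := radius_pos ha hD
  have hv := τ.im_pos
  have hpi := Real.pi_pos
  have h2 : √2 ^ 2 = 2 := Real.sq_sqrt two_pos.le
  obtain ⟨hm, hn⟩ := bil_ne_zero_of_q_ne_zero ha hD hY hA hq
  have he : e ((q Y : ℂ) * (starRingEnd ℂ) (τ : ℂ)) ≠ 0 := Complex.exp_ne_zero _
  have hint' := hint.const_mul (e ((q Y : ℂ) * (starRingEnd ℂ) (τ : ℂ)))⁻¹
  simp only [kernel, inv_mul_cancel_left₀ he] at hint'
  have h := integral_kernel (β := 2 * Real.pi * τ.im) (κ := 1 / (2 * √2 * radius a b c))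
    (by positivity) (by positivity) hm hn x y hint'
  have hq2 : 4 * (1 / (2 * √2 * radius a b c)) ^ 2 *
      (bil Y (vecY0 a b c) * bil Y (vecY1 a b c)) = 2 * q Y := by
    rw [q_eq_combination ha hD hY, hA, div_pow, mul_pow, mul_pow, h2]
    field_simp
    ring
  have hexp : e ((q Y : ℂ) * (starRingEnd ℂ) (τ : ℂ)) *
      (Real.exp (-(2 * Real.pi * τ.im) * (2 * q Y)) : ℝ) = e ((q Y : ℂ) * τ) := by
    rw [show -(2 * Real.pi * τ.im) * (2 * q Y) = -(2 * Real.pi * (2 * τ.im * q Y)) by ring,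
      ← e_mul_I, ← e_add]
    congr 1
    have h2 : (τ : ℂ) = τ.re + τ.im * Complex.I := (Complex.re_add_im _).symm
    have h3 : (starRingEnd ℂ) (τ : ℂ) = τ.re - τ.im * Complex.I := by
      rw [h2]; simp [sub_eq_add_neg]
    rw [h3, h2]
    push_cast
    ring
  simp only [kernel]
  rw [integral_const_mul]
  simp only [arcProd, arcProd']
  rw [h, hq2, ← hexp]
  push_cast
  ring

end Real

/-! ### Anisotropy of `I` and the action of `Γ_A` on its classes -/

section Integral

variable {a b c : ℤ}

/-- After scaling to integer entries, isotropy and orthogonality to `A` read `γα = β²` and `aγ - bβ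
+ cα = 0`, whence `(2aβ - bα)² = D α²`. As `D` is not a square, `α = 0`, and then `β = γ = 0`. -/
lemma eq_zero_of_q_eq_zero (ha : 0 < (a : ℝ)) (hD : 0 < b ^ 2 - 4 * a * c)
    (hsq : ¬IsSquare (b ^ 2 - 4 * a * c)) {Y : V}
    (hY : Y ∈ dual (latticeI (formMatrix a b c))) (hq : q Y = 0) : Y = 0 := by
  obtain ⟨α, β, γ, h⟩ := smul_mem_of_mem_dual_latticeI hD hY
  have hK := four_mul_disc_ne hD
  generalize (4 * ((b ^ 2 - 4 * a * c : ℤ) : ℝ)) = K at *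
  have hA := perp_of_mem_dual_latticeI hY
  have hq' : q (K • Y) = 0 := by rw [q_smul, hq, mul_zero]
  have hA' : bil (K • Y) (formMatrix a b c) = 0 := by rw [bil_smul_left, hA, mul_zero]
  rw [h, bil_formMatrix] at hA'
  rw [h, q_eq] at hq'
  simp at hA' hq'
  have ha0 : a ≠ 0 := by rintro rfl; simp at ha
  have e1 : -(β * b) + a * γ + c * α = 0 := by
    have : ((-(β * b) + a * γ + c * α : ℤ) : ℝ) = 0 := by push_cast; linarith
    exact_mod_cast this
  have e2 : γ * α = β ^ 2 := by
    have : ((γ * α : ℤ) : ℝ) = (β ^ 2 : ℤ) := by push_cast; linarith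
    exact_mod_cast this
  have e3 : (2 * a * β - b * α) ^ 2 = (b ^ 2 - 4 * a * c) * α ^ 2 := by
    linear_combination (4 * a * α) * e1 - 4 * a ^ 2 * e2
  have hα : α = 0 := by
    by_contra hα
    apply hsq
    have hdvd : α ^ 2 ∣ (2 * a * β - b * α) ^ 2 := ⟨_, by rw [e3, mul_comm]⟩
    obtain ⟨d, hd⟩ := (Int.pow_dvd_pow_iff two_ne_zero).1 hdvd
    refine ⟨d, ?_⟩
    rw [hd, mul_pow, mul_comm] at e3
    have := mul_right_cancel₀ (pow_ne_zero 2 hα) e3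
    rw [← this, sq]
  have hβ : β = 0 := by rw [hα, mul_zero] at e2; exact pow_eq_zero_iff two_ne_zero |>.1 e2.symm
  have hγ : γ = 0 := by
    rw [hα, hβ] at e1
    simpa [ha0] using e1
  rw [hα, hβ, hγ] at h
  have h0 : K • Y = K • (0 : V) := by
    rw [h, smul_zero]; ext i j; fin_cases i <;> fin_cases j <;> simp
  exact smul_right_injective V hK h0

lemma summable_sqNorm_dual_latticeI (hD : 0 < b ^ 2 - 4 * a * c)
    {P : dual (latticeI (formMatrix a b c)) → Prop} {C : ℝ} (hC : 0 < C) :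
    Summable fun Y : {Y : dual (latticeI (formMatrix a b c)) // P Y} =>
      Real.exp (-C * sqNorm (Y.1 : V)) :=
  summable_exp_neg_sqNorm (f := fun Y : {Y : dual (latticeI (formMatrix a b c)) // P Y} =>
    (Y.1 : V)) (Subtype.val_injective.comp Subtype.val_injective) (four_mul_disc_ne hD)
    (fun Y => smul_mem_of_mem_dual_latticeI hD Y.1.2) hC

/-- The action of `Γ_A` on the vectors of a class in `I'/I` that satisfy an invariant
condition. -/
noncomputable def permHom (a b c : ℤ) (δ : Disc (latticeI (formMatrix a b c))) (P : V → Prop)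
    (hP : ∀ (g : SL(2, ℤ)) (Y : V), P (conj g Y) ↔ P Y) :
    stab (formMatrix a b c) →* Equiv.Perm {Y : dual (latticeI (formMatrix a b c)) //
      toDisc (latticeI (formMatrix a b c)) Y = δ ∧ P Y} where
  toFun g :=
    { toFun := fun Y => ⟨⟨conj g Y.1, conj_mem_dual_latticeI g.2 Y.1.2⟩, by
        refine Eq.trans ?_ Y.2.1
        refine QuotientAddGroup.eq.2 ?_
        rw [AddSubgroup.mem_addSubgroupOf, ← neg_mem_iff]
        convert conj_sub_self_mem_latticeI g.2 Y.1.2 using 1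
        push_cast
        abel, (hP _ _).2 Y.2.2⟩
      invFun := fun Y => ⟨⟨conj (g⁻¹ : stab (formMatrix a b c)) Y.1,
        conj_mem_dual_latticeI (g⁻¹).2 Y.1.2⟩, by
        refine Eq.trans ?_ Y.2.1
        refine QuotientAddGroup.eq.2 ?_
        rw [AddSubgroup.mem_addSubgroupOf, ← neg_mem_iff]
        convert conj_sub_self_mem_latticeI (g⁻¹).2 Y.1.2 using 1
        push_cast
        abel, (hP _ _).2 Y.2.2⟩
      left_inv := fun Y => Subtype.ext (Subtype.ext (conj_inv_eq rfl))
      right_inv := fun Y => Subtype.ext (Subtype.ext (by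
        change conj g (conj (g : SL(2, ℤ))⁻¹ Y.1) = Y.1
        rw [← conj_mul, mul_inv_cancel, conj_one])) }
  map_one' := Equiv.ext fun Y => Subtype.ext (Subtype.ext (conj_one _))
  map_mul' g h := Equiv.ext fun Y => Subtype.ext (Subtype.ext (conj_mul _ _ _))

lemma coe_permHom (δ : Disc (latticeI (formMatrix a b c))) (P : V → Prop)
    (hP : ∀ (g : SL(2, ℤ)) (Y : V), P (conj g Y) ↔ P Y) (g : stab (formMatrix a b c))
    (Y : {Y : dual (latticeI (formMatrix a b c)) //
      toDisc (latticeI (formMatrix a b c)) Y = δ ∧ P Y}) :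
    ((permHom a b c δ P hP g Y).1 : V) = conj g Y.1 := rfl

end Integral

/-! ### Integrating the kernel over a period and unfolding -/

section Integral

variable {a b c : ℤ} (τ : ℍ) (x y : ℂ)

lemma exists_kernel_bound (ha : 0 < (a : ℝ)) (hD : 0 < b ^ 2 - 4 * a * c) (T : ℝ) :
    ∃ C M : ℝ, 0 < M ∧ ∀ Y ∈ dual (latticeI (formMatrix a b c)), ∀ s ∈ Set.Icc 0 T,
      ‖kernel a b c τ x y Y s‖ ≤ C * Real.exp (-M * sqNorm Y) := by
  have hD' := disc_pos_cast hD
  have hv := τ.im_pos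
  have hpi := Real.pi_pos
  obtain ⟨M, hM, hMs⟩ := exists_distortion_bound ha hD' T
  refine ⟨(‖x‖ + ‖y‖) * (1 + 2 / (Real.pi * τ.im)), Real.pi * τ.im / M, by positivity,
    fun Y hY s hs => ?_⟩
  refine (norm_kernel_le τ x y ha hD' (traceless_of_mem_dual_le (latticeI_le _) hY)
    (perp_of_mem_dual_latticeI hY) s).trans ?_
  have hd := distortion_pos (z := geodesicPath a b c s)
  have h0 := sqNorm_nonneg Y
  gcongr
  exact hMs s hs

lemma summable_kernel (ha : 0 < (a : ℝ)) (hD : 0 < b ^ 2 - 4 * a * c)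
    (P : dual (latticeI (formMatrix a b c)) → Prop) (s : ℝ) :
    Summable fun Y : {Y : dual (latticeI (formMatrix a b c)) // P Y} =>
      ‖kernel a b c τ x y Y.1 s‖ := by
  have hv := τ.im_pos
  have hpi := Real.pi_pos
  have hd := distortion_pos (z := geodesicPath a b c s)
  exact .of_nonneg_of_le (fun Y => norm_nonneg _)
    (fun Y => norm_kernel_le τ x y ha (disc_pos_cast hD)
      (traceless_of_mem_dual_le (latticeI_le _) Y.1.2) (perp_of_mem_dual_latticeI Y.1.2) s)
    ((summable_sqNorm_dual_latticeI hD (by positivity)).mul_left _)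

lemma summable_integral_kernel (ha : 0 < (a : ℝ)) (hD : 0 < b ^ 2 - 4 * a * c)
    (P : dual (latticeI (formMatrix a b c)) → Prop) {T : ℝ} (hT : 0 < T) :
    Summable fun Y : {Y : dual (latticeI (formMatrix a b c)) // P Y} =>
      ∫ s in Set.Ioc 0 T, ‖kernel a b c τ x y Y.1 s‖ := by
  obtain ⟨C, M, hM, h⟩ := exists_kernel_bound τ x y ha hD T
  refine .of_norm_bounded (((summable_sqNorm_dual_latticeI hD hM).mul_left C).mul_right T)
    fun Y => ?_
  have h1 := norm_setIntegral_le_of_norm_le_const (μ := volume) (s := Set.Ioc 0 T)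
    (f := fun s => ‖kernel a b c τ x y Y.1 s‖) (C := C * Real.exp (-M * sqNorm (Y.1 : V)))
    (by simp) (fun s hs => by
      rw [norm_norm]; exact h _ Y.1.2 s (Set.Ioc_subset_Icc_self hs))
  simpa [Measure.real, hT.le] using h1

lemma continuousOn_tsum_kernel (ha : 0 < (a : ℝ)) (hD : 0 < b ^ 2 - 4 * a * c)
    (P : dual (latticeI (formMatrix a b c)) → Prop) (T : ℝ) :
    ContinuousOn (fun s => ∑' Y : {Y : dual (latticeI (formMatrix a b c)) // P Y},
      kernel a b c τ x y Y.1 s) (Set.Icc 0 T) := by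
  obtain ⟨C, M, hM, h⟩ := exists_kernel_bound τ x y ha hD T
  exact continuousOn_tsum (fun Y => (continuous_kernel τ x y _).continuousOn)
    ((summable_sqNorm_dual_latticeI hD hM).mul_left C) (fun Y s hs => h _ Y.1.2 s hs)

lemma integral_tsum_kernel (ha : 0 < (a : ℝ)) (hD : 0 < b ^ 2 - 4 * a * c)
    (P : dual (latticeI (formMatrix a b c)) → Prop) {T : ℝ} (hT : 0 < T) :
    HasSum (fun Y : {Y : dual (latticeI (formMatrix a b c)) // P Y} =>
      ∫ s in Set.Ioc 0 T, kernel a b c τ x y Y.1 s)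
      (∫ s in Set.Ioc 0 T, ∑' Y : {Y : dual (latticeI (formMatrix a b c)) // P Y},
        kernel a b c τ x y Y.1 s) := by
  have hcount : Countable {Y : dual (latticeI (formMatrix a b c)) // P Y} := by
    have := (summable_sqNorm_dual_latticeI (P := P) hD one_pos).countable_support
    rw [Function.support_eq_univ (fun Y => (Real.exp_pos _).ne')] at this
    exact Set.countable_univ_iff.1 this
  exact hasSum_integral_of_summable_integral_norm
    (fun Y => ((continuous_kernel τ x y _).integrableOn_Icc).mono_set Set.Ioc_subset_Icc_self)
    (summable_integral_kernel τ x y ha hD P hT)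

variable {g₀ : SL(2, ℤ)}

/-- Unfolding of the sum over a class of `I'/I` against the action of `Γ_A`. -/
lemma hasSum_integral_kernel (ha : 0 < (a : ℝ)) (hD : 0 < b ^ 2 - 4 * a * c)
    (hg₀ : g₀ ∈ stab (formMatrix a b c)) (hpos : 0 < shift a b c g₀)
    (hgen : ∀ g ∈ stab (formMatrix a b c), ∃ k : ℤ, shift a b c g = k * shift a b c g₀)
    (δ : Disc (latticeI (formMatrix a b c))) {P : V → Prop}
    (hP : ∀ (g : SL(2, ℤ)) (Y : V), P (conj g Y) ↔ P Y) (hP0 : ∀ Y, P Y → q Y ≠ 0)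
    (r : Setoid {Y : dual (latticeI (formMatrix a b c)) //
      toDisc (latticeI (formMatrix a b c)) Y = δ ∧ P Y})
    (hr : ∀ Y Y', r Y Y' ↔ ∃ g ∈ stab (formMatrix a b c), conj g (Y.1 : V) = (Y'.1 : V)) :
    HasSum (fun C : Quotient r => x * (√(Real.pi / (2 * Real.pi * τ.im)) : ℝ) *
      (e ((q (Quotient.out C).1 : ℂ) * τ) * (((bil (Quotient.out C).1 (vecY0 a b c)).sign +
        (bil (Quotient.out C).1 (vecY1 a b c)).sign) / 2 : ℝ)))
      (∑' Y : {Y : dual (latticeI (formMatrix a b c)) //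
        toDisc (latticeI (formMatrix a b c)) Y = δ ∧ P Y},
          ∫ s in Set.Ioc 0 (shift a b c g₀), kernel a b c τ x y Y.1 s) := by
  have hD' := disc_pos_cast hD
  let σ := permHom a b c δ P hP ⟨g₀, hg₀⟩
  have hσ : ∀ (j : ℤ) Y, (((σ ^ j) Y).1 : V) = conj (g₀ ^ j) Y.1 := fun j Y => by
    rw [← map_zpow, coe_permHom]; rfl
  have hY : ∀ Y : {Y : dual (latticeI (formMatrix a b c)) //
      toDisc (latticeI (formMatrix a b c)) Y = δ ∧ P Y}, (Y.1 : V) 1 1 = -(Y.1 : V) 0 0 ∧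
      bil Y.1 (formMatrix a b c) = 0 ∧ q Y.1 ≠ 0 := fun Y =>
    ⟨traceless_of_mem_dual_le (latticeI_le _) Y.1.2, perp_of_mem_dual_latticeI Y.1.2,
      hP0 _ Y.2.2⟩
  have hr' : ∀ Y Y', r Y Y' ↔ ∃ j : ℤ, (σ ^ j) Y = Y' := by
    intro Y Y'
    rw [hr]
    constructor
    · rintro ⟨g, hg, h⟩
      obtain ⟨k, hk⟩ := hgen g hg
      refine ⟨k, Subtype.ext (Subtype.ext ?_)⟩
      rw [hσ, ← conj_eq_conj_zpow ha hD hg₀ hg hk, h]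
    · rintro ⟨j, rfl⟩
      exact ⟨g₀ ^ j, zpow_mem hg₀ j, (hσ j Y).symm⟩
  -- A vector with `q(Y) ≠ 0` has `(Y, Y₀) ≠ 0`, so only elements of shift zero fix it.
  have hfree : ∀ (Y) (j : ℤ), (σ ^ j) Y = Y → j = 0 := by
    intro Y j h
    obtain ⟨h1, h2, h3⟩ := hY Y
    have h4 := shift_eq_zero_of_conj_eq ha hD' (zpow_mem hg₀ j)
      (bil_ne_zero_of_q_ne_zero ha hD' h1 h2 h3).1 (by rw [← hσ, h])
    rw [shift_zpow ha hD' hg₀] at h4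
    exact_mod_cast (mul_eq_zero.1 h4).resolve_right hpos.ne'
  obtain ⟨hint, hsum⟩ := hasSum_integral_unfold r σ hr' hfree hpos
    (k := fun Y => kernel a b c τ x y Y.1)
    (fun Y j s => by rw [hσ, kernel_conj τ x y ha hD' (zpow_mem hg₀ j), shift_zpow ha hD' hg₀])
    (fun Y => continuous_kernel τ x y _) (summable_integral_kernel τ x y ha hD _ hpos)
  refine hsum.congr_fun fun C => ?_
  obtain ⟨h1, h2, h3⟩ := hY (Quotient.out C)
  exact (integral_kernel_eq τ x y ha hD' h1 h2 h3 (hint _)).symm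

lemma sign_eq_sign_of_mul_pos {m n : ℝ} (h : 0 < m * n) : m.sign = n.sign := by
  rcases pos_and_pos_or_neg_and_neg_of_mul_pos h with ⟨h1, h2⟩ | ⟨h1, h2⟩
  · rw [Real.sign_of_pos h1, Real.sign_of_pos h2]
  · rw [Real.sign_of_neg h1, Real.sign_of_neg h2]

lemma sign_add_sign_of_mul_neg {m n : ℝ} (h : m * n < 0) : m.sign + n.sign = 0 := by
  rcases mul_neg_iff.1 h with ⟨h1, h2⟩ | ⟨h1, h2⟩
  · rw [Real.sign_of_pos h1, Real.sign_of_neg h2, add_neg_cancel]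
  · rw [Real.sign_of_neg h1, Real.sign_of_pos h2, neg_add_cancel]

/-- If `q(Y) > 0`, then `(Y, Y₀)` and `(Y, Y₁)` have the same sign, so the mean of the two signs is
`sgn(Y, Y₀)`; the stabilizer of `Y` is trivial. -/
lemma hasSum_integral_kernel_pos (ha : 0 < (a : ℝ)) (hD : 0 < b ^ 2 - 4 * a * c)
    (hg₀ : g₀ ∈ stab (formMatrix a b c)) (hpos : 0 < shift a b c g₀)
    (hgen : ∀ g ∈ stab (formMatrix a b c), ∃ k : ℤ, shift a b c g = k * shift a b c g₀)
    (δ : Disc (latticeI (formMatrix a b c))) :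
    HasSum (fun C : Quotient (heckeSetoid (formMatrix a b c) δ) =>
      x * (√(Real.pi / (2 * Real.pi * τ.im)) : ℝ) * heckeTerm a b c τ (Quotient.out C).1)
      (∑' Y : HeckeIndex (formMatrix a b c) δ,
          ∫ s in Set.Ioc 0 (shift a b c g₀), kernel a b c τ x y Y.1 s) := by
  have hD' := disc_pos_cast hD
  have h := hasSum_integral_kernel τ x y ha hD hg₀ hpos hgen δ (P := fun Y => 0 < q Y)
    (fun g Y => by rw [q_conj]) (fun Y h => h.ne') (heckeSetoid _ δ) (fun _ _ => Iff.rfl)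
  refine h.congr_fun fun C => ?_
  have hq := (Quotient.out C).2.2
  have h1 := traceless_of_mem_dual_le (latticeI_le _) (Quotient.out C).1.2
  have h2 := perp_of_mem_dual_latticeI (Quotient.out C).1.2
  generalize ((Quotient.out C).1 : V) = Y at *
  rw [heckeTerm, stabOrder_eq_one ha hD' (bil_ne_zero_of_q_ne_zero ha hD' h1 h2 hq.ne').1]
  have hr := radius_pos ha hD'
  have hmn : 0 < bil Y (vecY0 a b c) * bil Y (vecY1 a b c) := by
    rw [q_eq_combination ha hD' h1, h2] at hq
    by_contra! hneg
    have : bil Y (vecY0 a b c) * bil Y (vecY1 a b c) / (4 * radius a b c ^ 2) ≤ 0 :=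
      div_nonpos_of_nonpos_of_nonneg hneg (by positivity)
    norm_num at hq
    linarith
  rw [← sign_eq_sign_of_mul_pos hmn]
  push_cast
  ring

/-- If `q(Y) < 0`, the two signs are opposite: `p'` tends to the same infinity at both ends of the
geodesic and the integral vanishes. So only vectors of positive norm survive. -/
lemma tsum_integral_kernel_neg (ha : 0 < (a : ℝ)) (hD : 0 < b ^ 2 - 4 * a * c)
    (hg₀ : g₀ ∈ stab (formMatrix a b c)) (hpos : 0 < shift a b c g₀)
    (hgen : ∀ g ∈ stab (formMatrix a b c), ∃ k : ℤ, shift a b c g = k * shift a b c g₀)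
    (δ : Disc (latticeI (formMatrix a b c))) :
    ∑' Y : {Y : dual (latticeI (formMatrix a b c)) //
        toDisc (latticeI (formMatrix a b c)) Y = δ ∧ q Y < 0},
          ∫ s in Set.Ioc 0 (shift a b c g₀), kernel a b c τ x y Y.1 s = 0 := by
  have hD' := disc_pos_cast hD
  let r : Setoid {Y : dual (latticeI (formMatrix a b c)) //
        toDisc (latticeI (formMatrix a b c)) Y = δ ∧ q Y < 0} :=
    { r Y Y' := ∃ g ∈ stab (formMatrix a b c), conj g (Y.1 : V) = (Y'.1 : V)
      iseqv :=
        { refl := fun Y => ⟨1, one_mem _, conj_one _⟩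
          symm := by
            rintro Y Y' ⟨g, hg, h⟩
            exact ⟨g⁻¹, inv_mem hg, conj_inv_eq h⟩
          trans := by
            rintro Y Y' Y'' ⟨g, hg, h⟩ ⟨g', hg', h'⟩
            exact ⟨g' * g, mul_mem hg' hg, by rw [conj_mul, h, h']⟩ } }
  have h := hasSum_integral_kernel τ x y ha hD hg₀ hpos hgen δ (P := fun Y => q Y < 0)
    (fun g Y => by rw [q_conj]) (fun Y h => h.ne) r (fun _ _ => Iff.rfl)
  refine h.unique (hasSum_zero.congr_fun fun C => ?_)
  have hq := (Quotient.out C).2.2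
  have h1 := traceless_of_mem_dual_le (latticeI_le _) (Quotient.out C).1.2
  have h2 := perp_of_mem_dual_latticeI (Quotient.out C).1.2
  generalize ((Quotient.out C).1 : V) = Y at *
  have hr := radius_pos ha hD'
  have hmn : bil Y (vecY0 a b c) * bil Y (vecY1 a b c) < 0 := by
    rw [q_eq_combination ha hD' h1, h2] at hq
    by_contra! hneg
    have : 0 ≤ bil Y (vecY0 a b c) * bil Y (vecY1 a b c) / (4 * radius a b c ^ 2) := by
      positivity
    norm_num at hq
    linarith
  rw [sign_add_sign_of_mul_neg hmn]
  simp

/-- A sum that vanishes on isotropic vectors is the sum over the vectors of positive and of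
negative norm. -/
lemma tsum_eq_add_of_q {ι : Type*} {p : ι → Prop} (f : ι → ℂ) (Qr : ι → ℝ)
    (hf : Summable fun i : {i // p i} => f i) (h0 : ∀ i, p i → Qr i = 0 → f i = 0) :
    ∑' i : {i // p i}, f i = ∑' i : {i // p i ∧ 0 < Qr i}, f i +
      ∑' i : {i // p i ∧ Qr i < 0}, f i := by
  have h1 : HasSum ((fun i : {i // p i} => f i) ∘ ((↑) : {i : {i // p i} | 0 < Qr i} → _))
      (∑' i : {i // p i ∧ 0 < Qr i}, f i) := by
    have := (hf.subtype {i : {i // p i} | 0 < Qr i}).hasSum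
    rwa [← (Equiv.subtypeSubtypeEquivSubtypeInter p fun i => 0 < Qr i).tsum_eq
      (fun i : {i // p i ∧ 0 < Qr i} => f i)]
  have h2 : HasSum ((fun i : {i // p i} => f i) ∘ ((↑) : {i : {i // p i} | Qr i < 0} → _))
      (∑' i : {i // p i ∧ Qr i < 0}, f i) := by
    have := (hf.subtype {i : {i // p i} | Qr i < 0}).hasSum
    rwa [← (Equiv.subtypeSubtypeEquivSubtypeInter p fun i => Qr i < 0).tsum_eq
      (fun i : {i // p i ∧ Qr i < 0} => f i)]
  have hdisj : Disjoint {i : {i // p i} | 0 < Qr i} {i : {i // p i} | Qr i < 0} :=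
    Set.disjoint_left.2 fun i (hi : 0 < Qr i) (hi' : Qr i < 0) => lt_asymm hi hi'
  refine HasSum.tsum_eq ((hasSum_subtype_iff_of_support_subset ?_).1 (h1.add_disjoint hdisj h2))
  intro i hi
  rcases lt_trichotomy (Qr i) 0 with h | h | h
  · exact Or.inr h
  · exact absurd (h0 i i.2 h) hi
  · exact Or.inl h

/-- The integral over a period of the contribution of a class of `I'/I`. -/
lemma integral_tsum_kernel_eq (ha : 0 < (a : ℝ)) (hD : 0 < b ^ 2 - 4 * a * c)
    (hsq : ¬IsSquare (b ^ 2 - 4 * a * c))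
    (hg₀ : g₀ ∈ stab (formMatrix a b c)) (hpos : 0 < shift a b c g₀)
    (hgen : ∀ g ∈ stab (formMatrix a b c), ∃ k : ℤ, shift a b c g = k * shift a b c g₀)
    (δ : Disc (latticeI (formMatrix a b c))) :
    ∫ s in Set.Ioc 0 (shift a b c g₀), ∑' Y : {Y : dual (latticeI (formMatrix a b c)) //
        toDisc (latticeI (formMatrix a b c)) Y = δ}, kernel a b c τ x y Y.1 s =
      x * (√(Real.pi / (2 * Real.pi * τ.im)) : ℝ) * heckeTheta a b c τ δ := by
  have h1 := integral_tsum_kernel τ x y ha hD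
    (fun Y => toDisc (latticeI (formMatrix a b c)) Y = δ) hpos
  rw [← h1.tsum_eq, tsum_eq_add_of_q
    (fun Y : dual (latticeI (formMatrix a b c)) =>
      ∫ s in Set.Ioc 0 (shift a b c g₀), kernel a b c τ x y Y s) (fun Y => q Y) h1.summable,
    tsum_integral_kernel_neg τ x y ha hD hg₀ hpos hgen δ, add_zero,
    ← (hasSum_integral_kernel_pos τ x y ha hD hg₀ hpos hgen δ).tsum_eq, tsum_mul_left]
  · rfl
  · intro Y _ hq
    -- The only isotropic vector is `0`, for which `p` vanishes identically.
    have hY := eq_zero_of_q_eq_zero ha hD hsq Y.2 hq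
    simp [hY, kernel, arcProd, expSum, bil_zero_left]

/-- Convergence of Hecke's series is a by-product of the unfolding, with weights `x = 1`, `y = 0`.
-/
lemma summable_heckeTerm (ha : 0 < (a : ℝ)) (hD : 0 < b ^ 2 - 4 * a * c)
    (hg₀ : g₀ ∈ stab (formMatrix a b c)) (hpos : 0 < shift a b c g₀)
    (hgen : ∀ g ∈ stab (formMatrix a b c), ∃ k : ℤ, shift a b c g = k * shift a b c g₀)
    (δ : Disc (latticeI (formMatrix a b c))) :
    Summable fun C : Quotient (heckeSetoid (formMatrix a b c) δ) =>
      heckeTerm a b c τ (Quotient.out C).1 := by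
  have h := (hasSum_integral_kernel_pos τ 1 0 ha hD hg₀ hpos hgen δ).summable
  have hv := τ.im_pos
  have hpi := Real.pi_pos
  have hne : (1 : ℂ) * (√(Real.pi / (2 * Real.pi * τ.im)) : ℝ) ≠ 0 := by
    rw [one_mul]
    have : (0 : ℝ) < √(Real.pi / (2 * Real.pi * τ.im)) := by positivity
    exact_mod_cast this.ne'
  exact (summable_mul_left_iff hne).1 h

/-- The contribution of a class of `I'/I` is periodic. -/
lemma tsum_kernel_add (ha : 0 < (a : ℝ)) (hD : 0 < b ^ 2 - 4 * a * c)
    (hg₀ : g₀ ∈ stab (formMatrix a b c)) (δ : Disc (latticeI (formMatrix a b c))) (j : ℤ)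
    (s : ℝ) :
    ∑' Y : {Y : dual (latticeI (formMatrix a b c)) //
        toDisc (latticeI (formMatrix a b c)) Y = δ},
          kernel a b c τ x y Y.1 (j * shift a b c g₀ + s) =
      ∑' Y : {Y : dual (latticeI (formMatrix a b c)) //
        toDisc (latticeI (formMatrix a b c)) Y = δ}, kernel a b c τ x y Y.1 s := by
  have hD' := disc_pos_cast hD
  -- `permHom` is used with the condition `True`, since here all vectors of the class occur.
  let E : {Y : dual (latticeI (formMatrix a b c)) //
        toDisc (latticeI (formMatrix a b c)) Y = δ} ≃ {Y : dual (latticeI (formMatrix a b c)) //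
        toDisc (latticeI (formMatrix a b c)) Y = δ ∧ True} :=
    Equiv.subtypeEquivRight fun Y => by simp
  let σ := permHom a b c δ (fun _ => True) (fun _ _ => Iff.rfl) (⟨g₀, hg₀⟩ ^ j)
  rw [← ((E.trans σ).trans E.symm).tsum_eq (fun Y : {Y : dual (latticeI (formMatrix a b c)) //
        toDisc (latticeI (formMatrix a b c)) Y = δ} =>
          kernel a b c τ x y Y.1 (j * shift a b c g₀ + s))]
  refine tsum_congr fun Y => ?_
  have : ((((E.trans σ).trans E.symm) Y).1 : V) = conj (g₀ ^ j) Y.1 := rfl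
  rw [this, kernel_conj τ x y ha hD' (zpow_mem hg₀ j), shift_zpow ha hD' hg₀, add_sub_cancel_left]

end Integral

/-! ### The integrand along the geodesic -/

section Real

variable {a b c : ℝ}

/-- For `p = (X, X(z))`, the real part of `(p_x - i p_y)(x' + i y')` is the derivative along the
geodesic, and the imaginary part `p_x y' - p_y x'` is a normal derivative. Leaving `S_A` in the
normal direction moves `X(z)` in the direction of `A`, which is why `(X, A)` appears. -/
lemma deriv_posVec_geodesicPath (ha : 0 < a) (hD : 0 < b ^ 2 - 4 * a * c) {X : V}
    (hX : X 1 1 = -X 0 0) (s : ℝ) :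
    ((posDerivX X (geodesicPath a b c s) : ℂ) -
      Complex.I * posDerivY X (geodesicPath a b c s)) * deriv (geodesicPath a b c) s =
      arcProd' a b c X s -
        Complex.I * (√2 * bil X (formMatrix a b c) / √(b ^ 2 - 4 * a * c) : ℝ) := by
  have hr := radius_pos ha hD
  have hC := Real.cosh_pos s
  have h2 : √2 ^ 2 = 2 := Real.sq_sqrt two_pos.le
  have h2' : 0 < √2 := by positivity
  have hsq := Real.cosh_sq s
  have he := (Real.cosh_add_sinh s).symm
  have he' := (Real.cosh_sub_sinh s).symm
  rw [(hasDerivAt_geodesicPath s).deriv, sqrt_disc_eq ha]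
  have k1 : posDerivX X (geodesicPath a b c s) * (-radius a b c / Real.cosh s ^ 2) +
      posDerivY X (geodesicPath a b c s) * (-radius a b c * Real.sinh s / Real.cosh s ^ 2) =
      arcProd' a b c X s := by
    rw [posDerivX, posDerivY, ← arcProd_eq ha hD, arcProd, arcProd', geodesicPath_re,
      geodesicPath_im, Real.tanh_eq_sinh_div_cosh, expSum, expSum, bil_eq, bil_eq, hX,
      vecY0, vecY1, endpoint_eq, endpoint'_eq]
    simp
    field_simp
    rw [h2, he, he']
    linear_combination
      (-(4 * radius a b c * (X 1 0 * center a b - X 0 0)) * Real.cosh s) * hsq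
  have k2 : posDerivX X (geodesicPath a b c s) *
        (-radius a b c * Real.sinh s / Real.cosh s ^ 2) -
      posDerivY X (geodesicPath a b c s) * (-radius a b c / Real.cosh s ^ 2) =
      -(√2 * bil X (formMatrix a b c) / (2 * a * radius a b c)) := by
    rw [posDerivX, posDerivY, ← arcProd_eq ha hD, arcProd, geodesicPath_re,
      geodesicPath_im, Real.tanh_eq_sinh_div_cosh, expSum, bil_eq, bil_eq, bil_eq, hX,
      vecY0, vecY1, formMatrix_eq ha hD, endpoint_eq, endpoint'_eq]
    simp
    field_simp
    rw [h2, he, he']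
    linear_combination (4 * X 1 0 * radius a b c ^ 2) * hsq
  rw [← k1, show √2 * bil X (formMatrix a b c) / (2 * a * radius a b c) = _ from
    neg_eq_iff_eq_neg.1 k2.symm]
  push_cast
  linear_combination (-((posDerivY X (geodesicPath a b c s) : ℂ)) *
    (-radius a b c * Complex.sinh s / Complex.cosh s ^ 2)) * Complex.I_sq

end Real

/-! ### Decomposition along `I ⊕ N` -/

lemma toDisc_eq_iff {M : AddSubgroup V} {X Y : dual M} :
    toDisc M X = toDisc M Y ↔ (X : V) - Y ∈ M := by
  rw [toDisc, toDisc, QuotientAddGroup.eq, AddSubgroup.mem_addSubgroupOf, ← neg_mem_iff]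
  push_cast
  rw [neg_add, neg_neg, sub_eq_add_neg]

lemma coeff_of_mem {M : AddSubgroup V} (g : GroupRing M) {X : V} (hX : X ∈ dual M) :
    coeff g X = g (toDisc M ⟨X, hX⟩) := by rw [coeff, dif_pos hX]

section Integral

variable {a b c : ℤ} (τ : ℍ)

lemma proj_mem_of_mem_sup (hD : 0 < b ^ 2 - 4 * a * c) {Z : V}
    (hZ : Z ∈ latticeI (formMatrix a b c) ⊔ latticeN (formMatrix a b c)) :
    projPerp (formMatrix a b c) Z ∈ latticeI (formMatrix a b c) ∧
      projLine (formMatrix a b c) Z ∈ latticeN (formMatrix a b c) := by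
  have hA := bil_self_ne hD
  obtain ⟨X, hX, W, hW, rfl⟩ := AddSubgroup.mem_sup.1 hZ
  have h1 := hX.2
  obtain ⟨hWL, r, rfl⟩ := hW
  rw [projPerp_add, projLine_add, projPerp_of_perp h1, projLine_of_perp h1,
    projPerp_smul_self hA, projLine_smul_self hA, add_zero, zero_add]
  exact ⟨hX, hWL, r, rfl⟩

lemma projPerp_sub (A X Y : V) : projPerp A (X - Y) = projPerp A X - projPerp A Y := by
  rw [eq_sub_iff_add_eq, ← projPerp_add, sub_add_cancel]

lemma projLine_sub (A X Y : V) : projLine A (X - Y) = projLine A X - projLine A Y := by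
  rw [eq_sub_iff_add_eq, ← projLine_add, sub_add_cancel]

lemma projPerp_add_of_mem (hD : 0 < b ^ 2 - 4 * a * c) {Y W : V}
    (hY : Y ∈ dual (latticeI (formMatrix a b c)))
    (hW : W ∈ dual (latticeN (formMatrix a b c))) :
    projPerp (formMatrix a b c) (Y + W) = Y ∧ projLine (formMatrix a b c) (Y + W) = W := by
  have hA := bil_self_ne hD
  have h1 := perp_of_mem_dual_latticeI hY
  obtain ⟨r, rfl⟩ := exists_smul_of_mem_dual_latticeN hW
  rw [projPerp_add, projLine_add, projPerp_of_perp h1, projLine_of_perp h1,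
    projPerp_smul_self hA, projLine_smul_self hA, add_zero, zero_add]
  exact ⟨rfl, rfl⟩

/-- A representative of the class of `β + γ` for `β ∈ L/(I ⊕ N)` and `γ ∈ L'/L`. -/
noncomputable def cosetRep {M : AddSubgroup V} (γ : Disc latticeL)
    (β : latticeL ⧸ M.addSubgroupOf latticeL) : V :=
  (Quotient.out β : latticeL) + (Quotient.out γ : dual latticeL)

lemma cosetRep_mem {M : AddSubgroup V} (γ : Disc latticeL)
    (β : latticeL ⧸ M.addSubgroupOf latticeL) : cosetRep γ β ∈ dual latticeL :=
  add_mem (latticeL_le_dual (Quotient.out β).2) (Quotient.out γ).2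

/-- The class of the projection to `I'` of a representative of `β + γ`. -/
noncomputable def classI (hD : 0 < b ^ 2 - 4 * a * c) (γ : Disc latticeL)
    (β : latticeL ⧸ (latticeI (formMatrix a b c) ⊔
      latticeN (formMatrix a b c)).addSubgroupOf latticeL) : Disc (latticeI (formMatrix a b c)) :=
  toDisc _ ⟨projPerp (formMatrix a b c) (cosetRep γ β), projPerp_mem_dual hD (cosetRep_mem γ β)⟩

/-- The class of the projection to `N'` of a representative of `β + γ`. -/
noncomputable def classN (hD : 0 < b ^ 2 - 4 * a * c) (γ : Disc latticeL)
    (β : latticeL ⧸ (latticeI (formMatrix a b c) ⊔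
      latticeN (formMatrix a b c)).addSubgroupOf latticeL) : Disc (latticeN (formMatrix a b c)) :=
  toDisc _ ⟨projLine (formMatrix a b c) (cosetRep γ β), projLine_mem_dual hD (cosetRep_mem γ β)⟩

lemma add_sub_cosetRep_mem (hD : 0 < b ^ 2 - 4 * a * c) {γ : Disc latticeL}
    {β : latticeL ⧸ (latticeI (formMatrix a b c) ⊔
      latticeN (formMatrix a b c)).addSubgroupOf latticeL}
    {Y : dual (latticeI (formMatrix a b c))} {W : dual (latticeN (formMatrix a b c))}
    (hY : toDisc _ Y = classI hD γ β) (hW : toDisc _ W = classN hD γ β) :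
    (Y : V) + W - cosetRep γ β ∈ latticeI (formMatrix a b c) ⊔ latticeN (formMatrix a b c) := by
  have h1 := toDisc_eq_iff.1 hY
  have h2 := toDisc_eq_iff.1 hW
  have h3 := AddSubgroup.add_mem_sup h1 h2
  convert h3 using 1
  change _ = (Y : V) - projPerp (formMatrix a b c) (cosetRep γ β) +
    (W - projLine (formMatrix a b c) (cosetRep γ β))
  nth_rewrite 1 [← projPerp_add_projLine (formMatrix a b c) (cosetRep γ β)]
  abel

/-- The decomposition of a class of `L'/L` into products of classes of `I'/I` and `N'/N`. -/
noncomputable def cosetMap (hD : 0 < b ^ 2 - 4 * a * c) (γ : Disc latticeL) :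
    (Σ β : latticeL ⧸ (latticeI (formMatrix a b c) ⊔
      latticeN (formMatrix a b c)).addSubgroupOf latticeL,
      {Y : dual (latticeI (formMatrix a b c)) // toDisc _ Y = classI hD γ β} ×
        {W : dual (latticeN (formMatrix a b c)) // toDisc _ W = classN hD γ β}) →
      {X : dual latticeL // toDisc latticeL X = γ} := fun x =>
  have h := add_sub_cosetRep_mem hD x.2.1.2 x.2.2.2
  have hL := sup_le (latticeI_le _) (latticeN_le _) h
  ⟨⟨x.2.1.1 + x.2.2.1, by
    simpa using add_mem (latticeL_le_dual hL) (cosetRep_mem γ x.1)⟩, by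
    refine Eq.trans (toDisc_eq_iff.2 ?_) (Quotient.out_eq γ)
    have h1 : (x.2.1.1 : V) + x.2.2.1 - (Quotient.out γ : dual latticeL) =
        ((x.2.1.1 : V) + x.2.2.1 - cosetRep γ x.1) + (Quotient.out x.1 : latticeL) := by
      unfold cosetRep
      abel
    exact h1 ▸ add_mem hL (Quotient.out x.1).2⟩

/-- The two projections recover `Y` and `W` from `Y + W`, and `β` is the class of `X` minus the
representative of `γ`. Conversely, the projections of any `X` in the class lie in the required
classes, because they carry `I ⊕ N` into `I` and `N`. -/
lemma bijective_cosetMap (hD : 0 < b ^ 2 - 4 * a * c) (γ : Disc latticeL) :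
    Function.Bijective (cosetMap hD γ) := by
  constructor
  · rintro ⟨β, ⟨Y, hY⟩, ⟨W, hW⟩⟩ ⟨β', ⟨Y', hY'⟩, ⟨W', hW'⟩⟩ h
    have h1 : (Y : V) + W = Y' + W' := congrArg (fun x => (x.1 : V)) h
    have h2 := projPerp_add_of_mem hD Y.2 W.2
    have h3 := projPerp_add_of_mem hD Y'.2 W'.2
    rw [h1] at h2
    obtain rfl : Y = Y' := Subtype.ext (h2.1.symm.trans h3.1)
    obtain rfl : W = W' := Subtype.ext (h2.2.symm.trans h3.2)
    have hβ : β = β' := by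
      rw [← Quotient.out_eq β, ← Quotient.out_eq β']
      refine QuotientAddGroup.eq.2 ?_
      rw [AddSubgroup.mem_addSubgroupOf]
      convert sub_mem (add_sub_cosetRep_mem hD hY hW) (add_sub_cosetRep_mem hD hY' hW') using 1
      rw [cosetRep, cosetRep]
      push_cast
      abel
    subst hβ
    rfl
  · rintro ⟨X, hX⟩
    have hXL : (X : V) - (Quotient.out γ : dual latticeL) ∈ latticeL :=
      toDisc_eq_iff.1 (hX.trans (Quotient.out_eq γ).symm)
    let β : latticeL ⧸ (latticeI (formMatrix a b c) ⊔
      latticeN (formMatrix a b c)).addSubgroupOf latticeL := QuotientAddGroup.mk ⟨_, hXL⟩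
    have hβ : (X : V) - cosetRep γ β ∈
        latticeI (formMatrix a b c) ⊔ latticeN (formMatrix a b c) := by
      have h1 : (QuotientAddGroup.mk (Quotient.out β) : latticeL ⧸ _) = β := Quotient.out_eq β
      have h2 := QuotientAddGroup.eq.1 h1
      rw [AddSubgroup.mem_addSubgroupOf] at h2
      convert h2 using 1
      rw [cosetRep]
      push_cast
      abel
    have hproj := proj_mem_of_mem_sup hD hβ
    rw [projPerp_sub, projLine_sub] at hproj
    refine ⟨⟨β, ⟨⟨_, projPerp_mem_dual hD X.2⟩, toDisc_eq_iff.2 hproj.1⟩,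
      ⟨⟨_, projLine_mem_dual hD X.2⟩, toDisc_eq_iff.2 hproj.2⟩⟩, ?_⟩
    exact Subtype.ext (Subtype.ext (projPerp_add_projLine _ _))

/-- `tensor` evaluates at a chosen representative `Z`. It differs from `cosetRep γ β` by a vector of
`I ⊕ N ⊆ L`, so it lies in `L'` as well, and its projections have the same classes. -/
lemma coeff_tensor (hD : 0 < b ^ 2 - 4 * a * c) (f : GroupRing (latticeI (formMatrix a b c)))
    (h : GroupRing (latticeN (formMatrix a b c))) (γ : Disc latticeL)
    (β : latticeL ⧸ (latticeI (formMatrix a b c) ⊔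
      latticeN (formMatrix a b c)).addSubgroupOf latticeL) :
    coeff (tensor (formMatrix a b c) f h) (cosetRep γ β) =
      f (classI hD γ β) * h (classN hD γ β) := by
  have hv := cosetRep_mem γ β
  have hv' := dual_latticeL_le hD hv
  rw [coeff_of_mem _ hv', tensor]
  set Z := Quotient.out (toDisc (latticeI (formMatrix a b c) ⊔ latticeN (formMatrix a b c))
    ⟨cosetRep γ β, hv'⟩) with hZ
  have h1 : (Z : V) - cosetRep γ β ∈
      latticeI (formMatrix a b c) ⊔ latticeN (formMatrix a b c) :=
    toDisc_eq_iff.1 (Quotient.out_eq _)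
  have hZL : (Z : V) ∈ dual latticeL := by
    simpa using add_mem (latticeL_le_dual (sup_le (latticeI_le _) (latticeN_le _) h1)) hv
  have hproj := proj_mem_of_mem_sup hD h1
  rw [projPerp_sub, projLine_sub] at hproj
  rw [coeff_of_mem f (projPerp_mem_dual hD hZL), coeff_of_mem h (projLine_mem_dual hD hZL)]
  congr 2
  · exact toDisc_eq_iff.2 hproj.1
  · exact toDisc_eq_iff.2 hproj.2

end Integral

/-! ### The unary theta series and the evaluation of the cycle integral -/

section Final

variable {a b c : ℤ} (τ : ℍ)

lemma bil_formMatrix_vecY {a b c : ℝ} (ha : 0 < a) (hD : 0 < b ^ 2 - 4 * a * c) :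
    bil (formMatrix a b c) (vecY0 a b c) = 0 ∧ bil (formMatrix a b c) (vecY1 a b c) = 0 := by
  rw [formMatrix_eq ha hD, bil_smul_left, bil_smul_left, bil_eq, bil_eq, vecY0, vecY1,
    endpoint_eq, endpoint'_eq]
  constructor
  · simp; right; ring
  · simp; right; ring

/-- The complex conjugate of the summand `e(-q(W)τ)`. -/
lemma conj_e_neg (r : ℝ) : (starRingEnd ℂ) (e (-(r : ℂ) * τ)) =
    e ((r : ℂ) * (starRingEnd ℂ) (τ : ℂ)) := by
  rw [e, e, ← Complex.exp_conj]
  congr 1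
  simp only [map_mul, map_neg, Complex.conj_ofReal, Complex.conj_I, map_ofNat]
  ring

lemma summable_sqNorm_dual_latticeN (hD : 0 < b ^ 2 - 4 * a * c)
    {P : dual (latticeN (formMatrix a b c)) → Prop} {C : ℝ} (hC : 0 < C) :
    Summable fun W : {W : dual (latticeN (formMatrix a b c)) // P W} =>
      Real.exp (-C * sqNorm (W.1 : V)) :=
  summable_exp_neg_sqNorm (f := fun W : {W : dual (latticeN (formMatrix a b c)) // P W} =>
    (W.1 : V)) (Subtype.val_injective.comp Subtype.val_injective) (four_mul_disc_ne hD)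
    (fun W => smul_mem_of_mem_dual_latticeN W.1.2) hC

lemma norm_e_q (W : V) : ‖e ((q W : ℂ) * (starRingEnd ℂ) (τ : ℂ))‖ =
    Real.exp (2 * Real.pi * τ.im * q W) := by
  rw [norm_e]
  congr 1
  simp
  ring

/-- The unary theta series with the weights `1` and `(W, A)` converge absolutely. -/
lemma summable_unary (hD : 0 < b ^ 2 - 4 * a * c)
    (P : dual (latticeN (formMatrix a b c)) → Prop) :
    (Summable fun W : {W : dual (latticeN (formMatrix a b c)) // P W} =>
      ‖e ((q W.1 : ℂ) * (starRingEnd ℂ) (τ : ℂ))‖) ∧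
    Summable fun W : {W : dual (latticeN (formMatrix a b c)) // P W} =>
      ‖(bil W.1 (formMatrix a b c) : ℂ) * e ((q W.1 : ℂ) * (starRingEnd ℂ) (τ : ℂ))‖ := by
  have hv := τ.im_pos
  have hpi := Real.pi_pos
  have hD' := disc_pos_cast hD
  set D : ℝ := (b : ℝ) ^ 2 - 4 * a * c with hDdef
  have hAA : bil (formMatrix a b c) (formMatrix (a : ℝ) b c) = -D / 2 := bil_formMatrix_self _ _ _
  have hqA : q (formMatrix (a : ℝ) b c) = -D / 4 := by have := bil_self (formMatrix (a : ℝ) b c); rw [hAA] at this; linarith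
  have hsA : 0 < sqNorm (formMatrix (a : ℝ) b c) := by
    have h0 := sqNorm_nonneg (formMatrix (a : ℝ) b c)
    refine h0.lt_of_ne' fun h => ?_
    have h1 : formMatrix (a : ℝ) b c 0 0 = 0 ∧ formMatrix (a : ℝ) b c 0 1 = 0 ∧ formMatrix (a : ℝ) b c 1 0 = 0 := by
      unfold sqNorm at h
      refine ⟨?_, ?_, ?_⟩ <;> nlinarith [sq_nonneg (formMatrix (a : ℝ) b c 0 0), sq_nonneg (formMatrix (a : ℝ) b c 0 1), sq_nonneg (formMatrix (a : ℝ) b c 1 0)]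
    rw [q_eq, h1.1, h1.2.1] at hqA
    linarith
  have hW : ∀ W : {W : dual (latticeN (formMatrix a b c)) // P W}, ∃ r : ℝ, (W.1 : V) = r • formMatrix (a : ℝ) b c :=
    fun W => exists_smul_of_mem_dual_latticeN W.1.2
  have hsm : ∀ r : ℝ, sqNorm (r • formMatrix (a : ℝ) b c) = r ^ 2 * sqNorm (formMatrix (a : ℝ) b c) := fun r => by
    simp only [sqNorm, Matrix.smul_apply, smul_eq_mul]; ring
  constructor
  -- For `W = rA`, `q(W) = -r²D/4` is negative and the norm is exactly a Gaussian in `sqNorm W`.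
  · refine .of_nonneg_of_le (fun W => norm_nonneg _) (fun W => ?_)
      (summable_sqNorm_dual_latticeN (P := P) hD
        (C := Real.pi * τ.im * D / (2 * sqNorm (formMatrix (a : ℝ) b c))) (by positivity))
    obtain ⟨r, hr⟩ := hW W
    rw [norm_e_q, hr, q_smul, hqA, hsm, Real.exp_le_exp]
    apply le_of_eq
    field_simp
    ring
  · refine .of_nonneg_of_le (fun W => norm_nonneg _) (fun W => ?_)
      ((summable_sqNorm_dual_latticeN (P := P) hD
        (C := Real.pi * τ.im * D / (4 * sqNorm (formMatrix (a : ℝ) b c))) (by positivity)).mul_left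
        (D / 2 * (1 + 4 / (Real.pi * τ.im * D))))
    obtain ⟨r, hr⟩ := hW W
    rw [norm_mul, norm_e_q, hr, q_smul, hqA, hsm, bil_smul_left, hAA, Complex.norm_real,
      Real.norm_eq_abs, abs_mul, show |-D / 2| = D / 2 by
        rw [abs_div, abs_neg, abs_of_pos hD', abs_two]]
    -- The Gaussian is split into two equal factors, one of which absorbs `|r|`.
    have e1 : 2 * Real.pi * τ.im * (r ^ 2 * (-D / 4)) =
      -(Real.pi * τ.im * D / 4 * r ^ 2) + -(Real.pi * τ.im * D / 4 * r ^ 2) := by ring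
    have e2 : -(Real.pi * τ.im * D / (4 * sqNorm (formMatrix (a : ℝ) b c))) * (r ^ 2 * sqNorm (formMatrix (a : ℝ) b c)) =
      -(Real.pi * τ.im * D / 4 * r ^ 2) := by field_simp
    have e3 : |r| ≤ 1 + r ^ 2 := by
      rw [← sq_abs r]; nlinarith [sq_nonneg (|r| - 1)]
    have e4 : r ^ 2 = 4 / (Real.pi * τ.im * D) * (Real.pi * τ.im * D / 4 * r ^ 2) := by
      field_simp
    rw [e1, e2, Real.exp_add]
    set u := Real.pi * τ.im * D / 4 * r ^ 2 with hu
    have hu0 : 0 ≤ u := by positivity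
    have e5 : u + 1 ≤ Real.exp u := Real.add_one_le_exp u
    have e6 : |r| ≤ (1 + 4 / (Real.pi * τ.im * D)) * Real.exp u := by
      rw [add_mul, one_mul]
      have : 4 / (Real.pi * τ.im * D) * u ≤ 4 / (Real.pi * τ.im * D) * Real.exp u := by
        gcongr; linarith
      linarith
    have e7 : Real.exp u * Real.exp (-u) = 1 := by
      rw [← Real.exp_add, add_neg_cancel, Real.exp_zero]
    calc |r| * (D / 2) * (Real.exp (-u) * Real.exp (-u))
        ≤ (1 + 4 / (Real.pi * τ.im * D)) * Real.exp u * (D / 2) *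
          (Real.exp (-u) * Real.exp (-u)) := by gcongr
      _ = D / 2 * (1 + 4 / (Real.pi * τ.im * D)) * (Real.exp u * Real.exp (-u)) *
          Real.exp (-u) := by ring
      _ = _ := by rw [e7, mul_one]

lemma summable_unaryTerm (hD : 0 < b ^ 2 - 4 * a * c) (δ : Disc (latticeN (formMatrix a b c))) :
    Summable fun W : {W : dual (latticeN (formMatrix a b c)) //
      toDisc (latticeN (formMatrix a b c)) W = δ} => unaryTerm (formMatrix a b c) τ W.1 := by
  refine ((summable_unary τ hD (fun W => toDisc _ W = δ)).2.congr fun W => ?_).of_norm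
  rw [unaryTerm, norm_mul, norm_mul, ← conj_e_neg, RCLike.norm_conj]

lemma tsum_conj_unaryTerm (δ : Disc (latticeN (formMatrix a b c))) :
    ∑' W : {W : dual (latticeN (formMatrix a b c)) //
      toDisc (latticeN (formMatrix a b c)) W = δ}, (bil W.1 (formMatrix a b c) : ℂ) *
        e ((q W.1 : ℂ) * (starRingEnd ℂ) (τ : ℂ)) =
      (starRingEnd ℂ) (unaryTheta (formMatrix a b c) τ δ) := by
  rw [unaryTheta, Complex.conj_tsum]
  refine tsum_congr fun W => ?_
  rw [unaryTerm, map_mul, Complex.conj_ofReal, conj_e_neg]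

lemma kernel_linear (a b c : ℝ) (x y : ℂ) (Y : V) (s : ℝ) : kernel a b c τ x y Y s =
    kernel a b c τ 1 0 Y s * x + kernel a b c τ 0 1 Y s * y := by
  simp only [kernel]; ring

/-- The weight of `(W, A)`-type in the integrand. -/
noncomputable def weightA (a b c : ℝ) (τ : ℍ) : ℂ :=
  (-(4 * Real.pi * τ.im ^ 2 * √2 / √(b ^ 2 - 4 * a * c)) : ℝ)

/-- The summand of index `Y + W` of the integrand of the cycle integral. -/
lemma integrand_summand (ha : 0 < (a : ℝ)) (hD : 0 < b ^ 2 - 4 * a * c)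
    (Y : dual (latticeI (formMatrix a b c))) (W : dual (latticeN (formMatrix a b c))) (s : ℝ) :
    Complex.I * τ.im * (siegelTerm τ (geodesicPath a b c s) (Y + W) *
        ((-(4 * Real.pi * τ.im) * bil (Y + W) (posVec (geodesicPath a b c s)) : ℝ) : ℂ) *
        (posDerivX (Y + W) (geodesicPath a b c s) -
          Complex.I * posDerivY (Y + W) (geodesicPath a b c s))) *
        deriv (geodesicPath a b c) s =
      kernel a b c τ 1 0 Y s * (weightA a b c τ *
        ((bil W (formMatrix a b c) : ℂ) * e ((q W : ℂ) * (starRingEnd ℂ) (τ : ℂ)))) +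
      kernel a b c τ 0 1 Y s * (-(4 * Real.pi * τ.im ^ 2 * Complex.I) *
        e ((q W : ℂ) * (starRingEnd ℂ) (τ : ℂ))) := by
  have hD' := disc_pos_cast hD
  have hz := geodesicPath_im_pos ha hD' s
  have hYt := traceless_of_mem_dual_le (latticeI_le _) Y.2
  have hWt := traceless_of_mem_dual_le (latticeN_le _) W.2
  have ht : ((Y : V) + W) 1 1 = -((Y : V) + W) 0 0 := by
    simp only [Matrix.add_apply, hYt, hWt]; ring
  have hYA := perp_of_mem_dual_latticeI Y.2
  obtain ⟨h0, h1⟩ := bil_formMatrix_vecY ha hD'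
  obtain ⟨r, hr⟩ := exists_smul_of_mem_dual_latticeN W.2
  have hYW : bil Y (W : V) = 0 := by rw [hr, bil_smul_right, hYA, mul_zero]
  -- `W` is a multiple of `A`, which is orthogonal to `Y₀` and `Y₁`.
  have hp : arcProd a b c ((Y : V) + W) s = arcProd a b c Y s := by
    rw [arcProd, arcProd, bil_add_left, bil_add_left, hr, bil_smul_left, bil_smul_left, h0, h1,
      mul_zero, add_zero, add_zero]
  have hp' : arcProd' a b c ((Y : V) + W) s = arcProd' a b c Y s := by
    rw [arcProd', arcProd', bil_add_left, bil_add_left, hr, bil_smul_left, bil_smul_left, h0, h1,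
      mul_zero, add_zero, add_zero]
  have hq : e ((q ((Y : V) + W) : ℂ) * (starRingEnd ℂ) (τ : ℂ)) =
      e ((q Y : ℂ) * (starRingEnd ℂ) (τ : ℂ)) * e ((q W : ℂ) * (starRingEnd ℂ) (τ : ℂ)) := by
    rw [q_add, hYW, add_zero, ← e_add]; push_cast; ring_nf
  have hd := deriv_posVec_geodesicPath ha hD' ht s
  rw [bil_add_left, hYA, zero_add, hp'] at hd
  rw [mul_assoc, mul_assoc (siegelTerm _ _ _ * _), hd, siegelTerm_eq τ hz, ← arcProd_eq ha hD',
    hp, hq, kernel, kernel, weightA]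
  push_cast
  simp only [neg_mul]
  linear_combination (4 * Real.pi * τ.im ^ 2 * √2 / √((b : ℝ) ^ 2 - 4 * a * c) *
    (bil W (formMatrix a b c) : ℂ) * e ((q W : ℂ) * (starRingEnd ℂ) (τ : ℂ)) *
    e ((q Y : ℂ) * (starRingEnd ℂ) (τ : ℂ)) * (arcProd a b c Y s : ℂ) *
    Complex.exp (-(2 * Real.pi * τ.im * (arcProd a b c Y s : ℂ) ^ 2))) * Complex.I_sq

lemma hasSum_mul_add_mul {α β : Type*} {f f' : α → ℂ} {g g' : β → ℂ}
    (hf : Summable fun i => ‖f i‖) (hf' : Summable fun i => ‖f' i‖)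
    (hg : Summable fun i => ‖g i‖) (hg' : Summable fun i => ‖g' i‖) :
    HasSum (fun x : α × β => f x.1 * g x.2 + f' x.1 * g' x.2)
      (∑' i, (f i * ∑' j, g j + f' i * ∑' j, g' j)) := by
  rw [(hf.of_norm.mul_right _).tsum_add (hf'.of_norm.mul_right _), tsum_mul_right, tsum_mul_right]
  exact (hf.of_norm.hasSum.mul hg.of_norm.hasSum (summable_mul_of_summable_norm hf hg)).add
    (hf'.of_norm.hasSum.mul hg'.of_norm.hasSum (summable_mul_of_summable_norm hf' hg'))

lemma hasSum_integrand (ha : 0 < (a : ℝ)) (hD : 0 < b ^ 2 - 4 * a * c)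
    (δI : Disc (latticeI (formMatrix a b c))) (δN : Disc (latticeN (formMatrix a b c))) (s : ℝ) :
    HasSum (fun x : {Y : dual (latticeI (formMatrix a b c)) // toDisc _ Y = δI} ×
        {W : dual (latticeN (formMatrix a b c)) // toDisc _ W = δN} =>
      Complex.I * τ.im * (siegelTerm τ (geodesicPath a b c s) ((x.1.1 : V) + x.2.1) *
        ((-(4 * Real.pi * τ.im) *
          bil ((x.1.1 : V) + x.2.1) (posVec (geodesicPath a b c s)) : ℝ) : ℂ) *
        (posDerivX ((x.1.1 : V) + x.2.1) (geodesicPath a b c s) -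
          Complex.I * posDerivY ((x.1.1 : V) + x.2.1) (geodesicPath a b c s))) *
        deriv (geodesicPath a b c) s)
      (∑' Y : {Y : dual (latticeI (formMatrix a b c)) // toDisc _ Y = δI},
        kernel a b c τ
          (weightA a b c τ * (starRingEnd ℂ) (unaryTheta (formMatrix a b c) τ δN))
          (-(4 * Real.pi * τ.im ^ 2 * Complex.I) *
            ∑' W : {W : dual (latticeN (formMatrix a b c)) // toDisc _ W = δN},
              e ((q W.1 : ℂ) * (starRingEnd ℂ) (τ : ℂ))) Y.1 s) := by
  obtain ⟨k1, k2⟩ := summable_unary τ hD (fun W => toDisc _ W = δN)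
  have k := hasSum_mul_add_mul (summable_kernel τ 1 0 ha hD (fun Y => toDisc _ Y = δI) s)
    (summable_kernel τ 0 1 ha hD (fun Y => toDisc _ Y = δI) s)
    ((k2.mul_left ‖weightA a b c τ‖).congr fun W => (norm_mul _ _).symm)
    ((k1.mul_left ‖(-(4 * Real.pi * τ.im ^ 2 * Complex.I) : ℂ)‖).congr
      fun W => (norm_mul _ _).symm)
  rw [tsum_mul_left, tsum_mul_left, tsum_conj_unaryTerm] at k
  rw [tsum_congr fun Y : {Y : dual (latticeI (formMatrix a b c)) // toDisc _ Y = δI} =>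
    kernel_linear τ a b c _ _ Y.1 s]
  convert k using 2 with x
  exact integrand_summand τ ha hD x.1.1 x.2.1 s

/-- The class `γ` is split by `cosetMap`, and in each product the sum over `W` is carried out first,
leaving constant weights for the kernel in `Y`. In weight `2k = 2` the factor `A(z, 1)^{k-1}` is
`1`. -/
lemma cycleIntegrand_eq (ha : 0 < (a : ℝ)) (hD : 0 < b ^ 2 - 4 * a * c) (γ : Disc latticeL)
    (s : ℝ) :
    cycleIntegrand a b c 1 (raising 0 (fun z : ℂ => siegelTheta τ z γ)) s =
      ∑' β : latticeL ⧸ (latticeI (formMatrix a b c) ⊔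
        latticeN (formMatrix a b c)).addSubgroupOf latticeL,
        ∑' Y : {Y : dual (latticeI (formMatrix a b c)) // toDisc _ Y = classI hD γ β},
          kernel a b c τ
            (weightA a b c τ *
              (starRingEnd ℂ) (unaryTheta (formMatrix a b c) τ (classN hD γ β)))
            (-(4 * Real.pi * τ.im ^ 2 * Complex.I) *
              ∑' W : {W : dual (latticeN (formMatrix a b c)) //
                toDisc (latticeN (formMatrix a b c)) W = classN hD γ β},
                  e ((q W.1 : ℂ) * (starRingEnd ℂ) (τ : ℂ))) Y.1 s := by
  have hz := geodesicPath_im_pos ha (disc_pos_cast hD) s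
  have h1 := (raising_siegelTheta τ γ hz).mul_right (deriv (geodesicPath a b c) s)
  have h2 := (Equiv.ofBijective (cosetMap hD γ) (bijective_cosetMap hD γ)).hasSum_iff.2 h1
  rw [cycleIntegrand, sub_self, zpow_zero, mul_one]
  exact (h2.sigma fun β => hasSum_integrand τ ha hD (classI hD γ β) (classN hD γ β) s).tsum_eq.symm

/-- This is the final constant: `-4πv²√2/√D`, in which `√2/√D` is from the normal derivative, times
`1/√(2v)` from the Gaussian integral. -/
lemma weightA_mul_sqrt (a b c : ℝ) : weightA a b c τ *
    (√(Real.pi / (2 * Real.pi * τ.im)) : ℝ) =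
      (-(4 * Real.pi / √(b ^ 2 - 4 * a * c)) : ℝ) * ((τ.im ^ (3 / 2 : ℝ) : ℝ) : ℂ) := by
  have hv := τ.im_pos
  have hpi := Real.pi_pos
  rw [weightA, ← Complex.ofReal_mul, ← Complex.ofReal_mul]
  congr 1
  have h1 : Real.pi / (2 * Real.pi * τ.im) = 1 / (2 * τ.im) := by field_simp
  have h2 : τ.im ^ (3 / 2 : ℝ) = τ.im * √τ.im := by
    rw [show (3 / 2 : ℝ) = 1 + 1 / 2 by norm_num, Real.rpow_add hv, Real.rpow_one,
      Real.sqrt_eq_rpow]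
  have h3 : √τ.im ^ 2 = τ.im := Real.sq_sqrt hv.le
  have h4 : 0 < √τ.im := by positivity
  rw [h1, h2, Real.sqrt_div zero_le_one, Real.sqrt_one, Real.sqrt_mul two_pos.le]
  field_simp
  rw [h3]

lemma hasCycleIntegral_raising_siegelTheta (ha : 0 < (a : ℝ)) (hD : 0 < b ^ 2 - 4 * a * c)
    (hsq : ¬ IsSquare (b ^ 2 - 4 * a * c)) (γ : Disc latticeL) :
    HasCycleIntegral a b c 1 (raising 0 (fun z : ℂ => siegelTheta τ z γ))
      (-(4 * Real.pi / √((b : ℝ) ^ 2 - 4 * a * c) : ℝ) *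
        up latticeL (tensor (formMatrix a b c) (heckeTheta a b c τ)
          (fun δ => (starRingEnd ℂ) (unaryTheta (formMatrix a b c) τ δ) *
            ((τ.im ^ (3 / 2 : ℝ) : ℝ) : ℂ))) γ) := by
  have hD' := disc_pos_cast hD
  obtain ⟨g₀, hg₀, hpos, hgen⟩ := exists_generator ha hD hsq
  refine ⟨exists_isFundDomain ha hD' hg₀ hpos hgen, fun F hF => ?_⟩
  have hfin := finite_quotient hD
  have hfund := isAddFundamentalDomain_params ha hD' hg₀ hgen hF
  have hIoc := isAddFundamentalDomain_Ioc hpos 0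
  rw [zero_add] at hIoc
  have _ := Fintype.ofFinite (latticeL ⧸ (latticeI (formMatrix a b c) ⊔
    latticeN (formMatrix a b c)).addSubgroupOf latticeL)
  obtain ⟨x, hx⟩ : ∃ x : Disc (latticeN (formMatrix a b c)) → ℂ, x = fun δ =>
    weightA a b c τ * (starRingEnd ℂ) (unaryTheta (formMatrix a b c) τ δ) := ⟨_, rfl⟩
  -- The weight `y` of the exact part is kept abstract: it does not enter the value of the integral.
  obtain ⟨y, hJ⟩ : ∃ y : Disc (latticeN (formMatrix a b c)) → ℂ,
      cycleIntegrand a b c 1 (raising 0 (fun z : ℂ => siegelTheta τ z γ)) = fun s =>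
        ∑ β, ∑' Y : {Y : dual (latticeI (formMatrix a b c)) // toDisc _ Y = classI hD γ β},
          kernel a b c τ (x (classN hD γ β)) (y (classN hD γ β)) Y.1 s := by
    refine ⟨fun δ => -(4 * Real.pi * τ.im ^ 2 * Complex.I) *
      ∑' W : {W : dual (latticeN (formMatrix a b c)) // toDisc _ W = δ},
        e ((q W.1 : ℂ) * (starRingEnd ℂ) (τ : ℂ)), funext fun s => ?_⟩
    rw [cycleIntegrand_eq τ ha hD γ s, tsum_fintype, hx]
  rw [hJ]
  have hint (β) : IntegrableOn (fun s =>
      ∑' Y : {Y : dual (latticeI (formMatrix a b c)) // toDisc _ Y = classI hD γ β},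
        kernel a b c τ (x (classN hD γ β)) (y (classN hD γ β)) Y.1 s)
      (Set.Ioc 0 (shift a b c g₀)) :=
    ((continuousOn_tsum_kernel τ _ _ ha hD _ _).integrableOn_Icc).mono_set
      Set.Ioc_subset_Icc_self
  have hper (g : AddSubgroup.zmultiples (shift (a : ℝ) b c g₀)) (s : ℝ) :
      ∑ β, ∑' Y : {Y : dual (latticeI (formMatrix a b c)) // toDisc _ Y = classI hD γ β},
        kernel a b c τ (x (classN hD γ β)) (y (classN hD γ β)) Y.1 (g +ᵥ s) =
      ∑ β, ∑' Y : {Y : dual (latticeI (formMatrix a b c)) // toDisc _ Y = classI hD γ β},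
        kernel a b c τ (x (classN hD γ β)) (y (classN hD γ β)) Y.1 s := by
    obtain ⟨_, j, rfl⟩ := g
    refine Finset.sum_congr rfl fun β _ => ?_
    rw [show ((⟨_, j, rfl⟩ : AddSubgroup.zmultiples (shift (a : ℝ) b c g₀)) +ᵥ s) =
      j * shift a b c g₀ + s from congrArg (· + s) (zsmul_eq_mul _ j)]
    exact tsum_kernel_add τ _ _ ha hD hg₀ _ j s
  refine ⟨(hfund.integrableOn_iff hIoc hper).2 (integrable_finsetSum _ fun β _ => hint β), ?_⟩
  -- By periodicity `F` may be replaced by one period; the finite sum over `L/(I ⊕ N)` is then the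
  -- one in the definition of `up`, and the comparison is made for each `β`.
  rw [hfund.setIntegral_eq hIoc hper, integral_finsetSum _ fun β _ => hint β, up,
    finsum_eq_sum_of_fintype, Finset.mul_sum]
  refine Finset.sum_congr rfl fun β _ => ?_
  have h1 := coeff_tensor hD (heckeTheta a b c τ) (fun δ => (starRingEnd ℂ)
    (unaryTheta (formMatrix a b c) τ δ) * ((τ.im ^ (3 / 2 : ℝ) : ℝ) : ℂ)) γ β
  rw [cosetRep] at h1
  have h2 := weightA_mul_sqrt τ a b c
  rw [integral_tsum_kernel_eq τ _ _ ha hD hsq hg₀ hpos hgen, h1, hx]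
  push_cast at h2 ⊢
  linear_combination (starRingEnd ℂ (unaryTheta (formMatrix a b c) τ (classN hD γ β))) *
    heckeTheta a b c τ (classI hD γ β) * h2

end Final

end SiegelTheta

theorem theorem3p1 (a b c : ℤ) (ha : 0 < a) (hD : 0 < b ^ 2 - 4 * a * c)
    (hsq : ¬ IsSquare (b ^ 2 - 4 * a * c)) (τ : ℍ) :
    (∀ (γ : Disc latticeL) (z : ℂ), 0 < z.im →
      Summable (fun X : {X : dual latticeL // toDisc latticeL X = γ} => siegelTerm τ z X.1) ∧
        DifferentiableAt ℝ (fun z : ℂ => siegelTheta τ z γ) z) ∧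
    (∀ γ : Disc (latticeI (formMatrix a b c)),
      Summable (fun Y : Quotient (heckeSetoid (formMatrix a b c) γ) =>
        heckeTerm a b c τ (Quotient.out Y).1)) ∧
    (∀ γ : Disc (latticeN (formMatrix a b c)),
      Summable (fun W : {W : dual (latticeN (formMatrix a b c)) //
        toDisc (latticeN (formMatrix a b c)) W = γ} => unaryTerm (formMatrix a b c) τ W.1)) ∧
    Finite (latticeL ⧸ (latticeI (formMatrix a b c) ⊔ latticeN (formMatrix a b c)).addSubgroupOf
      latticeL) ∧
    ∀ γ : Disc latticeL,
      HasCycleIntegral a b c 1 (raising 0 (fun z : ℂ => siegelTheta τ z γ))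
        (-(4 * Real.pi / √((b : ℝ) ^ 2 - 4 * a * c) : ℝ) *
          up latticeL (tensor (formMatrix a b c) (heckeTheta a b c τ)
            (fun δ => (starRingEnd ℂ) (unaryTheta (formMatrix a b c) τ δ) *
              ((τ.im ^ (3 / 2 : ℝ) : ℝ) : ℂ))) γ) := by
  have ha' : (0 : ℝ) < a := by exact_mod_cast ha
  obtain ⟨g₀, hg₀, hpos, hgen⟩ := exists_generator ha' hD hsq
  exact ⟨fun γ z hz => ⟨summable_siegelTerm τ γ hz, differentiableAt_siegelTheta τ γ hz⟩,
    summable_heckeTerm τ ha' hD hg₀ hpos hgen, summable_unaryTerm τ hD, finite_quotient hD,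
    hasCycleIntegral_raising_siegelTheta τ ha' hD hsq⟩
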